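/- An instance of \textsc{Set Cover} or of \textsc{Set Partition} consists of a bipartite graph $G=(F\,\dot\cup\,U,E)$ with finite (possibly empty) sides $F$ and $U$, together with an integer $s\ge 0$. Write $n=|U|$, $m=|F|$, $N(f)=\{u\in U : (f,u)\in E\}$ for $f\in F$ (different $f$ may have equal neighbourhoods, and $N(f)$ may be empty), and $N(S)=\bigcup_{f\in S}N(f)$ for $S\subseteq F$. \textsc{Set Cover} asks whether there is $S\subseteq F$ with $N(S)=U$ and $|S|\le s$. \textsc{Set Partition} asks whether there is $S\subseteq F$ with $N(S)=U$, $|S|=s$, and $N(f)\cap N(f')=\emptyset$ for all distinct $f,f'\in S$. For real $\delta$, an $O^*(2^{\delta n})$-time algorithm for one of these problems is a deterministic algorithm that decides it correctly on every instance and runs in time at most $q(x)\cdot 2^{\delta n}$, where $q$ is a polynomial that does not depend on the instance and $x$ is the size of the input (the $n\times m$ incidence matrix, with the vertices of $F$ and $U$ counted, and $s$ in binary). Time is measured on a random-access machine with logarithmic cost: registers hold natural numbers; the instructions are loading a constant, addition, truncated subtraction, multiplication, integer division, indirect load and store, and tests for zero in conditionals and loops; each instruction costs one plus the bit lengths of the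 numbers it handles. Initially the registers hold $n$, $m$, $s$ and the incidence matrix. \textbf{Theorem.} There is an $\epsilon>0$ such that \textsc{Set Cover} has an $O^*(2^{(1-\epsilon)n})$-time algorithm if and only if there is an $\epsilon'>0$ such that \textsc{Set Partition} has an $O^*(2^{(1-\epsilon')n})$-time algorithm. -/

import Mathlib

/-! ### Set Cover and Set Partition -/

/-- An instance of Set Cover or of Set Partition: a bipartite graph between a family `F` of `m`
vertices and a universe `U` of `n` vertices, given by the neighbourhood `N f ⊆ U` of each `f` in
`F`, together with a number `s`. Different `f` may have the same neighbourhood, and a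
neighbourhood may be empty. -/
structure SetInstance where
  /-- the number of elements of the universe -/
  n : ℕ
  /-- the number of members of the family -/
  m : ℕ
  /-- the solution size -/
  s : ℕ
  /-- the neighbourhood in the universe of a member of the family -/
  N : Fin m → Finset (Fin n)

namespace SetInstance

/-- The Set Cover problem: is there `S ⊆ F` with `N(S) = U` and `|S| ≤ s`? -/
def HasSetCover (I : SetInstance) : Prop :=
  ∃ S : Finset (Fin I.m), S.biUnion I.N = Finset.univ ∧ S.card ≤ I.s

/-- The Set Partition problem: is there `S ⊆ F` with `N(S) = U` and `|S| = s` whose members have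
pairwise disjoint neighbourhoods? -/
def HasSetPartition (I : SetInstance) : Prop :=
  ∃ S : Finset (Fin I.m), S.biUnion I.N = Finset.univ ∧ S.card = I.s ∧
    ∀ f ∈ S, ∀ g ∈ S, f ≠ g → Disjoint (I.N f) (I.N g)

/-- The input size: an `n` by `m` incidence matrix, its two dimensions in unary, and `s` in binary
(a positive number that is polynomially related to the length of any usual encoding). -/
def size (I : SetInstance) : ℕ := (I.n + 1) * (I.m + 1) + Nat.size I.s

open Classical in
/-- The instance as the initial memory of a random-access machine: `n`, `m`, `s` in the registers
`0`, `1`, `2`, then the incidence matrix row by row (one row for each member of the family),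
and `0` in all other registers. -/
noncomputable def toMem (I : SetInstance) : ℕ → ℕ := fun a =>
  if a = 0 then I.n
  else if a = 1 then I.m
  else if a = 2 then I.s
  else if ∃ (f : Fin I.m) (u : Fin I.n), u ∈ I.N f ∧ a = 3 + (f : ℕ) * I.n + (u : ℕ) then 1
  else 0

end SetInstance

/-! ### Random-access machines with logarithmic cost

The memory is a sequence of registers `M 0, M 1, …` holding natural numbers. Programs have the
usual arithmetic instructions, indirect loads and stores, and structured control flow (which is
as powerful as jumps, up to a constant factor in the running time). Each instruction costs one
plus the bit lengths of the numbers it handles: register contents used as operands, run-time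
addresses, and the value written. -/

/-- Programs of a random-access machine. The arguments of the constructors are fixed register
addresses, except for the value `c` in `const d c`. -/
inductive RAMProg : Type
  /-- `M d := c` -/
  | const (d c : ℕ)
  /-- `M d := M a + M b` -/
  | add (d a b : ℕ)
  /-- `M d := M a - M b`, truncated at `0` -/
  | sub (d a b : ℕ)
  /-- `M d := M a * M b` -/
  | mul (d a b : ℕ)
  /-- `M d := ⌊M a / M b⌋`, and `0` if `M b = 0` -/
  | div (d a b : ℕ)
  /-- `M d := M (M a)` -/
  | load (d a : ℕ)
  /-- `M (M a) := M b` -/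
  | store (a b : ℕ)
  /-- `p`, then `q` -/
  | seq (p q : RAMProg)
  /-- if `M a ≠ 0` then `p` else `q` -/
  | ite (a : ℕ) (p q : RAMProg)
  /-- while `M a ≠ 0` do `p` -/
  | loop (a : ℕ) (p : RAMProg)

namespace RAMProg

/-- `Exec p M M' t`: started on the memory `M`, the program `p` halts with the memory `M'`, at
total logarithmic cost `t`. Here `Nat.size x` is the number of binary digits of `x`. -/
inductive Exec : RAMProg → (ℕ → ℕ) → (ℕ → ℕ) → ℕ → Prop
  | const (d c : ℕ) (M : ℕ → ℕ) :
      Exec (const d c) M (Function.update M d c) (1 + Nat.size c)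
  | add (d a b : ℕ) (M : ℕ → ℕ) :
      Exec (add d a b) M (Function.update M d (M a + M b))
        (1 + Nat.size (M a) + Nat.size (M b) + Nat.size (M a + M b))
  | sub (d a b : ℕ) (M : ℕ → ℕ) :
      Exec (sub d a b) M (Function.update M d (M a - M b))
        (1 + Nat.size (M a) + Nat.size (M b) + Nat.size (M a - M b))
  | mul (d a b : ℕ) (M : ℕ → ℕ) :
      Exec (mul d a b) M (Function.update M d (M a * M b))
        (1 + Nat.size (M a) + Nat.size (M b) + Nat.size (M a * M b))
  | div (d a b : ℕ) (M : ℕ → ℕ) :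
      Exec (div d a b) M (Function.update M d (M a / M b))
        (1 + Nat.size (M a) + Nat.size (M b) + Nat.size (M a / M b))
  | load (d a : ℕ) (M : ℕ → ℕ) :
      Exec (load d a) M (Function.update M d (M (M a)))
        (1 + Nat.size (M a) + Nat.size (M (M a)))
  | store (a b : ℕ) (M : ℕ → ℕ) :
      Exec (store a b) M (Function.update M (M a) (M b))
        (1 + Nat.size (M a) + Nat.size (M b))
  | seq {p q : RAMProg} {M M' M'' : ℕ → ℕ} {t t' : ℕ} :
      Exec p M M' t → Exec q M' M'' t' → Exec (seq p q) M M'' (t + t')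
  | ite_true {a : ℕ} {p q : RAMProg} {M M' : ℕ → ℕ} {t : ℕ} :
      M a ≠ 0 → Exec p M M' t → Exec (ite a p q) M M' (1 + Nat.size (M a) + t)
  | ite_false {a : ℕ} {p q : RAMProg} {M M' : ℕ → ℕ} {t : ℕ} :
      M a = 0 → Exec q M M' t → Exec (ite a p q) M M' (1 + Nat.size (M a) + t)
  | loop_true {a : ℕ} {p : RAMProg} {M M' M'' : ℕ → ℕ} {t t' : ℕ} :
      M a ≠ 0 → Exec p M M' t → Exec (loop a p) M' M'' t' →
        Exec (loop a p) M M'' (1 + Nat.size (M a) + t + t')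
  | loop_false {a : ℕ} {p : RAMProg} {M : ℕ → ℕ} :
      M a = 0 → Exec (loop a p) M M (1 + Nat.size (M a))

end RAMProg

/-- There is an algorithm deciding the problem `Q` (the set of its yes-instances) in time
`O*(2^(δ n))`: one program halts on every instance, with `1` in register `0` on yes-instances and
`0` on no-instances, in time at most a fixed polynomial in the input size times `2^(δ n)`. -/
def SolvableInTime (Q : SetInstance → Prop) (δ : ℝ) : Prop :=
  ∃ (p : RAMProg) (C : ℝ) (k : ℕ), ∀ I : SetInstance, ∃ (M' : ℕ → ℕ) (t : ℕ),
    p.Exec I.toMem M' t ∧ (Q I → M' 0 = 1) ∧ (¬ Q I → M' 0 = 0) ∧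
      (t : ℝ) ≤ C * (I.size : ℝ) ^ k * (2 : ℝ) ^ (δ * (I.n : ℝ))

/-! Each direction is a reduction that spends time O*(2^(δn)) with some δ < 1 on preparation and
then calls the assumed algorithm once, on an instance whose universe exceeds n by at most a
logarithmic term.

From Set Cover to Set Partition, fix a large D and call a member large if it has more than k = ⌊n/D⌋
elements. Covers that use a large member are found by dynamic programming over the unions of
families containing one. Such a union is determined by a large member and a subset of the fewer than
n - k elements outside of it, so there are at most about m 2^(n-k) of them (`card_coverCodes_le`).
For covers without large members, every small member is replaced by all its subsets, at most 2^k
each. Assigning each element to one member that contains it turns a cover into a partition by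
subsets, and empty sets pad the number of parts to exactly min(s, n) (`hasCover_iff`). The family
grows by a factor of about 2^k. A polynomial of degree K in the input size thus costs 2^(Kk), which
half of the gain ε absorbs once D ≥ 2K/ε.

From Set Partition to Set Cover, call a disjoint family of nonempty members a packing. Merging small
parts greedily, the nonempty members of a partition split into at most 2D packings, each either with
at most n/D elements in its union or with a single member (`exists_coloring`). For large D there are
only 2^(ηn) sets with at most n/D elements (`exists_smallSets_le`), so all pairs (union, number of
members) of such packings can be tabulated (`packings_sound`, `packings_complete`). Sets that cover
the universe are disjoint exactly when their sizes add up to n. Hence a partition amounts to T = 2D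
table entries whose unions cover the universe, whose sizes add up to n, and whose numbers add up to
s, apart from empty members (`exists_codes_of_hasPartition`, `hasPartition_of_codes`).

The condition on the sums is moved into the Set Cover instance itself. A candidate set carries a
table entry, a position and the sum of the weights at earlier positions. One extra element per
position forces exactly one set per position when only T sets are allowed. Two extra elements per
position and binary digit can be covered only if the sum leaving a position equals the sum entering
the next one (`hasCover_chainRow`, `exists_codes_of_hasCover_chainRow`). These are O(log n) extra
elements for fixed D, so they cost only a polynomial factor.

The machine side rests on a small language of expressions without side effects and counted loops.
Its compiled code is correct with a cost per step that is polynomial in the word length (`Ex.runs`,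
`Tr.rep`, `Cmd.polyBound_tau`). The assumed program runs unchanged inside every fourth memory cell
(`exec_hosted`), and `solvableInTime_of_cmd` reduces each direction to a step count and a loop
invariant. -/

set_option linter.unusedSimpArgs false

/-! ### A small structured language compiled to random-access machines -/

namespace RAM

open RAMProg Function

/-- The state of a structured program: registers and memory cells. -/
structure St where
  /-- the registers; those below `32` are available to programs -/
  r : ℕ → ℕ
  /-- the memory cells -/
  c : ℕ → ℕ

/-- Assign to a register. -/
def St.set (σ : St) (x v : ℕ) : St := ⟨update σ.r x v, σ.c⟩

/-- Assign to a memory cell. -/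
def St.put (σ : St) (a v : ℕ) : St := ⟨σ.r, update σ.c a v⟩

@[simp] theorem St.set_c (σ : St) (x v : ℕ) : (σ.set x v).c = σ.c := rfl
@[simp] theorem St.put_r (σ : St) (x v : ℕ) : (σ.put x v).r = σ.r := rfl
@[simp] theorem St.set_r (σ : St) (x v y : ℕ) :
    (σ.set x v).r y = if y = x then v else σ.r y := by
  simp [St.set, update_apply]
@[simp] theorem St.put_c (σ : St) (x v y : ℕ) :
    (σ.put x v).c y = if y = x then v else σ.c y := by
  simp [St.put, update_apply]

/-- The memory `M` represents the state `σ`: registers `0, …, 31` in place, scratch space in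
`32, …, 95`, and the memory cells from `96` on. -/
structure Sim (M : ℕ → ℕ) (σ : St) : Prop where
  reg : ∀ x < 32, M x = σ.r x
  cell : ∀ a, M (96 + a) = σ.c a

/-- All numbers in the state have at most `w` binary digits. -/
structure Bdd (w : ℕ) (σ : St) : Prop where
  reg : ∀ x < 32, σ.r x < 2 ^ w
  cell : ∀ a, σ.c a < 2 ^ w

theorem Bdd.mono {w v : ℕ} {σ : St} (h : Bdd w σ) (hwv : w ≤ v) : Bdd v σ :=
  ⟨fun x hx => (h.reg x hx).trans_le (Nat.pow_le_pow_right two_pos hwv),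
    fun a => (h.cell a).trans_le (Nat.pow_le_pow_right two_pos hwv)⟩

theorem Bdd.set {w : ℕ} {σ : St} (h : Bdd w σ) {x v : ℕ} (hv : v < 2 ^ w) : Bdd w (σ.set x v) :=
  ⟨fun y hy => by rw [St.set_r]; split_ifs; exacts [hv, h.reg y hy], h.cell⟩

theorem Bdd.put {w : ℕ} {σ : St} (h : Bdd w σ) {x v : ℕ} (hv : v < 2 ^ w) : Bdd w (σ.put x v) :=
  ⟨h.reg, fun y => by rw [St.put_c]; split_ifs; exacts [hv, h.cell y]⟩

theorem Sim.set {M : ℕ → ℕ} {σ : St} (h : Sim M σ) {x v : ℕ} (hx : x < 32) :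
    Sim (update M x v) (σ.set x v) :=
  ⟨fun y hy => by simp [update_apply, h.reg y hy],
    fun a => by simp [h.cell a, show ¬ (96 + a = x) by omega]⟩

theorem Sim.put {M : ℕ → ℕ} {σ : St} (h : Sim M σ) {a v : ℕ} :
    Sim (update M (96 + a) v) (σ.put a v) :=
  ⟨fun y hy => by simp [h.reg y hy, show ¬ (y = 96 + a) by omega],
    fun b => by simp [update_apply, h.cell b]⟩

/-- The memories agree outside of the scratch registers from `t` on. -/
def Fr (t : ℕ) (M M' : ℕ → ℕ) : Prop := ∀ a, a < t ∨ 96 ≤ a → M' a = M a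

theorem Fr.trans {t : ℕ} {M M' M'' : ℕ → ℕ} (h : Fr t M M') (h' : Fr t M' M'') : Fr t M M'' :=
  fun a ha => (h' a ha).trans (h a ha)

theorem Fr.mono {t t' : ℕ} {M M' : ℕ → ℕ} (h : Fr t M M') (ht : t' ≤ t) : Fr t' M M' :=
  fun a ha => h a (by omega)

theorem Fr.update {t x v : ℕ} {M : ℕ → ℕ} (hx : t ≤ x) (hx' : x < 96) :
    Fr t M (update M x v) :=
  fun a ha => by rw [update_apply, if_neg (by omega)]

theorem Sim.fr {t : ℕ} {M M' : ℕ → ℕ} {σ : St} (h : Sim M σ) (hf : Fr t M M') (ht : 32 ≤ t) :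
    Sim M' σ :=
  ⟨fun x hx => (hf x (by omega)).trans (h.reg x hx), fun a => (hf _ (by omega)).trans (h.cell a)⟩

/-- `p` leads from `M` to `M'` at cost at most `k`. -/
def Ev (p : RAMProg) (M M' : ℕ → ℕ) (k : ℕ) : Prop := ∃ j, Exec p M M' j ∧ j ≤ k

theorem Ev.mono {p : RAMProg} {M M' : ℕ → ℕ} {k l : ℕ} (h : Ev p M M' k) (hkl : k ≤ l) :
    Ev p M M' l := by
  obtain ⟨j, h, hj⟩ := h
  exact ⟨j, h, hj.trans hkl⟩

theorem Ev.seq {p q : RAMProg} {M M' M'' : ℕ → ℕ} {k l : ℕ} (h : Ev p M M' k)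
    (h' : Ev q M' M'' l) : Ev (seq p q) M M'' (k + l) := by
  obtain ⟨j, h, hj⟩ := h
  obtain ⟨i, h', hi⟩ := h'
  exact ⟨_, h.seq h', by omega⟩

theorem Ev.const (d : ℕ) (M : ℕ → ℕ) {c p : ℕ} (hc : Nat.size c ≤ p) :
    Ev (const d c) M (update M d c) (1 + p) :=
  ⟨_, Exec.const d c M, by omega⟩

/-- The arithmetic operations. -/
inductive Op : Type
  | add
  | sub
  | mul
  | div

/-- The function of two numbers that an operation computes. -/
def Op.fn : Op → ℕ → ℕ → ℕ
  | .add, x, y => x + y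
  | .sub, x, y => x - y
  | .mul, x, y => x * y
  | .div, x, y => x / y

/-- The machine instruction of an operation. -/
def Op.prog : Op → ℕ → ℕ → ℕ → RAMProg
  | .add => RAMProg.add
  | .sub => RAMProg.sub
  | .mul => RAMProg.mul
  | .div => RAMProg.div

/-- The product needs p + q digits and the sum at most one more than the larger operand, so a single
bound serves all four operations. -/
theorem Op.fn_size (o : Op) {x y p q : ℕ} (hx : Nat.size x ≤ p) (hy : Nat.size y ≤ q) :
    Nat.size (o.fn x y) ≤ p + q + 1 := by
  rw [Nat.size_le] at *
  have h1 : 2 ^ p ≤ 2 ^ (p + q) := Nat.pow_le_pow_right two_pos (by omega)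
  have h2 : 2 ^ q ≤ 2 ^ (p + q) := Nat.pow_le_pow_right two_pos (by omega)
  have h3 : 2 ^ (p + q + 1) = 2 * 2 ^ (p + q) := by ring
  have h4 : x * y ≤ 2 ^ (p + q) := by rw [pow_add]; exact Nat.mul_le_mul hx.le hy.le
  have h5 : x / y ≤ x := Nat.div_le_self x y
  have h6 : 0 < 2 ^ (p + q) := by positivity
  cases o <;> simp only [Op.fn] <;> omega

theorem Ev.op (o : Op) (d : ℕ) {a b p q : ℕ} {M : ℕ → ℕ} (ha : Nat.size (M a) ≤ p)
    (hb : Nat.size (M b) ≤ q) :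
    Ev (o.prog d a b) M (update M d (o.fn (M a) (M b))) (2 + 2 * (p + q)) := by
  have := o.fn_size ha hb
  refine ⟨1 + Nat.size (M a) + Nat.size (M b) + Nat.size (o.fn (M a) (M b)), ?_, by omega⟩
  cases o
  exacts [Exec.add d a b M, Exec.sub d a b M, Exec.mul d a b M, Exec.div d a b M]

/-- Copy register `a` to register `d`. -/
def copy (d a : ℕ) : RAMProg := seq (RAMProg.const d 0) (RAMProg.add d d a)

theorem Ev.copy {d a p : ℕ} {M : ℕ → ℕ} (hda : d ≠ a) (ha : Nat.size (M a) ≤ p) :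
    Ev (RAM.copy d a) M (update M d (M a)) (3 + 2 * p) := by
  have h := (Ev.const d M (c := 0) (p := 0) (by simp)).seq
    (Ev.op .add d (a := d) (b := a) (p := 0) (q := p) (M := update M d 0) (by simp)
      (by simpa [update_apply, hda.symm] using ha))
  simp only [update_self, Op.fn, zero_add, update_idem, update_of_ne hda.symm] at h
  exact Ev.mono h (by omega)

theorem Ev.load (d : ℕ) {a p q : ℕ} {M : ℕ → ℕ} (ha : Nat.size (M a) ≤ p)
    (hb : Nat.size (M (M a)) ≤ q) :
    Ev (RAMProg.load d a) M (update M d (M (M a))) (1 + p + q) :=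
  ⟨_, Exec.load d a M, by omega⟩

theorem Ev.store {a b p q : ℕ} {M : ℕ → ℕ} (ha : Nat.size (M a) ≤ p) (hb : Nat.size (M b) ≤ q) :
    Ev (RAMProg.store a b) M (update M (M a) (M b)) (1 + p + q) :=
  ⟨_, Exec.store a b M, by omega⟩

theorem Ev.loop_false {a : ℕ} {p : RAMProg} {M : ℕ → ℕ} (h : M a = 0) :
    Ev (loop a p) M M 1 :=
  ⟨_, Exec.loop_false h, by simp [h]⟩

theorem Ev.loop_true {a : ℕ} {p : RAMProg} {M M' M'' : ℕ → ℕ} {k l s : ℕ} (h : M a ≠ 0)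
    (hs : Nat.size (M a) ≤ s) (hp : Ev p M M' k) (hl : Ev (loop a p) M' M'' l) :
    Ev (loop a p) M M'' (1 + s + k + l) := by
  obtain ⟨j, hp, hj⟩ := hp
  obtain ⟨i, hl, hi⟩ := hl
  exact ⟨_, Exec.loop_true h hp hl, by omega⟩

/-- Expressions: constants, registers, arithmetic, memory cells, sums `∑ x < b, e` whose bound is
in a register, powers of two, and local definitions. -/
inductive Ex : Type
  | con (c : ℕ)
  | reg (x : ℕ)
  | op (o : Op) (a b : Ex)
  | cell (a : Ex)
  | sum (x b : ℕ) (e : Ex)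
  | pow2 (b : ℕ)
  | lett (x : ℕ) (a e : Ex)

namespace Ex

/-- The value of an expression. -/
def eval : Ex → St → ℕ
  | con c, _ => c
  | reg x, σ => σ.r x
  | op o a b, σ => o.fn (a.eval σ) (b.eval σ)
  | cell a, σ => σ.c (a.eval σ)
  | sum x b e, σ => ∑ i ∈ Finset.range (σ.r b), e.eval (σ.set x i)
  | pow2 b, σ => 2 ^ σ.r b
  | lett x a e, σ => e.eval (σ.set x (a.eval σ))

/-- The expression uses admissible registers, and its loops have length at most `l`. -/
def Ok (l : ℕ) : Ex → St → Prop
  | con _, _ => True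
  | reg x, _ => x < 32
  | op _ a b, σ => a.Ok l σ ∧ b.Ok l σ
  | cell a, σ => a.Ok l σ
  | sum x b e, σ => x < 32 ∧ b < 32 ∧ x ≠ b ∧ σ.r b ≤ l ∧ ∀ i < σ.r b, e.Ok l (σ.set x i)
  | pow2 b, σ => b < 32 ∧ σ.r b ≤ l
  | lett x a e, σ => x < 32 ∧ a.Ok l σ ∧ e.Ok l (σ.set x (a.eval σ))

/-- A bound for the number of scratch registers. -/
def ht : Ex → ℕ
  | con _ => 1
  | reg _ => 1
  | op _ a b => max a.ht (b.ht + 1)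
  | cell a => max a.ht 2
  | sum _ _ e => max (e.ht + 3) 4
  | pow2 _ => 3
  | lett _ a e => max (a.ht + 1) (e.ht + 2)

/-- A bound for the number of digits of the value. -/
def sz : Ex → ℕ → ℕ
  | con c, _ => Nat.size c
  | reg _, w => w
  | op _ a b, w => a.sz w + b.sz w + 1
  | cell _, w => w
  | sum _ _ e, w => w + e.sz w
  | pow2 _, w => w + 1
  | lett _ a e, w => e.sz (w + a.sz w)

/-- A bound for the time to evaluate the expression. -/
def tb : Ex → ℕ → ℕ
  | con c, _ => 1 + Nat.size c
  | reg _, w => 3 + 2 * w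
  | op _ a b, w => a.tb w + b.tb w + (2 + 2 * (a.sz w + b.sz w))
  | cell a, w => a.tb w + (50 + 4 * a.sz w + w)
  | sum _ _ e, w => w * (e.tb w + 20 + 20 * w + 10 * e.sz w) + 30 + 20 * w
  | pow2 _, w => w * (30 + 10 * w) + 30 + 10 * w
  | lett _ a e, w => a.tb w + e.tb (w + a.sz w) + 20 + 10 * (w + a.sz w) + 10 * e.sz (w + a.sz w)

/-- The code that evaluates the expression into register `t`, using the scratch registers from
`t` on. -/
def comp : Ex → ℕ → RAMProg
  | con c, t => const t c
  | reg x, t => copy t x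
  | op o a b, t => seq (a.comp t) (seq (b.comp (t + 1)) (o.prog t t (t + 1)))
  | cell a, t =>
      seq (a.comp t) (seq (const (t + 1) 96) (seq (Op.add.prog t t (t + 1)) (load t t)))
  | sum x b e, t =>
      seq (const t 0) (seq (copy (t + 1) x) (seq (const x 0) (seq (Op.sub.prog (t + 2) b x)
        (seq (loop (t + 2) (seq (e.comp (t + 3)) (seq (Op.add.prog t t (t + 3))
          (seq (const (t + 3) 1) (seq (Op.add.prog x x (t + 3)) (Op.sub.prog (t + 2) b x))))))
          (copy x (t + 1))))))
  | pow2 b, t =>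
      seq (const t 1) (seq (copy (t + 1) b) (seq (const (t + 2) 1)
        (loop (t + 1) (seq (Op.add.prog t t t) (Op.sub.prog (t + 1) (t + 1) (t + 2))))))
  | lett x a e, t =>
      seq (copy t x) (seq (a.comp (t + 1)) (seq (copy x (t + 1)) (seq (e.comp (t + 2))
        (seq (copy x t) (copy t (t + 2))))))

/-- The loop bound l ≤ w enters through `pow2`, whose exponent is at most l. A sum has fewer than
2^w terms, which adds at most w digits. -/
theorem eval_size {e : Ex} {l w : ℕ} {σ : St} (hl : l ≤ w) (hσ : Bdd w σ) (h : e.Ok l σ) :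
    Nat.size (e.eval σ) ≤ e.sz w := by
  induction e generalizing w σ with
  | con c => exact le_rfl
  | reg x => exact Nat.size_le.2 (hσ.reg x h)
  | op o a b iha ihb => exact o.fn_size (iha hl hσ h.1) (ihb hl hσ h.2)
  | cell a _ => exact Nat.size_le.2 (hσ.cell _)
  | sum x b e ih =>
    obtain ⟨hx, hb, hxb, hbl, h⟩ := h
    rw [Nat.size_le]
    have hw := hσ.reg b hb
    calc ∑ i ∈ Finset.range (σ.r b), e.eval (σ.set x i)
        ≤ ∑ i ∈ Finset.range (σ.r b), 2 ^ e.sz w := Finset.sum_le_sum fun i hi =>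
          (Nat.size_le.1 (ih hl (hσ.set ((Finset.mem_range.1 hi).trans hw))
            (h i (Finset.mem_range.1 hi)))).le
      _ = σ.r b * 2 ^ e.sz w := by simp
      _ < 2 ^ w * 2 ^ e.sz w := Nat.mul_lt_mul_of_pos_right hw (by positivity)
      _ = 2 ^ (w + e.sz w) := by rw [pow_add]
  | pow2 b =>
    rw [Nat.size_le]
    exact Nat.pow_lt_pow_right one_lt_two (by have := h.2; simp only [sz]; omega)
  | lett x a e iha ihe =>
    obtain ⟨hx, h1, h2⟩ := h
    exact ihe (by omega) ((hσ.mono (by omega)).set ((Nat.size_le.1 (iha hl hσ h1)).trans_le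
      (Nat.pow_le_pow_right two_pos (by omega)))) h2

end Ex

end RAM

/-! ### Correctness and cost of compiled expressions -/

namespace RAM

open RAMProg Function

theorem St.set_set (σ : St) (x v v' : ℕ) : (σ.set x v).set x v' = σ.set x v' := by
  simp [St.set]

theorem Sim.scratch {M : ℕ → ℕ} {σ : St} (h : Sim M σ) {x v : ℕ} (hx : 32 ≤ x) (hx' : x < 96) :
    Sim (update M x v) σ :=
  h.fr (Fr.update hx hx') le_rfl

namespace Ex

/-- The compiled code of an expression evaluates it. -/
def Runs (e : Ex) : Prop :=
  ∀ (l w : ℕ) (σ : St) (M : ℕ → ℕ) (t : ℕ), l ≤ w → Bdd w σ → e.Ok l σ → Sim M σ → 32 ≤ t →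
    t + e.ht ≤ 96 → ∃ M', Ev (e.comp t) M M' (e.tb w) ∧ M' t = e.eval σ ∧ Fr t M M'

theorem runs_con (c : ℕ) : (con c).Runs := fun l w σ M t hl hσ ho hM ht hh =>
  ⟨_, Ev.const t M le_rfl, by simp [eval], Fr.update le_rfl (by simp [Ex.ht] at hh; omega)⟩

theorem runs_reg (x : ℕ) : (reg x).Runs := by
  intro l w σ M t hl hσ ho hM ht hh
  simp only [Ok, Ex.ht] at ho hh
  have hx := hM.reg x ho
  exact ⟨_, Ev.copy (by omega) (by rw [hx, Nat.size_le]; exact hσ.reg x ho), by simp [eval, hx],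
    Fr.update le_rfl (by omega)⟩

/-- The value of a waits in scratch register t while b is evaluated from t + 1 on; this is the
reason for the height max a.ht (b.ht + 1). -/
theorem runs_op (o : Op) {a b : Ex} (ha : a.Runs) (hb : b.Runs) : (op o a b).Runs := by
  intro l w σ M t hl hσ ho hM ht hh
  simp only [Ok, Ex.ht] at ho hh
  obtain ⟨M1, h1, e1, f1⟩ := ha l w σ M t hl hσ ho.1 hM ht (by omega)
  obtain ⟨M2, h2, e2, f2⟩ := hb l w σ M1 (t + 1) hl hσ ho.2 (hM.fr f1 ht) (by omega) (by omega)
  have e3 : M2 t = a.eval σ := (f2 t (by omega)).trans e1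
  refine ⟨_, (h1.seq (h2.seq (Ev.op o t (p := a.sz w) (q := b.sz w) ?_ ?_))).mono ?_, ?_,
    (f1.trans (f2.mono (by omega))).trans (Fr.update le_rfl (by omega))⟩
  · rw [e3]; exact eval_size hl hσ ho.1
  · rw [e2]; exact eval_size hl hσ ho.2
  · simp only [tb]; omega
  · simp [eval, e2, e3]

theorem runs_cell {a : Ex} (ha : a.Runs) : (cell a).Runs := by
  intro l w σ M t hl hσ ho hM ht hh
  simp only [Ok, Ex.ht] at ho hh
  obtain ⟨M1, h1, e1, f1⟩ := ha l w σ M t hl hσ ho hM ht (by omega)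
  have hs := eval_size hl hσ ho
  have h96 : Nat.size 96 ≤ 7 := by decide
  have e2 : (update (update M1 (t + 1) 96) t (96 + a.eval σ)) t = 96 + a.eval σ := by simp
  have f2 : Fr t M (update (update M1 (t + 1) 96) t (96 + a.eval σ)) :=
    (f1.trans (Fr.update (by omega) (by omega))).trans (Fr.update le_rfl (by omega))
  have e3 : (update (update M1 (t + 1) 96) t (96 + a.eval σ)) (96 + a.eval σ)
      = σ.c (a.eval σ) := by rw [f2 _ (by omega), hM.cell]
  have h3 := Ev.op .add t (a := t) (b := t + 1) (p := a.sz w) (q := 7)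
    (M := update M1 (t + 1) 96) (by simpa [e1] using hs) (by simpa using h96)
  have e4 : Op.add.fn (update M1 (t + 1) 96 t) (update M1 (t + 1) 96 (t + 1))
      = 96 + a.eval σ := by simp [e1, Op.fn, add_comm]
  rw [e4] at h3
  have hs' := Op.fn_size .add (x := 96) (y := a.eval σ) h96 hs
  have h4 := Ev.load t (a := t) (M := update (update M1 (t + 1) 96) t (96 + a.eval σ))
    (p := 7 + a.sz w + 1) (q := w) (by rw [e2]; exact hs')
    (by rw [e2, e3, Nat.size_le]; exact hσ.cell _)
  rw [e2, e3] at h4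
  refine ⟨_, (h1.seq ((Ev.const (t + 1) M1 h96).seq (h3.seq h4))).mono ?_, by simp [eval],
    f2.trans (Fr.update le_rfl (by omega))⟩
  simp only [tb]; omega

/-- The old content of register x is saved in scratch register t and restored after the evaluation
of e, so a local definition leaves no trace outside of the scratch space. The body runs at word
length w + a.sz w, because x may now hold a longer number. -/
theorem runs_lett (x : ℕ) {a e : Ex} (ha : a.Runs) (he : e.Runs) : (lett x a e).Runs := by
  intro l w σ M t hl hσ ho hM ht hh
  simp only [Ok, Ex.ht] at ho hh
  obtain ⟨hx, ho1, ho2⟩ := ho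
  have ex := hM.reg x hx
  have sx : Nat.size (σ.r x) ≤ w := Nat.size_le.2 (hσ.reg x hx)
  have h1 := Ev.copy (d := t) (a := x) (M := M) (p := w) (by omega) (by rwa [ex])
  obtain ⟨M2, h2, e2, f2⟩ := ha l w σ (update M t (M x)) (t + 1) hl hσ ho1
    (hM.scratch ht (by omega)) (by omega) (by omega)
  have hM2 : Sim M2 σ := (hM.scratch ht (by omega)).fr f2 (by omega)
  have sa := eval_size hl hσ ho1
  have h3 := Ev.copy (d := x) (a := t + 1) (M := M2) (p := a.sz w) (by omega) (by rwa [e2])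
  rw [e2] at h3
  have hσ' : Bdd (w + a.sz w) (σ.set x (a.eval σ)) := (hσ.mono (by omega)).set
    ((Nat.size_le.1 sa).trans_le (Nat.pow_le_pow_right two_pos (by omega)))
  obtain ⟨M4, h4, e4, f4⟩ := he l (w + a.sz w) _ (update M2 x (a.eval σ)) (t + 2) (by omega) hσ'
    ho2 (hM2.set hx) (by omega) (by omega)
  have et : M4 t = σ.r x := by
    rw [f4 t (by omega), update_of_ne (by omega), f2 t (by omega), update_self, ex]
  have h5 := Ev.copy (d := x) (a := t) (M := M4) (p := w) (by omega) (by rwa [et])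
  rw [et] at h5
  have ee := eval_size (by omega) hσ' ho2
  have e5 : update M4 x (σ.r x) (t + 2) = e.eval (σ.set x (a.eval σ)) := by
    rw [update_of_ne (by omega), e4]
  have h6 := Ev.copy (d := t) (a := t + 2) (M := update M4 x (σ.r x))
    (p := e.sz (w + a.sz w)) (by omega) (by rw [e5]; exact ee)
  rw [e5] at h6
  refine ⟨_, (h1.seq (h2.seq (h3.seq (h4.seq (h5.seq h6))))).mono ?_, by simp [eval], ?_⟩
  · simp only [tb]; omega
  · intro b hb
    rw [update_of_ne (by omega)]
    rcases eq_or_ne b x with rfl | hbx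
    · rw [update_self, ex]
    · rw [update_of_ne hbx, f4 b (by omega), update_of_ne hbx, f2 b (by omega),
        update_of_ne (by omega)]

theorem runs_pow2 (b : ℕ) : (pow2 b).Runs := by
  intro l w σ M t hl hσ ho hM ht hh
  simp only [Ok, Ex.ht] at ho hh
  obtain ⟨hb, hbl⟩ := ho
  have eb := hM.reg b hb
  have sb : Nat.size (σ.r b) ≤ w := Nat.size_le.2 (hσ.reg b hb)
  have key : ∀ d i M0, i + d = σ.r b → M0 t = 2 ^ i → M0 (t + 1) = d → M0 (t + 2) = 1 →
      ∃ M', Ev (loop (t + 1) (seq (Op.add.prog t t t) (Op.sub.prog (t + 1) (t + 1) (t + 2))))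
        M0 M' (d * (30 + 10 * w) + 1) ∧ M' t = 2 ^ σ.r b ∧ Fr t M0 M' := by
    intro d
    induction d with
    | zero =>
      intro i M0 hi h0 h1 h2
      refine ⟨M0, (Ev.loop_false h1).mono (by omega), by rw [h0, ← hi, add_zero], fun _ _ => rfl⟩
    | succ d ih =>
      intro i M0 hi h0 h1 h2
      have si : Nat.size (2 ^ i) ≤ w + 1 := by
        rw [Nat.size_le]; exact Nat.pow_lt_pow_right one_lt_two (by omega)
      have sd : Nat.size (d + 1) ≤ w :=
        (Nat.size_le_size (show d + 1 ≤ σ.r b by omega)).trans sb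
      have g1 := Ev.op .add t (a := t) (b := t) (M := M0) (p := w + 1) (q := w + 1)
        (by rwa [h0]) (by rwa [h0])
      have g2 := Ev.op .sub (t + 1) (a := t + 1) (b := t + 2)
        (M := update M0 t (Op.add.fn (M0 t) (M0 t))) (p := w) (q := 1)
        (by simpa [h1] using sd) (by simp [h2])
      obtain ⟨M', h3, e3, f3⟩ := ih (i + 1) _ (by omega)
        (show (update (update M0 t (Op.add.fn (M0 t) (M0 t))) (t + 1)
          (Op.sub.fn (update M0 t (Op.add.fn (M0 t) (M0 t)) (t + 1))
          (update M0 t (Op.add.fn (M0 t) (M0 t)) (t + 2)))) t = 2 ^ (i + 1) by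
            simp [Op.fn, h0]; ring)
        (by simp [Op.fn, h1, h2]) (by simp [h2])
      refine ⟨M', (Ev.loop_true (s := w) (by omega) (by rwa [h1]) (g1.seq g2) h3).mono ?_, e3, ?_⟩
      · rw [Nat.succ_mul d]; omega
      · exact ((Fr.update le_rfl (by omega)).trans (Fr.update (by omega) (by omega))).trans f3
  have g1 := Ev.const t M (c := 1) (p := 1) (by simp)
  have g2 := Ev.copy (d := t + 1) (a := b) (M := update M t 1) (p := w) (by omega)
    (by rw [update_of_ne (by omega), eb]; exact sb)
  rw [update_of_ne (a := b) (by omega), eb] at g2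
  have g3 := Ev.const (t + 2) (update (update M t 1) (t + 1) (σ.r b)) (c := 1) (p := 1) (by simp)
  obtain ⟨M', h4, e4, f4⟩ := key (σ.r b) 0 _ (by omega)
    (show update (update (update M t 1) (t + 1) (σ.r b)) (t + 2) 1 t = 2 ^ 0 by simp)
    (by simp) (by simp)
  refine ⟨M', (g1.seq (g2.seq (g3.seq h4))).mono ?_, e4,
    (((Fr.update le_rfl (by omega)).trans (Fr.update (by omega) (by omega))).trans
      (Fr.update (by omega) (by omega))).trans f4⟩
  have := Nat.mul_le_mul_right (30 + 10 * w) (hbl.trans hl)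
  simp only [tb]; omega

/-- Scratch register t holds the partial sum, t + 1 the saved content of x, and t + 2 the number of
rounds left, which is what the loop tests. The summand uses the scratch space from t + 3 on. -/
theorem runs_sum (x b : ℕ) {e : Ex} (he : e.Runs) : (sum x b e).Runs := by
  intro l w σ M t hl hσ ho hM ht hh
  have stot : ∀ i ≤ σ.r b, Nat.size (∑ j ∈ Finset.range i, e.eval (σ.set x j)) ≤ w + e.sz w :=
    fun i hi => (Nat.size_le_size (Finset.sum_le_sum_of_subset (Finset.range_mono hi))).trans
      (eval_size hl hσ ho)
  simp only [Ok, Ex.ht] at ho hh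
  obtain ⟨hx, hb, hxb, hbl, ho⟩ := ho
  have ex := hM.reg x hx
  have eb := hM.reg b hb
  have hbw := hσ.reg b hb
  have sb : Nat.size (σ.r b) ≤ w := Nat.size_le.2 hbw
  have sx : Nat.size (σ.r x) ≤ w := Nat.size_le.2 (hσ.reg x hx)
  -- Induction on the number d of rounds left. Register x is excluded from the frame condition
  -- because it is restored only after the loop; t + 1 is included because it keeps the saved value.
  have key : ∀ d i M0, i + d = σ.r b → Sim M0 (σ.set x i) →
      M0 t = ∑ j ∈ Finset.range i, e.eval (σ.set x j) → M0 (t + 2) = d →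
      ∃ M', Ev (loop (t + 2) (seq (e.comp (t + 3)) (seq (Op.add.prog t t (t + 3))
          (seq (const (t + 3) 1) (seq (Op.add.prog x x (t + 3)) (Op.sub.prog (t + 2) b x))))))
        M0 M' (d * (e.tb w + 20 + 20 * w + 10 * e.sz w) + 1) ∧
        M' t = ∑ j ∈ Finset.range (σ.r b), e.eval (σ.set x j) ∧
        ∀ a, (a < t ∨ 96 ≤ a ∨ a = t + 1) → a ≠ x → M' a = M0 a := by
    intro d
    induction d with
    | zero =>
      intro i M0 hi hS h0 h2
      exact ⟨M0, (Ev.loop_false h2).mono (by omega), by rw [h0, ← hi, add_zero], fun _ _ _ => rfl⟩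
    | succ d ih =>
      intro i M0 hi hS h0 h2
      have hσi : Bdd w (σ.set x i) := hσ.set (by omega)
      obtain ⟨M1, h1, e1, f1⟩ := he l w (σ.set x i) M0 (t + 3) hl hσi (ho i (by omega)) hS
        (by omega) (by omega)
      have e1t : M1 t = ∑ j ∈ Finset.range i, e.eval (σ.set x j) := (f1 t (by omega)).trans h0
      have se := eval_size hl hσi (ho i (by omega))
      have g2 := Ev.op .add t (a := t) (b := t + 3) (M := M1) (p := w + e.sz w) (q := e.sz w)
        (by rw [e1t]; exact stot i (by omega)) (by rwa [e1])
      have v2 : Op.add.fn (M1 t) (M1 (t + 3))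
          = ∑ j ∈ Finset.range (i + 1), e.eval (σ.set x j) := by
        rw [e1, e1t, Finset.sum_range_succ]; rfl
      rw [v2] at g2
      generalize ∑ j ∈ Finset.range (i + 1), e.eval (σ.set x j) = v at *
      have S2 : Sim (update M1 t v) (σ.set x i) := (hS.fr f1 (by omega)).scratch ht (by omega)
      have g3 := Ev.const (t + 3) (update M1 t v) (c := 1) (p := 1) (by simp)
      have S3 := S2.scratch (x := t + 3) (v := 1) (by omega) (by omega)
      have x3 : update (update M1 t v) (t + 3) 1 x = i := by rw [S3.reg x hx]; simp
      have si : Nat.size i ≤ w := (Nat.size_le_size (show i ≤ σ.r b by omega)).trans sb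
      have si1 : Nat.size (i + 1) ≤ w := (Nat.size_le_size (show i + 1 ≤ σ.r b by omega)).trans sb
      have g4 := Ev.op .add x (a := x) (b := t + 3) (M := update (update M1 t v) (t + 3) 1)
        (p := w) (q := 1) (by rwa [x3]) (by simp)
      rw [x3, update_self, show Op.add.fn i 1 = i + 1 from rfl] at g4
      have S4 := S3.set (x := x) (v := i + 1) hx
      rw [St.set_set] at S4
      generalize hM4 : update (update (update M1 t v) (t + 3) 1) x (i + 1) = M4 at *
      have x4 : M4 x = i + 1 := by rw [S4.reg x hx]; simp
      have b4 : M4 b = σ.r b := by rw [S4.reg b hb]; simp [hxb.symm]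
      have g5 := Ev.op .sub (t + 2) (a := b) (b := x) (M := M4) (p := w) (q := w)
        (by rwa [b4]) (by rwa [x4])
      rw [b4, x4, show Op.sub.fn (σ.r b) (i + 1) = d by simp only [Op.fn]; omega] at g5
      have S5 := S4.scratch (x := t + 2) (v := d) (by omega) (by omega)
      obtain ⟨M', h6, e6, f6⟩ := ih (i + 1) _ (by omega) S5
        (by rw [update_of_ne (by omega), ← hM4, update_of_ne (by omega), update_of_ne (by omega),
          update_self, ← v2, e1, e1t, Finset.sum_range_succ]; rfl) (by simp)
      have sd : Nat.size (d + 1) ≤ w :=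
        (Nat.size_le_size (show d + 1 ≤ σ.r b by omega)).trans sb
      refine ⟨M', (Ev.loop_true (s := w) (by omega) (by rwa [h2])
        (h1.seq (g2.seq (g3.seq (g4.seq g5)))) h6).mono ?_, e6, ?_⟩
      · rw [Nat.succ_mul d]; omega
      · intro a ha hax
        rw [f6 a ha hax, update_of_ne (by omega), ← hM4, update_of_ne hax, update_of_ne (by omega),
          update_of_ne (by omega), f1 a (by omega)]
  have g1 := Ev.const t M (c := 0) (p := 0) (by simp)
  have S1 := hM.scratch (x := t) (v := 0) ht (by omega)
  have g2 := Ev.copy (d := t + 1) (a := x) (M := update M t 0) (p := w) (by omega)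
    (by rwa [S1.reg x hx])
  rw [S1.reg x hx] at g2
  have S2 := S1.scratch (x := t + 1) (v := σ.r x) (by omega) (by omega)
  have g3 := Ev.const x (update (update M t 0) (t + 1) (σ.r x)) (c := 0) (p := 0) (by simp)
  have S3 := S2.set (x := x) (v := 0) hx
  have g4 := Ev.op .sub (t + 2) (a := b) (b := x)
    (M := update (update (update M t 0) (t + 1) (σ.r x)) x 0) (p := w) (q := 0)
    (by rw [S3.reg b hb]; simpa [hxb.symm] using sb) (by simp)
  rw [S3.reg b hb, update_self, show Op.sub.fn ((σ.set x 0).r b) 0 = σ.r b by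
    simp [Op.fn, hxb.symm]] at g4
  have S4 := S3.scratch (x := t + 2) (v := σ.r b) (by omega) (by omega)
  obtain ⟨M5, h5, e5, f5⟩ := key (σ.r b) 0 _ (by omega) S4
    (by simp [show t ≠ x by omega]) (by simp)
  have t5 : M5 (t + 1) = σ.r x := by
    rw [f5 _ (by omega) (by omega), update_of_ne (by omega), update_of_ne (by omega), update_self]
  have g6 := Ev.copy (d := x) (a := t + 1) (M := M5) (p := w) (by omega) (by rwa [t5])
  rw [t5] at g6
  refine ⟨_, (g1.seq (g2.seq (g3.seq (g4.seq (h5.seq g6))))).mono ?_, ?_, ?_⟩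
  · have := Nat.mul_le_mul_right (e.tb w + 20 + 20 * w + 10 * e.sz w) (hbl.trans hl)
    simp only [tb]; omega
  · rw [update_of_ne (by omega), e5]; rfl
  · intro a ha
    rcases eq_or_ne a x with rfl | hax
    · rw [update_self, ex]
    · rw [update_of_ne hax, f5 a (by omega) hax, update_of_ne (by omega), update_of_ne hax,
        update_of_ne (by omega), update_of_ne (by omega)]

theorem runs (e : Ex) : e.Runs := by
  induction e with
  | con c => exact runs_con c
  | reg x => exact runs_reg x
  | op o a b iha ihb => exact runs_op o iha ihb
  | cell a ih => exact runs_cell ih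
  | sum x b e ih => exact runs_sum x b ih
  | pow2 b => exact runs_pow2 b
  | lett x a e iha ihe => exact runs_lett x iha ihe

end Ex

end RAM

/-! ### Commands and a calculus of correctness with step counts -/

namespace RAM

open RAMProg Function

/-- Commands: assignment to a register, writing to a cell, sequence, and `for x < b do c`. -/
inductive Cmd : Type
  | asg (x : ℕ) (e : Ex)
  | wr (a e : Ex)
  | seq (c d : Cmd)
  | rep (x b : ℕ) (c : Cmd)

namespace Cmd

/-- The code of a command. -/
def comp : Cmd → RAMProg
  | asg x e => RAMProg.seq (e.comp 32) (copy x 32)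
  | wr a e => RAMProg.seq (a.comp 32) (RAMProg.seq (e.comp 33) (RAMProg.seq (const 34 96)
      (RAMProg.seq (Op.add.prog 32 32 34) (store 32 33))))
  | seq c d => RAMProg.seq c.comp d.comp
  | rep x b c => RAMProg.seq (const x 0) (RAMProg.seq (Op.sub.prog 32 b x)
      (loop 32 (RAMProg.seq c.comp (RAMProg.seq (const 33 1)
        (RAMProg.seq (Op.add.prog x x 33) (Op.sub.prog 32 b x))))))

/-- A bound for the cost of one step of a command. -/
def tau : Cmd → ℕ → ℕ
  | asg _ e, w => e.tb w + (3 + 2 * e.sz w)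
  | wr a e, w => a.tb w + e.tb w + 50 + 4 * a.sz w + e.sz w
  | seq c d, w => c.tau w + d.tau w
  | rep _ _ c, w => c.tau w + (30 + 10 * w)

end Cmd

/-- Started in `σ`, the command `c` ends in a state satisfying `Q` after at most `T` steps, and all
states have at most `w` digits per number. -/
def Tr (w : ℕ) (c : Cmd) (σ : St) (Q : St → Prop) (T : ℕ) : Prop :=
  Bdd w σ → ∃ σ', Q σ' ∧ Bdd w σ' ∧
    ∀ M, Sim M σ → ∃ M', Ev c.comp M M' (T * c.tau w) ∧ Sim M' σ'

theorem Tr.conseq {w : ℕ} {c : Cmd} {σ : St} {Q Q' : St → Prop} {T T' : ℕ} (h : Tr w c σ Q T)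
    (hQ : ∀ σ, Q σ → Q' σ) (hT : T ≤ T') : Tr w c σ Q' T' := by
  intro hσ
  obtain ⟨σ', hq, hb, h⟩ := h hσ
  refine ⟨σ', hQ _ hq, hb, fun M hM => ?_⟩
  obtain ⟨M', h, hM'⟩ := h M hM
  exact ⟨M', h.mono (Nat.mul_le_mul_right _ hT), hM'⟩

/-- The word length w is fixed for the whole run, so the value assigned must fit into w digits. The
syntactic bound `sz` may be larger and limits only the scratch values. -/
theorem Tr.asg {w x : ℕ} {e : Ex} {σ : St} {Q : St → Prop} (hx : x < 32) (ho : e.Ok w σ)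
    (hh : e.ht ≤ 64) (hv : e.eval σ < 2 ^ w) (hQ : Q (σ.set x (e.eval σ))) :
    Tr w (.asg x e) σ Q 1 := by
  intro hσ
  refine ⟨_, hQ, hσ.set hv, fun M hM => ?_⟩
  obtain ⟨M1, h1, e1, f1⟩ := e.runs w w σ M 32 le_rfl hσ ho hM le_rfl (by omega)
  have h2 := Ev.copy (d := x) (a := 32) (M := M1) (p := e.sz w) (by omega)
    (by rw [e1]; exact e.eval_size le_rfl hσ ho)
  rw [e1] at h2
  exact ⟨_, (h1.seq h2).mono (by simp [Cmd.tau]), (hM.fr f1 le_rfl).set hx⟩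

theorem Tr.wr {w : ℕ} {a e : Ex} {σ : St} {Q : St → Prop} (ha : a.Ok w σ) (he : e.Ok w σ)
    (hha : a.ht ≤ 64) (hhe : e.ht ≤ 63) (hv : e.eval σ < 2 ^ w)
    (hQ : Q (σ.put (a.eval σ) (e.eval σ))) : Tr w (.wr a e) σ Q 1 := by
  intro hσ
  refine ⟨_, hQ, hσ.put hv, fun M hM => ?_⟩
  have h96 : Nat.size 96 ≤ 7 := by decide
  obtain ⟨M1, h1, e1, f1⟩ := a.runs w w σ M 32 le_rfl hσ ha hM le_rfl (by omega)
  obtain ⟨M2, h2, e2, f2⟩ := e.runs w w σ M1 33 le_rfl hσ he (hM.fr f1 le_rfl) (by omega)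
    (by omega)
  have sa := a.eval_size le_rfl hσ ha
  have se := e.eval_size le_rfl hσ he
  have e3 : M2 32 = a.eval σ := (f2 32 (by omega)).trans e1
  have h4 := Ev.op .add 32 (a := 32) (b := 34) (M := update M2 34 96) (p := a.sz w) (q := 7)
    (by simpa [e3] using sa) (by simpa using h96)
  have v4 : Op.add.fn (update M2 34 96 32) (update M2 34 96 34) = 96 + a.eval σ := by
    simp [Op.fn, e3, add_comm]
  rw [v4] at h4
  have h5 := Ev.store (a := 32) (b := 33)
    (M := update (update M2 34 96) 32 (96 + a.eval σ)) (p := 7 + a.sz w + 1) (q := e.sz w)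
    (by simpa [Op.fn] using Op.fn_size .add h96 sa) (by simpa [e2] using se)
  rw [update_self, show update (update M2 34 96) 32 (96 + a.eval σ) 33 = e.eval σ by
    simp [e2]] at h5
  refine ⟨_, (h1.seq (h2.seq ((Ev.const 34 M2 h96).seq (h4.seq h5)))).mono
    (by simp only [Cmd.tau]; omega), ?_⟩
  exact ((((hM.fr f1 le_rfl).fr f2 (by omega)).scratch (by omega) (by omega)).scratch
    (by omega) (by omega)).put

theorem Tr.seq {w : ℕ} {c d : Cmd} {σ : St} {Q : St → Prop} {T T' : ℕ}
    (h : Tr w c σ (fun σ' => Tr w d σ' Q T') T) : Tr w (.seq c d) σ Q (T + T') := by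
  intro hσ
  obtain ⟨σ1, h1, hb1, h⟩ := h hσ
  obtain ⟨σ2, h2, hb2, h'⟩ := h1 hb1
  refine ⟨σ2, h2, hb2, fun M hM => ?_⟩
  obtain ⟨M1, g1, hM1⟩ := h M hM
  obtain ⟨M2, g2, hM2⟩ := h' M1 hM1
  refine ⟨M2, (g1.seq g2).mono ?_, hM2⟩
  have e : (T + T') * (Cmd.seq c d).tau w
      = T * c.tau w + T' * d.tau w + (T * d.tau w + T' * c.tau w) := by
    simp only [Cmd.tau]; ring
  omega

/-- The invariant is indexed by the number of completed rounds and is stated after the counter has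
been advanced. One step per round and one further step pay for the loop itself. -/
theorem Tr.rep {w x b N T : ℕ} {c : Cmd} {σ : St} {Q : St → Prop} (Inv : ℕ → St → Prop)
    (hx : x < 32) (hb : b < 32) (hxb : x ≠ b) (hN : σ.r b = N) (h0 : Inv 0 (σ.set x 0))
    (hs : ∀ i < N, ∀ σ, σ.r x = i → σ.r b = N → Inv i σ → Tr w c σ
      (fun σ' => σ'.r x = i ∧ σ'.r b = N ∧ Inv (i + 1) (σ'.set x (i + 1))) T)
    (hQ : ∀ σ, Inv N σ → Q σ) : Tr w (.rep x b c) σ Q (N * (T + 1) + 1) := by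
  intro hσ
  have hNw : N < 2 ^ w := hN ▸ hσ.reg b hb
  have sN : Nat.size N ≤ w := Nat.size_le.2 hNw
  have key : ∀ d i σ, i + d = N → σ.r x = i → σ.r b = N → Inv i σ → Bdd w σ →
      ∃ σ', Inv N σ' ∧ Bdd w σ' ∧ ∀ M, Sim M σ → M 32 = d →
        ∃ M', Ev (loop 32 (RAMProg.seq c.comp (RAMProg.seq (const 33 1)
          (RAMProg.seq (Op.add.prog x x 33) (Op.sub.prog 32 b x))))) M M'
          (d * (T * c.tau w + (25 + 10 * w)) + 1) ∧ Sim M' σ' := by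
    intro d
    induction d with
    | zero =>
      intro i σ hi hxi hbN hI hB
      refine ⟨σ, by rwa [← hi], hB, fun M hM h0 => ⟨M, (Ev.loop_false h0).mono (by omega), hM⟩⟩
    | succ d ih =>
      intro i σ hi hxi hbN hI hB
      obtain ⟨σ1, ⟨hx1, hb1, hI1⟩, hB1, h1⟩ := hs i (by omega) σ hxi hbN hI hB
      obtain ⟨σ2, hI2, hB2, h2⟩ := ih (i + 1) (σ1.set x (i + 1)) (by omega) (by simp)
        (by simp [hxb.symm, hb1]) hI1 (hB1.set (by omega))
      refine ⟨σ2, hI2, hB2, fun M hM hd => ?_⟩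
      obtain ⟨M1, g1, S1⟩ := h1 M hM
      have g2 := Ev.const 33 M1 (c := 1) (p := 1) (by simp)
      have S2 := S1.scratch (x := 33) (v := 1) (by omega) (by omega)
      have x2 : update M1 33 1 x = i := by rw [S2.reg x hx, hx1]
      have si : Nat.size i ≤ w := (Nat.size_le_size (show i ≤ N by omega)).trans sN
      have si1 : Nat.size (i + 1) ≤ w := (Nat.size_le_size (show i + 1 ≤ N by omega)).trans sN
      have sd : Nat.size (d + 1) ≤ w := (Nat.size_le_size (show d + 1 ≤ N by omega)).trans sN
      have g3 := Ev.op .add x (a := x) (b := 33) (M := update M1 33 1) (p := w) (q := 1)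
        (by rwa [x2]) (by simp)
      rw [x2, update_self, show Op.add.fn i 1 = i + 1 from rfl] at g3
      have S3 := S2.set (x := x) (v := i + 1) hx
      have g4 := Ev.op .sub 32 (a := b) (b := x) (M := update (update M1 33 1) x (i + 1))
        (p := w) (q := w) (by rw [S3.reg b hb]; simpa [hxb.symm, hb1] using sN)
        (by simpa using si1)
      rw [S3.reg b hb, update_self, show Op.sub.fn ((σ1.set x (i + 1)).r b) (i + 1) = d by
        simp only [Op.fn, St.set_r, hxb.symm, if_false, hb1]; omega] at g4
      obtain ⟨M5, g5, S5⟩ := h2 _ (S3.scratch (x := 32) (v := d) (by omega) (by omega))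
        (by simp)
      refine ⟨M5, (Ev.loop_true (s := w) (by omega) (by rwa [hd])
        (g1.seq (g2.seq (g3.seq g4))) g5).mono ?_, S5⟩
      rw [Nat.succ_mul d]; omega
  obtain ⟨σ', hI, hB, h⟩ := key N 0 (σ.set x 0) (by omega) (by simp) (by simp [hxb.symm, hN]) h0
    (hσ.set (by positivity))
  refine ⟨σ', hQ _ hI, hB, fun M hM => ?_⟩
  have g1 := Ev.const x M (c := 0) (p := 0) (by simp)
  have S1 := hM.set (x := x) (v := 0) hx
  have g2 := Ev.op .sub 32 (a := b) (b := x) (M := update M x 0) (p := w) (q := 0)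
    (by rw [S1.reg b hb]; simpa [hxb.symm, hN] using sN) (by simp)
  rw [S1.reg b hb, update_self, show Op.sub.fn ((σ.set x 0).r b) 0 = N by
    simp [Op.fn, hxb.symm, hN]] at g2
  obtain ⟨M', g3, S3⟩ := h _ (S1.scratch (x := 32) (v := N) (by omega) (by omega)) (by simp)
  refine ⟨M', (g1.seq (g2.seq g3)).mono ?_, S3⟩
  have e : (N * (T + 1) + 1) * (Cmd.rep x b c).tau w
      = N * (T * c.tau w + (25 + 10 * w)) + (30 + 10 * w)
        + (N * c.tau w + N * (T * (30 + 10 * w)) + 5 * N + c.tau w) := by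
    simp only [Cmd.tau]; ring
  omega

theorem Tr.asg_seq {w x T : ℕ} {e : Ex} {d : Cmd} {σ : St} {Q : St → Prop} (hx : x < 32)
    (ho : e.Ok w σ) (hh : e.ht ≤ 64) (hv : e.eval σ < 2 ^ w)
    (h : Tr w d (σ.set x (e.eval σ)) Q T) : Tr w (.seq (.asg x e) d) σ Q (T + 1) :=
  (Tr.seq (Tr.asg hx ho hh hv h)).conseq (fun _ h => h) (by omega)

theorem Tr.wr_seq {w T : ℕ} {a e : Ex} {d : Cmd} {σ : St} {Q : St → Prop} (ha : a.Ok w σ)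
    (he : e.Ok w σ) (hha : a.ht ≤ 64) (hhe : e.ht ≤ 63) (hv : e.eval σ < 2 ^ w)
    (h : Tr w d (σ.put (a.eval σ) (e.eval σ)) Q T) : Tr w (.seq (.wr a e) d) σ Q (T + 1) :=
  (Tr.seq (Tr.wr ha he hha hhe hv h)).conseq (fun _ h => h) (by omega)

theorem Tr.rep_seq {w x b N T T' : ℕ} {c d : Cmd} {σ : St} {Q : St → Prop} (Inv : ℕ → St → Prop)
    (hx : x < 32) (hb : b < 32) (hxb : x ≠ b) (hN : σ.r b = N) (h0 : Inv 0 (σ.set x 0))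
    (hs : ∀ i < N, ∀ σ, σ.r x = i → σ.r b = N → Inv i σ → Tr w c σ
      (fun σ' => σ'.r x = i ∧ σ'.r b = N ∧ Inv (i + 1) (σ'.set x (i + 1))) T)
    (h : ∀ σ, Inv N σ → Tr w d σ Q T') :
    Tr w (.seq (.rep x b c) d) σ Q (T' + (N * (T + 1) + 1)) :=
  (Tr.seq (Tr.rep Inv hx hb hxb hN h0 hs h)).conseq (fun _ h => h) (by omega)

theorem Tr.run {w : ℕ} {c : Cmd} {σ : St} {Q : St → Prop} {T : ℕ} (h : Tr w c σ Q T)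
    (hσ : Bdd w σ) : ∃ σ', Q σ' ∧ Bdd w σ' ∧
      ∀ M, Sim M σ → ∃ M', Ev c.comp M M' (T * c.tau w) ∧ Sim M' σ' := h hσ

attribute [irreducible] Tr

/-! ### Polynomial bounds -/

/-- A polynomially bounded function. -/
def PolyBound (f : ℕ → ℕ) : Prop := ∃ k, ∀ w, f w ≤ (w + 2) ^ k

theorem PolyBound.const (c : ℕ) : PolyBound fun _ => c :=
  ⟨c, fun w => (Nat.lt_two_pow_self).le.trans (Nat.pow_le_pow_left (by omega) _)⟩

theorem PolyBound.id : PolyBound fun w => w := ⟨1, fun w => by simp⟩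

theorem PolyBound.add {f g : ℕ → ℕ} (hf : PolyBound f) (hg : PolyBound g) :
    PolyBound fun w => f w + g w := by
  obtain ⟨k, hf⟩ := hf
  obtain ⟨l, hg⟩ := hg
  refine ⟨k + l + 1, fun w => ?_⟩
  have h1 : (w + 2) ^ k ≤ (w + 2) ^ (k + l) := Nat.pow_le_pow_right (by omega) (by omega)
  have h2 : (w + 2) ^ l ≤ (w + 2) ^ (k + l) := Nat.pow_le_pow_right (by omega) (by omega)
  calc f w + g w ≤ (w + 2) ^ (k + l) * 2 := by have := hf w; have := hg w; omega
    _ ≤ (w + 2) ^ (k + l) * (w + 2) := Nat.mul_le_mul_left _ (by omega)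
    _ = _ := by ring

theorem PolyBound.mul {f g : ℕ → ℕ} (hf : PolyBound f) (hg : PolyBound g) :
    PolyBound fun w => f w * g w := by
  obtain ⟨k, hf⟩ := hf
  obtain ⟨l, hg⟩ := hg
  exact ⟨k + l, fun w => by rw [pow_add]; exact Nat.mul_le_mul (hf w) (hg w)⟩

/-- Composition is needed for local definitions, whose body is measured at an enlarged word length.
-/
theorem PolyBound.comp {f g : ℕ → ℕ} (hf : PolyBound f) (hg : PolyBound g) :
    PolyBound fun w => f (g w) := by
  obtain ⟨k, hf⟩ := hf
  obtain ⟨l, hg⟩ := hg.add (.const 2)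
  exact ⟨l * k, fun w => by
    rw [pow_mul]; exact (hf _).trans (Nat.pow_le_pow_left (hg w) _)⟩

theorem Ex.polyBound_sz (e : Ex) : PolyBound e.sz := by
  induction e with
  | con c => exact .const _
  | reg x => exact .id
  | op o a b iha ihb => exact (iha.add ihb).add (.const 1)
  | cell a ih => exact .id
  | sum x b e ih => exact PolyBound.id.add ih
  | pow2 b => exact PolyBound.id.add (.const 1)
  | lett x a e iha ihe => exact ihe.comp (PolyBound.id.add iha)

theorem Ex.polyBound_tb (e : Ex) : PolyBound e.tb := by
  induction e with
  | con c => exact .const _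
  | reg x => exact (PolyBound.const 3).add ((PolyBound.const 2).mul .id)
  | op o a b iha ihb =>
    exact (iha.add ihb).add ((PolyBound.const 2).add
      ((PolyBound.const 2).mul (a.polyBound_sz.add b.polyBound_sz)))
  | cell a ih =>
    exact ih.add (((PolyBound.const 50).add ((PolyBound.const 4).mul a.polyBound_sz)).add .id)
  | sum x b e ih =>
    exact ((PolyBound.id.mul (((ih.add (.const 20)).add ((PolyBound.const 20).mul .id)).add
      ((PolyBound.const 10).mul e.polyBound_sz))).add (.const 30)).add ((PolyBound.const 20).mul .id)
  | pow2 b =>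
    exact ((PolyBound.id.mul ((PolyBound.const 30).add ((PolyBound.const 10).mul .id))).add
      (.const 30)).add ((PolyBound.const 10).mul .id)
  | lett x a e iha ihe =>
    have h := PolyBound.id.add a.polyBound_sz
    exact (((iha.add (ihe.comp h)).add (.const 20)).add ((PolyBound.const 10).mul h)).add
      ((PolyBound.const 10).mul (e.polyBound_sz.comp h))

theorem Cmd.polyBound_tau (c : Cmd) : PolyBound c.tau := by
  induction c with
  | asg x e =>
    exact e.polyBound_tb.add ((PolyBound.const 3).add ((PolyBound.const 2).mul e.polyBound_sz))
  | wr a e =>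
    exact (((a.polyBound_tb.add e.polyBound_tb).add (.const 50)).add
      ((PolyBound.const 4).mul a.polyBound_sz)).add e.polyBound_sz
  | seq c d ihc ihd => exact ihc.add ihd
  | rep x b c ih => exact ih.add ((PolyBound.const 30).add ((PolyBound.const 10).mul .id))

/-! ### Running a program inside of every fourth memory cell -/

/-- The place of address `a` of a hosted program. -/
def host (a : ℕ) : ℕ := 96 + (4 * a + 3)

/-- The program `p`, with its memory moved by `host`. -/
def hosted : RAMProg → RAMProg
  | .const d c => .const (host d) c
  | .add d a b => .add (host d) (host a) (host b)
  | .sub d a b => .sub (host d) (host a) (host b)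
  | .mul d a b => .mul (host d) (host a) (host b)
  | .div d a b => .div (host d) (host a) (host b)
  | .load d a => .seq (.const 32 4) (.seq (.mul 32 32 (host a)) (.seq (.const 33 99)
      (.seq (.add 32 32 33) (.load (host d) 32))))
  | .store a b => .seq (.const 32 4) (.seq (.mul 32 32 (host a)) (.seq (.const 33 99)
      (.seq (.add 32 32 33) (.store 32 (host b)))))
  | .seq p q => .seq (hosted p) (hosted q)
  | .ite a p q => .ite (host a) (hosted p) (hosted q)
  | .loop a p => .loop (host a) (hosted p)

/-- `M` hosts the memory `M₀`, and agrees with `N` on the registers. -/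
def Hosts (N M₀ M : ℕ → ℕ) : Prop := (∀ a, M (host a) = M₀ a) ∧ ∀ x < 32, M x = N x

theorem Hosts.update {N M₀ M : ℕ → ℕ} (h : Hosts N M₀ M) (d v : ℕ) :
    Hosts N (update M₀ d v) (update M (host d) v) := by
  refine ⟨fun a => ?_, fun x hx => ?_⟩
  · simp only [update_apply, host, show (96 + (4 * a + 3) = 96 + (4 * d + 3)) ↔ a = d by omega]
    split_ifs
    · rfl
    · exact h.1 a
  · rw [update_of_ne (by simp only [host]; omega), h.2 x hx]

theorem Hosts.scratch {N M₀ M : ℕ → ℕ} (h : Hosts N M₀ M) {x v : ℕ} (hx : 32 ≤ x) (hx' : x < 96) :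
    Hosts N M₀ (Function.update M x v) :=
  ⟨fun a => by rw [update_of_ne (by simp only [host]; omega), h.1],
    fun y hy => by rw [update_of_ne (by omega), h.2 y hy]⟩

/-- The address computation of a hosted program. -/
theorem Ev.hostAddr {N M₀ M : ℕ → ℕ} (h : Hosts N M₀ M) (a : ℕ) {p : RAMProg} {M' : ℕ → ℕ} {k : ℕ}
    (hp : Ev p (update (update (update (update M 32 4) 32 (4 * M₀ a)) 33 99) 32
      (host (M₀ a))) M' k) :
    Ev (.seq (.const 32 4) (.seq (.mul 32 32 (host a)) (.seq (.const 33 99)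
      (.seq (.add 32 32 33) p)))) M M' (60 + 6 * Nat.size (M₀ a) + k) := by
  have h4 : Nat.size 4 ≤ 3 := by decide
  have h99 : Nat.size 99 ≤ 7 := by decide
  have e1 : update M 32 4 (host a) = M₀ a := by
    rw [update_of_ne (by simp only [host]; omega), h.1]
  have g1 := Ev.const 32 M h4
  have g2 := Ev.op .mul 32 (a := 32) (b := host a) (M := update M 32 4) (p := 3)
    (q := Nat.size (M₀ a)) (by simpa using h4) (by rw [e1])
  rw [e1, update_self, show Op.mul.fn 4 (M₀ a) = 4 * M₀ a from rfl] at g2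
  have g3 := Ev.const 33 (update (update M 32 4) 32 (4 * M₀ a)) h99
  have s4 := Op.fn_size .mul h4 (le_refl (Nat.size (M₀ a)))
  have g4 := Ev.op .add 32 (a := 32) (b := 33)
    (M := update (update (update M 32 4) 32 (4 * M₀ a)) 33 99) (p := 3 + Nat.size (M₀ a) + 1)
    (q := 7) (by simpa [Op.fn] using s4) (by simpa using h99)
  rw [update_self, update_of_ne (show (32 : ℕ) ≠ 33 by omega), update_self,
    show Op.add.fn (4 * M₀ a) 99 = host (M₀ a) by simp only [Op.fn, host]; omega] at g4
  exact (g1.seq (g2.seq (g3.seq (g4.seq hp)))).mono (by omega)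

theorem size_host (x : ℕ) : Nat.size (host x) ≤ Nat.size x + 12 := by
  have h4 : Nat.size 4 ≤ 3 := by decide
  have h99 : Nat.size 99 ≤ 7 := by decide
  have h := Op.fn_size .add h99 (Op.fn_size .mul h4 (le_refl (Nat.size x)))
  rw [show Op.add.fn 99 (Op.mul.fn 4 x) = host x by simp only [Op.fn, host]; omega] at h
  omega

/-- Direct instructions are translated one to one. Only loads and stores cost more, since they
compute 4a + 99 in the scratch registers 32 and 33. This overhead is a constant plus a multiple of
the length of a, and as every instruction costs at least one plus the length of its address, the
factor 80 covers it. -/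
theorem exec_hosted {p : RAMProg} {M₀ M₀' : ℕ → ℕ} {t : ℕ} (h : Exec p M₀ M₀' t) {N M : ℕ → ℕ}
    (hM : Hosts N M₀ M) : ∃ M', Ev (hosted p) M M' (80 * t) ∧ Hosts N M₀' M' := by
  induction h generalizing M with
  | const d c M₀ => exact ⟨_, ⟨_, Exec.const _ _ _, by omega⟩, hM.update _ _⟩
  | add d a b M₀ =>
    have g := Exec.add (host d) (host a) (host b) M
    rw [hM.1, hM.1] at g
    exact ⟨_, ⟨_, g, by omega⟩, hM.update _ _⟩
  | sub d a b M₀ =>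
    have g := Exec.sub (host d) (host a) (host b) M
    rw [hM.1, hM.1] at g
    exact ⟨_, ⟨_, g, by omega⟩, hM.update _ _⟩
  | mul d a b M₀ =>
    have g := Exec.mul (host d) (host a) (host b) M
    rw [hM.1, hM.1] at g
    exact ⟨_, ⟨_, g, by omega⟩, hM.update _ _⟩
  | div d a b M₀ =>
    have g := Exec.div (host d) (host a) (host b) M
    rw [hM.1, hM.1] at g
    exact ⟨_, ⟨_, g, by omega⟩, hM.update _ _⟩
  | load d a M₀ =>
    have h4 : Hosts N M₀ (update (update (update (update M 32 4) 32 (4 * M₀ a)) 33 99) 32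
        (host (M₀ a))) := (((hM.scratch le_rfl (by omega)).scratch le_rfl (by omega)).scratch
      (by omega) (by omega)).scratch le_rfl (by omega)
    have g := Exec.load (host d) 32 (update (update (update (update M 32 4) 32 (4 * M₀ a)) 33 99) 32
        (host (M₀ a)))
    rw [update_self, h4.1] at g
    have := size_host (M₀ a)
    exact ⟨_, (Ev.hostAddr hM a ⟨_, g, le_rfl⟩).mono (by omega), h4.update _ _⟩
  | store a b M₀ =>
    have h4 : Hosts N M₀ (update (update (update (update M 32 4) 32 (4 * M₀ a)) 33 99) 32
        (host (M₀ a))) := (((hM.scratch le_rfl (by omega)).scratch le_rfl (by omega)).scratch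
      (by omega) (by omega)).scratch le_rfl (by omega)
    have g := Exec.store 32 (host b) (update (update (update (update M 32 4) 32 (4 * M₀ a)) 33 99)
        32 (host (M₀ a)))
    rw [update_self, h4.1] at g
    have := size_host (M₀ a)
    exact ⟨_, (Ev.hostAddr hM a ⟨_, g, le_rfl⟩).mono (by omega), h4.update _ _⟩
  | seq _ _ ih ih' =>
    obtain ⟨M1, h1, hM1⟩ := ih hM
    obtain ⟨M2, h2, hM2⟩ := ih' hM1
    exact ⟨M2, (h1.seq h2).mono (by omega), hM2⟩
  | ite_true ha _ ih =>
    obtain ⟨M1, ⟨j, h1, hj⟩, hM1⟩ := ih hM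
    exact ⟨M1, ⟨_, Exec.ite_true (by rwa [hM.1]) h1, by rw [hM.1]; omega⟩, hM1⟩
  | ite_false ha _ ih =>
    obtain ⟨M1, ⟨j, h1, hj⟩, hM1⟩ := ih hM
    exact ⟨M1, ⟨_, Exec.ite_false (by rwa [hM.1]) h1, by rw [hM.1]; omega⟩, hM1⟩
  | loop_true ha _ _ ih ih' =>
    obtain ⟨M1, ⟨j, h1, hj⟩, hM1⟩ := ih hM
    obtain ⟨M2, ⟨i, h2, hi⟩, hM2⟩ := ih' hM1
    exact ⟨M2, ⟨_, Exec.loop_true (by rwa [hM.1]) h1 h2, by rw [hM.1]; omega⟩, hM2⟩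
  | loop_false ha =>
    exact ⟨M, ⟨_, Exec.loop_false (by rwa [hM.1]), by rw [hM.1]; omega⟩, hM⟩

end RAM

/-! ### Arithmetic, comparison and Boolean operators for expressions -/

namespace RAM

open RAMProg Function

namespace Ex

instance : Add Ex := ⟨op .add⟩
instance : Sub Ex := ⟨op .sub⟩
instance : Mul Ex := ⟨op .mul⟩
instance : Div Ex := ⟨op .div⟩

/-- Remainder. -/
def md (a b : Ex) : Ex := a - b * (a / b)
/-- `1` if the value is nonzero, else `0`. -/
def nz (a : Ex) : Ex := con 1 - (con 1 - a)
/-- `1` if the value is zero, else `0`. -/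
def eqz (a : Ex) : Ex := con 1 - a
/-- `1` if `a ≤ b`, else `0`. -/
def le (a b : Ex) : Ex := eqz (a - b)
/-- `1` if `a < b`, else `0`. -/
def lt (a b : Ex) : Ex := nz (b - a)
/-- `1` if `a = b`, else `0`. -/
def eq (a b : Ex) : Ex := eqz ((a - b) + (b - a))

variable (a b : Ex) (σ : St) (l x y c : ℕ)

@[simp] theorem eval_con : (con c).eval σ = c := rfl
@[simp] theorem eval_reg : (reg x).eval σ = σ.r x := rfl
@[simp] theorem eval_cell : (cell a).eval σ = σ.c (a.eval σ) := rfl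
@[simp] theorem eval_add : (a + b).eval σ = a.eval σ + b.eval σ := rfl
@[simp] theorem eval_sub : (a - b).eval σ = a.eval σ - b.eval σ := rfl
@[simp] theorem eval_mul : (a * b).eval σ = a.eval σ * b.eval σ := rfl
@[simp] theorem eval_div : (a / b).eval σ = a.eval σ / b.eval σ := rfl
@[simp] theorem eval_sum :
    (sum x y a).eval σ = ∑ i ∈ Finset.range (σ.r y), a.eval (σ.set x i) := rfl
@[simp] theorem eval_pow2 : (pow2 x).eval σ = 2 ^ σ.r x := rfl
@[simp] theorem eval_lett : (lett x a b).eval σ = b.eval (σ.set x (a.eval σ)) := rfl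
@[simp] theorem eval_md : (md a b).eval σ = a.eval σ % b.eval σ := by
  simp [md, Nat.mod_eq_sub]
@[simp] theorem eval_nz : (nz a).eval σ = if a.eval σ = 0 then 0 else 1 := by
  simp only [nz, eval_sub, eval_con]; split_ifs <;> omega
@[simp] theorem eval_eqz : (eqz a).eval σ = if a.eval σ = 0 then 1 else 0 := by
  simp only [eqz, eval_sub, eval_con]; split_ifs <;> omega
@[simp] theorem eval_le : (le a b).eval σ = if a.eval σ ≤ b.eval σ then 1 else 0 := by
  simp only [le, eval_eqz, eval_sub]; exact if_congr (by omega) rfl rfl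
@[simp] theorem eval_lt : (lt a b).eval σ = if a.eval σ < b.eval σ then 1 else 0 := by
  simp only [lt, eval_nz, eval_sub]; rw [← ite_not]; exact if_congr (by omega) rfl rfl
@[simp] theorem eval_eq : (eq a b).eval σ = if a.eval σ = b.eval σ then 1 else 0 := by
  simp only [eq, eval_eqz, eval_sub, eval_add]; exact if_congr (by omega) rfl rfl

@[simp] theorem ok_con : (con c).Ok l σ ↔ True := Iff.rfl
@[simp] theorem ok_reg : (reg x).Ok l σ ↔ x < 32 := Iff.rfl
@[simp] theorem ok_cell : (cell a).Ok l σ ↔ a.Ok l σ := Iff.rfl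
@[simp] theorem ok_add : (a + b).Ok l σ ↔ a.Ok l σ ∧ b.Ok l σ := Iff.rfl
@[simp] theorem ok_sub : (a - b).Ok l σ ↔ a.Ok l σ ∧ b.Ok l σ := Iff.rfl
@[simp] theorem ok_mul : (a * b).Ok l σ ↔ a.Ok l σ ∧ b.Ok l σ := Iff.rfl
@[simp] theorem ok_div : (a / b).Ok l σ ↔ a.Ok l σ ∧ b.Ok l σ := Iff.rfl
@[simp] theorem ok_sum : (sum x y a).Ok l σ ↔
    x < 32 ∧ y < 32 ∧ x ≠ y ∧ σ.r y ≤ l ∧ ∀ i < σ.r y, a.Ok l (σ.set x i) := Iff.rfl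
@[simp] theorem ok_pow2 : (pow2 x).Ok l σ ↔ x < 32 ∧ σ.r x ≤ l := Iff.rfl
@[simp] theorem ok_lett : (lett x a b).Ok l σ ↔
    x < 32 ∧ a.Ok l σ ∧ b.Ok l (σ.set x (a.eval σ)) := Iff.rfl
@[simp] theorem ok_md : (md a b).Ok l σ ↔ a.Ok l σ ∧ b.Ok l σ := by simp [md]; tauto
@[simp] theorem ok_nz : (nz a).Ok l σ ↔ a.Ok l σ := by simp [nz]
@[simp] theorem ok_eqz : (eqz a).Ok l σ ↔ a.Ok l σ := by simp [eqz]
@[simp] theorem ok_le : (le a b).Ok l σ ↔ a.Ok l σ ∧ b.Ok l σ := by simp [le]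
@[simp] theorem ok_lt : (lt a b).Ok l σ ↔ a.Ok l σ ∧ b.Ok l σ := by simp [lt, and_comm]
@[simp] theorem ok_eq : (eq a b).Ok l σ ↔ a.Ok l σ ∧ b.Ok l σ := by simp [eq]; tauto

end Ex

end RAM

/-! ### Instances as families of sets of numbers -/

/-- The members of `S` cover `{0, …, n - 1}`. -/
def Covers (n : ℕ) (S : Finset ℕ) (E : ℕ → Finset ℕ) : Prop := ∀ u < n, ∃ f ∈ S, u ∈ E f

/-- Set Cover for a family `E 0, …, E (m - 1)` of sets of numbers. -/
def HasCover (n m s : ℕ) (E : ℕ → Finset ℕ) : Prop :=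
  ∃ S ⊆ Finset.range m, S.card ≤ s ∧ Covers n S E

/-- Set Partition for a family `E 0, …, E (m - 1)` of sets of numbers. -/
def HasPartition (n m s : ℕ) (E : ℕ → Finset ℕ) : Prop :=
  ∃ S ⊆ Finset.range m, S.card = s ∧ Covers n S E ∧ (S : Set ℕ).PairwiseDisjoint E

namespace SetInstance

variable (I : SetInstance)

theorem toMem_zero : I.toMem 0 = I.n := by simp [toMem]
theorem toMem_one : I.toMem 1 = I.m := by simp [toMem]
theorem toMem_two : I.toMem 2 = I.s := by simp [toMem]

theorem toMem_add_three_le (a : ℕ) : I.toMem (3 + a) ≤ 1 := by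
  unfold toMem
  rw [if_neg (by omega), if_neg (by omega), if_neg (by omega)]
  split_ifs <;> omega

theorem toMem_eq_zero {a : ℕ} (ha : 3 + I.n * I.m ≤ a) : I.toMem a = 0 := by
  unfold toMem
  rw [if_neg (by omega), if_neg (by omega), if_neg (by omega), if_neg]
  rintro ⟨f, u, -, h⟩
  have h1 : ((f : ℕ) + 1) * I.n ≤ I.m * I.n := Nat.mul_le_mul_right _ f.2
  have h2 := u.2
  rw [Nat.succ_mul, mul_comm I.m] at h1
  omega

/-- The members of the family as sets of numbers. -/
noncomputable def nbr (f : ℕ) : Finset ℕ := (Finset.range I.n).filter fun u => I.toMem (3 + f * I.n + u) ≠ 0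

theorem nbr_subset (f : ℕ) : I.nbr f ⊆ Finset.range I.n := Finset.filter_subset _ _

/-- Since u < n, the offset f n + u determines f and u by division with remainder, so no two matrix
entries share a register. -/
theorem mem_nbr (f : Fin I.m) (u : Fin I.n) : (u : ℕ) ∈ I.nbr f ↔ u ∈ I.N f := by
  have hu := u.2
  simp only [nbr, Finset.mem_filter, Finset.mem_range, hu, true_and]
  unfold toMem
  rw [if_neg (by omega), if_neg (by omega), if_neg (by omega)]
  simp only [ne_eq, ite_eq_right_iff, one_ne_zero, imp_false, not_not]
  constructor
  · rintro ⟨g, v, hv, h⟩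
    have h1 : (f : ℕ) * I.n + u = g * I.n + v := by omega
    have e1 : (u : ℕ) = v := by
      have := congrArg (· % I.n) h1
      simpa [Nat.mul_add_mod', Nat.mod_eq_of_lt u.2, Nat.mod_eq_of_lt v.2] using this
    have e2 : (f : ℕ) = g :=
      Nat.eq_of_mul_eq_mul_right (show 0 < I.n by omega) (by omega)
    rw [Fin.ext e1, Fin.ext e2]
    exact hv
  · exact fun h => ⟨f, u, h, rfl⟩

theorem indicator_nbr {f u : ℕ} (hu : u < I.n) :
    I.toMem (3 + f * I.n + u) = if u ∈ I.nbr f then 1 else 0 := by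
  have := I.toMem_add_three_le (f * I.n + u)
  rw [← add_assoc] at this
  simp only [nbr, Finset.mem_filter, Finset.mem_range, hu, true_and]
  split_ifs <;> omega

theorem exists_finset_fin {m : ℕ} {S : Finset ℕ} (hS : S ⊆ Finset.range m) :
    ∃ S' : Finset (Fin m), S'.map Fin.valEmbedding = S := by
  refine ⟨Finset.univ.filter fun f => (f : ℕ) ∈ S, ?_⟩
  ext f
  simp only [Finset.mem_map, Finset.mem_filter, Finset.mem_univ, true_and, Fin.valEmbedding_apply]
  exact ⟨by rintro ⟨g, hg, rfl⟩; exact hg, fun h => ⟨⟨f, Finset.mem_range.1 (hS h)⟩, h, rfl⟩⟩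

variable {I} {E : ℕ → Finset ℕ}

theorem covers_map_iff (hE : ∀ (f : Fin I.m) (u : Fin I.n), (u : ℕ) ∈ E f ↔ u ∈ I.N f)
    (S : Finset (Fin I.m)) :
    Covers I.n (S.map Fin.valEmbedding) E ↔ S.biUnion I.N = Finset.univ := by
  simp only [Covers, Finset.mem_map, Fin.valEmbedding_apply, Finset.eq_univ_iff_forall,
    Finset.mem_biUnion]
  constructor
  · intro h u
    obtain ⟨_, ⟨f, hf, rfl⟩, hu⟩ := h u u.2
    exact ⟨f, hf, (hE f u).1 hu⟩
  · intro h u hu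
    obtain ⟨f, hf, hu⟩ := h ⟨u, hu⟩
    exact ⟨f, ⟨f, hf, rfl⟩, (hE f ⟨u, _⟩).2 hu⟩

theorem hasSetCover_iff (hE : ∀ (f : Fin I.m) (u : Fin I.n), (u : ℕ) ∈ E f ↔ u ∈ I.N f) :
    I.HasSetCover ↔ HasCover I.n I.m I.s E := by
  constructor
  · rintro ⟨S, h1, h2⟩
    refine ⟨S.map Fin.valEmbedding, ?_, by simpa using h2, (covers_map_iff hE S).2 h1⟩
    intro f hf
    obtain ⟨g, _, rfl⟩ := Finset.mem_map.1 hf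
    exact Finset.mem_range.2 g.2
  · rintro ⟨S, hS, h1, h2⟩
    obtain ⟨S, rfl⟩ := exists_finset_fin hS
    exact ⟨S, (covers_map_iff hE S).1 h2, by simpa using h1⟩

theorem hasSetPartition_iff (hE : ∀ (f : Fin I.m) (u : Fin I.n), (u : ℕ) ∈ E f ↔ u ∈ I.N f)
    (hE' : ∀ f, E f ⊆ Finset.range I.n) :
    I.HasSetPartition ↔ HasPartition I.n I.m I.s E := by
  have hd : ∀ f g : Fin I.m, Disjoint (I.N f) (I.N g) ↔ Disjoint (E f) (E g) := by
    intro f g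
    simp only [Finset.disjoint_left]
    constructor
    · intro h u hf hg
      have hu := Finset.mem_range.1 (hE' _ hf)
      exact h ((hE f ⟨u, hu⟩).1 hf) ((hE g ⟨u, hu⟩).1 hg)
    · intro h u hf hg
      exact h ((hE f u).2 hf) ((hE g u).2 hg)
  constructor
  · rintro ⟨S, h1, h2, h3⟩
    refine ⟨S.map Fin.valEmbedding, ?_, by simpa using h2, (covers_map_iff hE S).2 h1, ?_⟩
    · intro f hf
      obtain ⟨g, _, rfl⟩ := Finset.mem_map.1 hf
      exact Finset.mem_range.2 g.2
    · intro f hf g hg hfg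
      obtain ⟨f, hf', rfl⟩ := Finset.mem_map.1 (Finset.mem_coe.1 hf)
      obtain ⟨g, hg', rfl⟩ := Finset.mem_map.1 (Finset.mem_coe.1 hg)
      exact (hd f g).1 (h3 f hf' g hg' fun h => hfg (by rw [h]))
  · rintro ⟨S, hS, h1, h2, h3⟩
    obtain ⟨S, rfl⟩ := exists_finset_fin hS
    refine ⟨S, (covers_map_iff hE S).1 h2, by simpa using h1, fun f hf g hg hfg => ?_⟩
    exact (hd f g).2 (h3 (Finset.mem_map_of_mem _ hf) (Finset.mem_map_of_mem _ hg)
      fun h => hfg (Fin.ext h))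

variable (I) in
theorem hasSetCover_iff_nbr : I.HasSetCover ↔ HasCover I.n I.m I.s I.nbr :=
  hasSetCover_iff I.mem_nbr

variable (I) in
theorem hasSetPartition_iff_nbr : I.HasSetPartition ↔ HasPartition I.n I.m I.s I.nbr :=
  hasSetPartition_iff I.mem_nbr I.nbr_subset

/-- The instance with universe `{0, …, n - 1}` and family `E 0, …, E (m - 1)`. -/
def ofSets (n m s : ℕ) (E : ℕ → Finset ℕ) : SetInstance :=
  ⟨n, m, s, fun f => Finset.univ.filter fun u => (u : ℕ) ∈ E f⟩

theorem ofSets_mem (n m s : ℕ) (E : ℕ → Finset ℕ) (f : Fin (ofSets n m s E).m)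
    (u : Fin (ofSets n m s E).n) : (u : ℕ) ∈ E f ↔ u ∈ (ofSets n m s E).N f :=
  ⟨fun h => Finset.mem_filter.2 ⟨Finset.mem_univ _, h⟩, fun h => (Finset.mem_filter.1 h).2⟩

/-- The matrix of a constructed instance is described by a function of the flat index, which is the
form in which a program writes it. -/
theorem toMem_ofSets {n m s : ℕ} {E : ℕ → Finset ℕ} {χ : ℕ → ℕ}
    (hχ : ∀ a < m * n, χ a = if a % n ∈ E (a / n) then 1 else 0)
    (h0 : ∀ a, m * n ≤ a → χ a = 0) (a : ℕ) :
    (ofSets n m s E).toMem (3 + a) = χ a := by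
  unfold toMem
  rw [if_neg (by omega), if_neg (by omega), if_neg (by omega)]
  by_cases ha : a < m * n
  · have hn : 0 < n := Nat.pos_of_ne_zero (by rintro rfl; simp at ha)
    rw [hχ a ha]
    refine if_congr ?_ rfl rfl
    constructor
    · rintro ⟨f, u, h, e⟩
      have hu : (u : ℕ) < n := u.2
      replace e : 3 + a = 3 + (f : ℕ) * n + u := e
      rw [show a = u + n * f by rw [mul_comm]; omega, Nat.add_mul_mod_self_left,
        Nat.mod_eq_of_lt hu, Nat.add_mul_div_left _ _ hn, Nat.div_eq_of_lt hu, zero_add]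
      exact (ofSets_mem n m s E f u).2 h
    · intro h
      refine ⟨⟨a / n, (Nat.div_lt_iff_lt_mul hn).2 ha⟩, ⟨a % n, Nat.mod_lt _ hn⟩,
        (ofSets_mem n m s E _ _).1 h, ?_⟩
      have := Nat.div_add_mod' a n
      show 3 + a = 3 + a / n * n + a % n
      omega
  · rw [h0 a (by omega), if_neg]
    rintro ⟨f, u, -, h⟩
    have h1 : ((f : ℕ) + 1) * n ≤ m * n := Nat.mul_le_mul_right _ f.2
    have h2 : (u : ℕ) < n := u.2
    simp only [ofSets] at h
    rw [Nat.succ_mul] at h1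
    omega

theorem n_lt_size : I.n < I.size := by
  have : I.n + 1 ≤ (I.n + 1) * (I.m + 1) := Nat.le_mul_of_pos_right _ (by omega)
  simp only [size]; omega

theorem m_lt_size : I.m < I.size := by
  have : I.m + 1 ≤ (I.n + 1) * (I.m + 1) := Nat.le_mul_of_pos_left _ (by omega)
  simp only [size]; omega

theorem mul_lt_size : I.n * I.m < I.size := by
  have : I.n * I.m < (I.n + 1) * (I.m + 1) := by nlinarith
  simp only [size]; omega

theorem s_lt_pow : I.s < 2 ^ I.size :=
  (Nat.lt_size_self _).trans_le (Nat.pow_le_pow_right two_pos (by simp only [size]; omega))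

end SetInstance

namespace RAM

open RAMProg Function

/-! ### Loading the input -/

/-- The binary number formed by the binary digits of `M 1` and the digits `M 3, M 4, …`. -/
def packed (M : ℕ → ℕ) : ℕ → ℕ
  | 0 => M 1
  | j + 1 => 2 * packed M j + M (3 + j)

/-- Each round appends one binary digit, so division by 2^j strips all j of them. -/
theorem packed_div {M : ℕ → ℕ} (hM : ∀ a, M (3 + a) ≤ 1) (j : ℕ) : packed M j / 2 ^ j = M 1 := by
  induction j with
  | zero => simp [packed]
  | succ j ih =>
    have := hM j
    rw [packed, pow_succ', ← Nat.div_div_eq_div_mul,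
      show (2 * packed M j + M (3 + j)) / 2 = packed M j by omega, ih]

/-- Digits are appended at the low end: the register read last is digit 0, hence the reversed index.
-/
theorem packed_bit {M : ℕ → ℕ} (hM : ∀ a, M (3 + a) ≤ 1) {j x : ℕ} (hx : x < j) :
    packed M j / 2 ^ x % 2 = M (3 + (j - 1 - x)) := by
  induction j generalizing x with
  | zero => omega
  | succ j ih =>
    have := hM j
    rw [packed]
    cases x with
    | zero => simp; omega
    | succ x =>
      rw [pow_succ', ← Nat.div_div_eq_div_mul,
        show (2 * packed M j + M (3 + j)) / 2 = packed M j by omega, ih (by omega)]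
      congr 2
      omega

theorem packed_lt {M : ℕ → ℕ} (hM : ∀ a, M (3 + a) ≤ 1) (j : ℕ) :
    packed M j < (M 1 + 1) * 2 ^ j := by
  induction j with
  | zero => simp [packed]
  | succ j ih =>
    have := hM j
    rw [packed, pow_succ', mul_left_comm]
    omega

/-- The code that packs registers `3, …, j + 3` into register `1`. -/
def pack : ℕ → RAMProg
  | 0 => seq (Op.add.prog 1 1 1) (Op.add.prog 1 1 3)
  | j + 1 => seq (pack j) (seq (Op.add.prog 1 1 1) (Op.add.prog 1 1 (3 + (j + 1))))

theorem ev_pack {M : ℕ → ℕ} {w : ℕ} (hM : ∀ a, M (3 + a) ≤ 1) (j : ℕ)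
    (hw : packed M (j + 1) < 2 ^ w) :
    Ev (pack j) M (update M 1 (packed M (j + 1))) ((j + 1) * (10 + 6 * w)) := by
  have step : ∀ i, packed M (i + 1) < 2 ^ w →
      Ev (seq (Op.add.prog 1 1 1) (Op.add.prog 1 1 (3 + i))) (update M 1 (packed M i))
        (update M 1 (packed M (i + 1))) (10 + 6 * w) := by
    intro i hi
    have e : packed M (i + 1) = 2 * packed M i + M (3 + i) := rfl
    have h1 := hM i
    have s1 : Nat.size (packed M i) ≤ w := Nat.size_le.2 (by omega)
    have s2 : Nat.size (2 * packed M i) ≤ w := Nat.size_le.2 (by omega)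
    have s3 : Nat.size (M (3 + i)) ≤ 1 := Nat.size_le.2 (by omega)
    have g1 := Ev.op .add 1 (a := 1) (b := 1) (M := update M 1 (packed M i)) (p := w) (q := w)
      (by simpa using s1) (by simpa using s1)
    rw [update_self, update_idem, show Op.add.fn (packed M i) (packed M i) = 2 * packed M i by
      simp only [Op.fn]; omega] at g1
    have g2 := Ev.op .add 1 (a := 1) (b := 3 + i) (M := update M 1 (2 * packed M i)) (p := w)
      (q := 1) (by simpa using s2) (by rw [update_of_ne (by omega)]; exact s3)
    rw [update_self, update_idem, update_of_ne (show 3 + i ≠ 1 by omega)] at g2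
    exact (g1.seq g2).mono (by omega)
  induction j with
  | zero =>
    have h := step 0 hw
    simp only [packed, update_eq_self] at h
    exact h.mono (by omega)
  | succ j ih =>
    have e : packed M (j + 1 + 1) = 2 * packed M (j + 1) + M (3 + (j + 1)) := rfl
    exact ((ih (by omega)).seq (step _ hw)).mono (by rw [Nat.succ_mul (j + 1)])

/-- The state in which the memory `M₀` is stored in every fourth cell. -/
structure Loaded (I : SetInstance) (σ : St) : Prop where
  r0 : σ.r 0 = I.n
  r1 : σ.r 1 = I.m
  r2 : σ.r 2 = I.s
  c : ∀ a, σ.c a = if 4 ∣ a then I.toMem (a / 4) else 0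

/-- The command that moves the input to every fourth cell. -/
def unpack : Cmd :=
  .seq (.asg 9 (.reg 1 / .con (2 ^ 93))) <|
  .seq (.asg 5 (.reg 0 * .reg 9 - .con 93)) <|
  .seq (.rep 6 5 <|
    .seq (.asg 7 (.reg 5 - (.reg 6 + .con 1))) <|
    .seq (.asg 8 (.cell (.reg 7))) <|
    .seq (.wr (.reg 7) (.con 0)) <|
      .wr (.con 4 * (.con 96 + .reg 7)) (.reg 8)) <|
  .seq (.asg 5 (.con 93)) <|
  .seq (.rep 6 5 <| .wr (.con 4 * (.con 95 - .reg 6)) (.md (.reg 1 / .pow2 6) (.con 2))) <|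
  .seq (.wr (.con 0) (.reg 0)) <|
  .seq (.wr (.con 4) (.reg 9)) <|
  .seq (.wr (.con 8) (.reg 2)) <|
    .asg 1 (.reg 9)

/-- The state after packing. -/
noncomputable def packedSt (I : SetInstance) : St :=
  ⟨update I.toMem 1 (packed I.toMem 93), fun a => I.toMem (96 + a)⟩

theorem packed_toMem_lt (I : SetInstance) {w : ℕ} (hw : I.size + 200 ≤ w) :
    packed I.toMem 93 < 2 ^ w := by
  refine (packed_lt I.toMem_add_three_le 93).trans_le ?_
  rw [I.toMem_one]
  have h1 := I.m_lt_size
  have h2 : I.size < 2 ^ I.size := Nat.lt_two_pow_self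
  calc (I.m + 1) * 2 ^ 93 ≤ 2 ^ I.size * 2 ^ 93 := Nat.mul_le_mul_right _ (by omega)
    _ = 2 ^ (I.size + 93) := by rw [pow_add]
    _ ≤ 2 ^ w := Nat.pow_le_pow_right two_pos (by omega)

theorem toMem_lt (I : SetInstance) {w : ℕ} (hw : I.size + 200 ≤ w) (a : ℕ) :
    I.toMem a < 2 ^ w := by
  have h2 : I.size < 2 ^ I.size := Nat.lt_two_pow_self
  have h3 : 2 ^ I.size ≤ 2 ^ w := Nat.pow_le_pow_right two_pos (by omega)
  have h4 := I.n_lt_size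
  have h5 := I.m_lt_size
  have h6 := I.s_lt_pow
  rcases Nat.lt_or_ge a 3 with ha | ha
  · interval_cases a
    · rw [I.toMem_zero]; omega
    · rw [I.toMem_one]; omega
    · rw [I.toMem_two]; omega
  · have := I.toMem_add_three_le (a - 3)
    rw [show 3 + (a - 3) = a by omega] at this
    omega

theorem bdd_packedSt (I : SetInstance) {w : ℕ} (hw : I.size + 200 ≤ w) : Bdd w (packedSt I) := by
  refine ⟨fun x hx => ?_, fun a => toMem_lt I hw _⟩
  simp only [packedSt, update_apply]
  split_ifs
  exacts [packed_toMem_lt I hw, toMem_lt I hw x]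

/-- The input matrix begins at address 3 and so overlaps the registers and the scratch space. Its
entries at 3, …, 95 have been packed behind m in register 1; the others start at cell 0. These are
moved from the highest index down: the new place 4(96 + b) exceeds b, so no entry still to be moved
is overwritten. -/
theorem tr_unpack (I : SetInstance) {w : ℕ} (hw : I.size + 200 ≤ w) :
    Tr w unpack (packedSt I) (Loaded I) (5 * (I.n * I.m) + 300) := by
  have hn := I.n_lt_size
  have hm := I.m_lt_size
  have hmul := I.mul_lt_size
  have hlt : w < 2 ^ w := Nat.lt_two_pow_self
  have hle := I.toMem_add_three_le
  have m9 : (packedSt I).r 1 / 2 ^ 93 = I.m := by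
    simp only [packedSt, update_self]
    rw [packed_div hle, I.toMem_one]
  have m9' : packed I.toMem 93 / 9903520314283042199192993792 = I.m := by
    rw [show 9903520314283042199192993792 = 2 ^ 93 by norm_num, packed_div hle, I.toMem_one]
  have r0 : (packedSt I).r 0 = I.n := by simp [packedSt, I.toMem_zero]
  have r2 : (packedSt I).r 2 = I.s := by simp [packedSt, I.toMem_two]
  have r1 : (packedSt I).r 1 = packed I.toMem 93 := by simp [packedSt]
  set cnt := I.n * I.m - 93 with hcnt
  have hz : ∀ a, 96 + cnt ≤ a → I.toMem a = 0 := fun a ha => I.toMem_eq_zero (by omega)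
  refine Tr.conseq (T := (((1 + 1 + 1 + 1) + (93 * (1 + 1) + 1)) + 1 + (cnt * (4 + 1) + 1)) + 1 + 1)
    (Q := Loaded I) ?_ (fun σ h => h) (by omega)
  -- After x rounds the lowest cnt - x cells are untouched, the inputs from address 96 + cnt - x on
  -- are at their fourfold addresses, and all other cells are zero.
  refine Tr.asg_seq (by omega) (by simp) (by decide) ?_ (Tr.asg_seq (by omega) (by simp)
    (by decide) ?_ (Tr.rep_seq (fun x σ => σ.r 0 = I.n ∧ σ.r 1 = packed I.toMem 93 ∧ σ.r 2 = I.s ∧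
      σ.r 9 = I.m ∧ σ.r 5 = cnt ∧ ∀ b, σ.c b = if b + x < cnt then I.toMem (96 + b) else
        if 4 ∣ b ∧ 96 + cnt ≤ b / 4 + x then I.toMem (b / 4) else 0)
      (by omega) (by omega) (by omega) ?_ ?_ ?_ ?_))
  · simp only [Ex.eval_div, Ex.eval_reg, Ex.eval_con, m9]; omega
  · simp only [Ex.eval_sub, Ex.eval_mul, Ex.eval_div, Ex.eval_reg, Ex.eval_con, m9, St.set_r,
      if_true, if_neg (show (0 : ℕ) ≠ 9 by omega), r0]; omega
  · simp only [Ex.eval_sub, Ex.eval_mul, Ex.eval_div, Ex.eval_reg, Ex.eval_con, m9, St.set_r,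
      if_true, if_neg (show (0 : ℕ) ≠ 9 by omega), r0]; exact hcnt.symm
  · simp only [Ex.eval_sub, Ex.eval_mul, Ex.eval_div, Ex.eval_reg, Ex.eval_con, m9, St.set_r,
      if_true, if_neg (show (0 : ℕ) ≠ 9 by omega), r0, r1, r2, ← hcnt, St.set_c]
    refine ⟨by simp [r0], by simp [r1], by simp [r2], by simp [r1, m9'],
      by simp [r1, m9', ← hcnt], fun b => ?_⟩
    simp only [packedSt]
    split_ifs with h1 h2
    · rfl
    · rw [hz _ (by omega), hz _ (by omega)]
    · rw [hz _ (by omega)]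
  · rintro x hx σ hx6 - ⟨h0, h1, h2, h9, h5, hc⟩
    refine Tr.asg_seq (by omega) (by simp) (by decide) (by simp [h5]; omega) ?_
    refine Tr.asg_seq (by omega) (by simp) (by decide) ?_ ?_
    · simp only [Ex.eval_cell, St.set_c, hc]
      split_ifs
      exacts [toMem_lt I hw _, toMem_lt I hw _, by positivity]
    refine Tr.wr_seq (by simp) (by simp) (by decide) (by decide) (by simp) ?_
    refine Tr.wr (by simp) (by simp) (by decide) (by decide) ?_ ?_
    · simp only [Ex.eval_reg, Ex.eval_cell, St.set_c, St.put_r, St.set_r, if_true, hc]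
      split_ifs
      exacts [toMem_lt I hw _, toMem_lt I hw _, by positivity]
    · simp only [Ex.eval_sub, Ex.eval_add, Ex.eval_mul, Ex.eval_reg, Ex.eval_con, Ex.eval_cell,
        St.set_r, St.put_r, St.set_c, St.put_c, h5, hx6, if_true]
      refine ⟨by simp [hx6], by simp [h5], by simp [h0], by simp [h1], by simp [h2],
        by simp [h9], by simp [h5], fun b => ?_⟩
      simp only [show (8 : ℕ) ≠ 7 by omega, show (7 : ℕ) ≠ 8 by omega, if_true, if_false, hc]
      rw [if_pos (show cnt - (x + 1) + x < cnt by omega)]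
      split_ifs with g1 g2 g3 g4 g5 g6 g7 g8 g9 <;> first | omega | skip
      all_goals first | rfl | (congr 1; omega)
  · rintro σ ⟨h0, h1, h2, h9, h5, hc⟩
    refine Tr.asg_seq (by omega) (by simp) (by decide) (by simp; omega) ?_
    -- The packed digits follow: after x rounds the inputs from address 96 - x on are in place. The
    -- addresses 0, 1, 2 are filled in after the loop.
    refine Tr.rep_seq (N := 93) (T := 1) (T' := 1 + 1 + 1 + 1)
      (fun x σ => σ.r 0 = I.n ∧ σ.r 1 = packed I.toMem 93 ∧ σ.r 2 = I.s ∧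
        σ.r 9 = I.m ∧ ∀ b, σ.c b = if 4 ∣ b ∧ 96 ≤ b / 4 + x then I.toMem (b / 4) else 0)
      (by omega) (by omega) (by omega) (by simp) ?_ ?_ ?_
    · refine ⟨by simp [h0], by simp [h1], by simp [h2], by simp [h9], fun b => ?_⟩
      simp only [St.set_c, hc]
      split_ifs with g1 g2 g3 g4 <;> omega
    · rintro x hx σ hx6 hx5 ⟨h0, h1, h2, h9, hc⟩
      refine Tr.wr (by simp) (by simp [hx6]; omega) (by decide) (by decide) ?_ ?_
      · simp only [Ex.eval_md, Ex.eval_con]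
        exact (Nat.mod_lt _ two_pos).trans (by omega)
      · simp only [Ex.eval_sub, Ex.eval_md, Ex.eval_div, Ex.eval_mul, Ex.eval_reg, Ex.eval_con,
          Ex.eval_pow2, St.set_r, St.put_r, St.set_c, St.put_c, hx6, h1, packed_bit hle hx]
        refine ⟨trivial, hx5, by simp [h0], by simp [h1], by simp [h2], by simp [h9], fun b => ?_⟩
        rw [hc]
        split_ifs with g1 g2 g3 g4 <;> first | omega | rfl | skip
        congr 1; omega
    · rintro σ ⟨h0, h1, h2, h9, hc⟩
      have hn2 : I.n < 2 ^ w := by omega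
      have hm2 : I.m < 2 ^ w := by omega
      have hs2 : I.s < 2 ^ w := by have := toMem_lt I hw 2; rwa [I.toMem_two] at this
      refine Tr.wr_seq (by simp) (by simp) (by decide) (by decide) (by simpa [h0]) (.seq
        (Tr.wr (by simp) (by simp) (by decide) (by decide) (by simpa [h9]) (.seq
        (Tr.wr (by simp) (by simp) (by decide) (by decide) (by simpa [h2]) (Tr.asg (by omega) (by simp)
          (by decide) (by simpa [h9]) ?_)))))
      refine ⟨by simp [h0], by simp [h9], by simp [h2], fun a => ?_⟩
      simp only [St.set_c, St.put_c, St.put_r, Ex.eval_con, Ex.eval_reg, h0, h2, h9, hc]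
      split_ifs with g1 g2 g3 g4 g5 g6 g7 g8 <;> first | omega | (subst_vars; first
        | exact I.toMem_zero.symm | exact I.toMem_one.symm | exact I.toMem_two.symm)

/-! ### Running times -/

/-- `f` is at most a polynomial in the input size times `2 ^ (δ n)`. -/
def OStar (δ : ℝ) (f : SetInstance → ℝ) : Prop :=
  ∃ k : ℕ, ∀ I, f I ≤ ((I.size : ℝ) + 2) ^ k * 2 ^ (δ * (I.n : ℝ))

theorem OStar.mono {δ δ' : ℝ} {f g : SetInstance → ℝ} (hf : OStar δ f) (hδ : δ ≤ δ')
    (hg : ∀ I, g I ≤ f I) : OStar δ' g := by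
  obtain ⟨k, hf⟩ := hf
  refine ⟨k, fun I => (hg I).trans ((hf I).trans ?_)⟩
  gcongr
  norm_num

theorem OStar.add {δ : ℝ} {f g : SetInstance → ℝ} (hf : OStar δ f) (hg : OStar δ g) :
    OStar δ fun I => f I + g I := by
  obtain ⟨k, hf⟩ := hf
  obtain ⟨l, hg⟩ := hg
  refine ⟨k + l + 1, fun I => ?_⟩
  have hs : (1 : ℝ) ≤ (I.size : ℝ) + 2 := by have : (0 : ℝ) ≤ I.size := by positivity
                                             linarith
  have h1 : ((I.size : ℝ) + 2) ^ k ≤ ((I.size : ℝ) + 2) ^ (k + l) :=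
    pow_le_pow_right₀ hs (by omega)
  have h2 : ((I.size : ℝ) + 2) ^ l ≤ ((I.size : ℝ) + 2) ^ (k + l) :=
    pow_le_pow_right₀ hs (by omega)
  have hp : (0 : ℝ) < 2 ^ (δ * (I.n : ℝ)) := by positivity
  have h3 : ((I.size : ℝ) + 2) ^ k + ((I.size : ℝ) + 2) ^ l ≤ ((I.size : ℝ) + 2) ^ (k + l + 1) := by
    rw [pow_succ]
    have : (0 : ℝ) ≤ ((I.size : ℝ) + 2) ^ (k + l) * I.size := by positivity
    nlinarith
  calc f I + g I ≤ (((I.size : ℝ) + 2) ^ k + ((I.size : ℝ) + 2) ^ l) * 2 ^ (δ * (I.n : ℝ)) := by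
        have := hf I; have := hg I; linarith
    _ ≤ _ := by gcongr

theorem OStar.mul {δ δ' : ℝ} {f g : SetInstance → ℝ} (hf : OStar δ f) (hg : OStar δ' g)
    (h0 : ∀ I, 0 ≤ g I) : OStar (δ + δ') fun I => f I * g I := by
  obtain ⟨k, hf⟩ := hf
  obtain ⟨l, hg⟩ := hg
  refine ⟨k + l, fun I => ?_⟩
  calc f I * g I ≤ (((I.size : ℝ) + 2) ^ k * 2 ^ (δ * (I.n : ℝ))) *
        (((I.size : ℝ) + 2) ^ l * 2 ^ (δ' * (I.n : ℝ))) :=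
        mul_le_mul (hf I) (hg I) (h0 I) (by positivity)
    _ = _ := by rw [add_mul, Real.rpow_add two_pos]; ring

theorem OStar.pow {δ : ℝ} {f : SetInstance → ℝ} (hf : OStar δ f) (h0 : ∀ I, 0 ≤ f I) (K : ℕ) :
    OStar (K * δ) fun I => f I ^ K := by
  obtain ⟨k, hf⟩ := hf
  refine ⟨k * K, fun I => (pow_le_pow_left₀ (h0 I) (hf I) K).trans_eq ?_⟩
  rw [mul_pow, ← pow_mul, ← Real.rpow_natCast, ← Real.rpow_natCast, ← Real.rpow_mul two_pos.le]
  ring_nf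

theorem OStar.of_poly {g : ℕ → ℕ} (hg : PolyBound g) : OStar 0 fun I => (g I.size : ℝ) := by
  obtain ⟨k, hg⟩ := hg
  refine ⟨k, fun I => ?_⟩
  rw [zero_mul, Real.rpow_zero, mul_one]
  show (g I.size : ℝ) ≤ _
  exact_mod_cast hg I.size

theorem OStar.const (c : ℝ) : OStar 0 fun _ => c := by
  obtain ⟨a, ha⟩ := exists_nat_ge c
  exact (OStar.of_poly (.const a)).mono le_rfl fun I => ha

theorem OStar.two_pow (δ : ℝ) : OStar δ fun I => (2 : ℝ) ^ (δ * (I.n : ℝ)) :=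
  ⟨0, fun I => by simp⟩

/-- A problem is solved by a command that either finds the answer or prepares one call of a program
for another problem. -/
theorem solvableInTime_of_cmd {Q Q' : SetInstance → Prop} {δ : ℝ} (hδ : 0 ≤ δ) {p : RAMProg}
    {t' : SetInstance → ℝ} (hp : ∀ I : SetInstance, ∃ (M' : ℕ → ℕ) (t : ℕ),
      p.Exec I.toMem M' t ∧ (Q' I → M' 0 = 1) ∧ (¬ Q' I → M' 0 = 0) ∧ (t : ℝ) ≤ t' I)
    (c : Cmd) (a : ℕ) (T : SetInstance → ℕ) (tJ : SetInstance → ℝ) (ha : 201 ≤ a)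
    (hT : OStar δ fun I => (T I : ℝ)) (hJ : OStar δ tJ)
    (hc : ∀ I σ, Loaded I σ → Bdd (a * I.size) σ → Tr (a * I.size) c σ (fun σ' =>
      ∃ J : SetInstance, (∀ b, σ'.c (4 * b + 3) = J.toMem b) ∧ t' J ≤ tJ I ∧
        (Q I ↔ σ'.r 4 ≠ 0 ∨ Q' J)) (T I)) : SolvableInTime Q δ := by
  have htot : OStar δ fun I => ((((94 * (10 + 6 * (a * I.size)) + (5 * I.size + 300)
      * unpack.tau (a * I.size) + 20 : ℕ) : ℝ) + (T I : ℝ) * (c.tau (a * I.size) : ℕ))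
      + 80 * tJ I) := by
    have hP : PolyBound fun w => a * w := (PolyBound.const a).mul .id
    refine OStar.add (OStar.add (OStar.mono (OStar.of_poly (g := fun w =>
      94 * (10 + 6 * (a * w)) + (5 * w + 300) * unpack.tau (a * w) + 20) ?_) hδ fun I => le_rfl)
      ?_) ?_
    · exact (((PolyBound.const 94).mul ((PolyBound.const 10).add ((PolyBound.const 6).mul hP))).add
        ((((PolyBound.const 5).mul .id).add (.const 300)).mul
          (unpack.polyBound_tau.comp hP))).add (.const 20)
    · exact (hT.mul (OStar.of_poly (c.polyBound_tau.comp hP)) fun I => by positivity).mono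
        (by simp) fun I => le_rfl
    · obtain ⟨k, hJ⟩ := hJ
      exact ((OStar.const 80).mul (f := fun _ => 80) (g := fun I =>
        ((I.size : ℝ) + 2) ^ k * 2 ^ (δ * (I.n : ℝ))) ⟨k, fun I => le_rfl⟩
        fun I => by positivity).mono (by simp) fun I => by have := hJ I; linarith
  obtain ⟨k, htot⟩ := htot
  -- The assumed program runs in every case, and register 4 decides whether its answer counts. That
  -- answer is its register 0, hosted at address 99. The constant 3^k comes from size + 2 ≤ 3 ·
  -- size.
  refine ⟨seq (pack 92) (seq unpack.comp (seq c.comp (seq (hosted p)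
    (RAMProg.ite 4 (const 0 1) (copy 0 99))))), 3 ^ k, k, fun I => ?_⟩
  have hs : 1 ≤ I.size := by have := I.n_lt_size; omega
  have hw : I.size + 200 ≤ a * I.size := by nlinarith
  have g1 := ev_pack I.toMem_add_three_le 92 (packed_toMem_lt I hw)
  obtain ⟨σ1, L1, B1, h2⟩ := (tr_unpack I hw).run (bdd_packedSt I hw)
  obtain ⟨M2, g2, S2⟩ := h2 (update I.toMem 1 (packed I.toMem 93))
    ⟨fun x _ => rfl, fun a => by simp only [packedSt]; rw [update_of_ne (by omega)]⟩
  obtain ⟨σ3, ⟨J, hJ3, htJ, hQ⟩, B3, h3⟩ := (hc I σ1 L1 B1).run B1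
  obtain ⟨M3, g3, S3⟩ := h3 M2 S2
  obtain ⟨N, t, hN, hy, hn, ht⟩ := hp J
  obtain ⟨M4, g4, H4⟩ := exec_hosted hN (N := M3) (M := M3)
    ⟨fun b => by rw [← hJ3, ← S3.cell]; rfl, fun x _ => rfl⟩
  have e4 : M4 4 = σ3.r 4 := by rw [H4.2 4 (by omega), S3.reg 4 (by omega)]
  have e99 : M4 99 = N 0 := H4.1 0
  have hN1 : N 0 ≤ 1 := by
    by_cases h : Q' J
    · rw [hy h]
    · rw [hn h]; omega
  have s4 : Nat.size (M4 4) ≤ a * I.size := by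
    rw [e4, Nat.size_le]; exact B3.reg 4 (by omega)
  have g5 : ∃ M5, Ev (RAMProg.ite 4 (const 0 1) (copy 0 99)) M4 M5 (1 + a * I.size + 10) ∧
      M5 0 = if σ3.r 4 ≠ 0 then 1 else N 0 := by
    split_ifs with h
    · obtain ⟨j, h5, hj⟩ := Ev.const 0 M4 (c := 1) (p := 1) (by simp)
      exact ⟨_, ⟨_, Exec.ite_true (by rwa [e4]) h5, by omega⟩, by simp⟩
    · obtain ⟨j, h5, hj⟩ := Ev.copy (d := 0) (a := 99) (M := M4) (p := 1) (by omega)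
        (by rw [e99, Nat.size_le]; omega)
      exact ⟨_, ⟨_, Exec.ite_false (by rw [e4]; omega) h5, by omega⟩, by simp [e99]⟩
  obtain ⟨M5, g5, e5⟩ := g5
  obtain ⟨tt, hex, htt⟩ := g1.seq (g2.seq (g3.seq (g4.seq g5)))
  refine ⟨M5, tt, hex, fun h => ?_, fun h => ?_, ?_⟩
  · rw [e5]
    split_ifs with h4
    · rfl
    · exact hy ((hQ.1 h).resolve_left h4)
  · rw [e5, if_neg fun h4 => h (hQ.2 (Or.inl h4))]
    exact hn fun h' => h (hQ.2 (Or.inr h'))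
  · have hm := I.mul_lt_size
    have h1 : (5 * (I.n * I.m) + 300) * unpack.tau (a * I.size)
        ≤ (5 * I.size + 300) * unpack.tau (a * I.size) := Nat.mul_le_mul_right _ (by omega)
    have h2 : tt ≤ (94 * (10 + 6 * (a * I.size)) + (5 * I.size + 300) * unpack.tau (a * I.size) + 20)
        + T I * c.tau (a * I.size) + 80 * t := by omega
    have h3 : (tt : ℝ) ≤ ((94 * (10 + 6 * (a * I.size)) + (5 * I.size + 300)
      * unpack.tau (a * I.size) + 20 : ℕ) : ℝ) + (T I : ℝ) * (c.tau (a * I.size) : ℕ) + 80 * t := by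
      exact_mod_cast h2
    refine (h3.trans ((add_le_add_right (mul_le_mul_of_nonneg_left (ht.trans htJ) (by norm_num)) _).trans
      (htot I))).trans ?_
    rw [← mul_pow]
    have : (1 : ℝ) ≤ I.size := by exact_mod_cast hs
    gcongr
    linarith

end RAM

/-! ### Sets of numbers as binary numbers -/

namespace SetCode

open Finset

/-- Splitting off the lowest digit and halving shifts the digit sequence by one place. -/
theorem sum_two_pow_bit {n : ℕ} {d : ℕ → ℕ} (hd : ∀ u, d u ≤ 1) {v : ℕ} (hv : v < n) :
    (∑ u ∈ range n, 2 ^ u * d u) / 2 ^ v % 2 = d v := by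
  induction n generalizing d v with
  | zero => omega
  | succ n ih =>
    have e : ∑ u ∈ range (n + 1), 2 ^ u * d u
        = 2 * (∑ u ∈ range n, 2 ^ u * d (u + 1)) + d 0 := by
      rw [sum_range_succ', mul_sum]
      simp only [pow_zero, one_mul, pow_succ']
      congr 1
      exact sum_congr rfl fun u _ => by ring
    have h0 := hd 0
    rw [e]
    cases v with
    | zero => simp; omega
    | succ v =>
      rw [pow_succ', ← Nat.div_div_eq_div_mul, show ∀ x, (2 * x + d 0) / 2 = x by intro x; omega]
      exact ih (fun u => hd (u + 1)) (by omega)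

theorem sum_two_pow_lt {n : ℕ} {d : ℕ → ℕ} (hd : ∀ u, d u ≤ 1) :
    ∑ u ∈ range n, 2 ^ u * d u < 2 ^ n := by
  induction n with
  | zero => simp
  | succ n ih =>
    rw [sum_range_succ, pow_succ]
    have := Nat.mul_le_mul_left (2 ^ n) (hd n)
    omega

/-- The binary number whose digits mark the elements of `X` below `n`. -/
def mask (n : ℕ) (X : Finset ℕ) : ℕ := ∑ u ∈ range n, 2 ^ u * if u ∈ X then 1 else 0

theorem mask_bit {n u : ℕ} (X : Finset ℕ) (hu : u < n) :
    mask n X / 2 ^ u % 2 = if u ∈ X then 1 else 0 :=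
  sum_two_pow_bit (d := fun u => if u ∈ X then 1 else 0) (fun u => by split_ifs <;> omega) hu

theorem mask_lt (n : ℕ) (X : Finset ℕ) : mask n X < 2 ^ n :=
  sum_two_pow_lt fun u => by split_ifs <;> omega

theorem mask_inj {n : ℕ} {X Y : Finset ℕ} (hX : X ⊆ range n) (hY : Y ⊆ range n)
    (h : mask n X = mask n Y) : X = Y := by
  ext u
  by_cases hu : u < n
  · have h1 := mask_bit X hu
    rw [h, mask_bit Y hu] at h1
    split_ifs at h1 with h2 h3 <;> simp_all
  · exact ⟨fun h => absurd (mem_range.1 (hX h)) hu, fun h => absurd (mem_range.1 (hY h)) hu⟩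

@[simp] theorem mask_empty (n : ℕ) : mask n ∅ = 0 := by simp [mask]

/-- The code of a set `X` together with a number `j < q`. -/
def code (n q : ℕ) (X : Finset ℕ) (j : ℕ) : ℕ := mask n X * q + j

@[simp] theorem code_empty_zero (n q : ℕ) : code n q ∅ 0 = 0 := by simp [code]

theorem code_div {n q j : ℕ} (X : Finset ℕ) (hj : j < q) : code n q X j / q = mask n X := by
  rw [code, mul_comm, Nat.mul_add_div (by omega), Nat.div_eq_of_lt hj, add_zero]

theorem code_mod {n q j : ℕ} (X : Finset ℕ) (hj : j < q) : code n q X j % q = j := by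
  rw [code, Nat.mul_add_mod', Nat.mod_eq_of_lt hj]

theorem code_lt {n q j : ℕ} (X : Finset ℕ) (hj : j < q) : code n q X j < 2 ^ n * q := by
  have h := Nat.mul_le_mul_right q (mask_lt n X)
  rw [Nat.succ_mul] at h
  simp only [code]
  omega

/-- One step of the dynamic program: apply `new` to all codes that pass the guard. -/
def dpStep (G : ℕ → Prop) [DecidablePred G] (new : ℕ → ℕ) (L : Finset ℕ) : Finset ℕ :=
  L ∪ (L.filter G).image new

/-- One pass of the dynamic program over all members of the family below `m`. -/
def dpPass (G : ℕ → ℕ → Prop) [∀ f, DecidablePred (G f)] (new : ℕ → ℕ → ℕ) (L : Finset ℕ) :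
    ℕ → Finset ℕ
  | 0 => L
  | m + 1 => dpStep (G m) (new m) (dpPass G new L m)

variable {G : ℕ → ℕ → Prop} [∀ f, DecidablePred (G f)] {new : ℕ → ℕ → ℕ} {L : Finset ℕ}

theorem dpPass_mono {i j : ℕ} (h : i ≤ j) : dpPass G new L i ⊆ dpPass G new L j := by
  induction j, h using Nat.le_induction with
  | base => exact Subset.rfl
  | succ j _ ih => exact ih.trans subset_union_left

theorem new_mem_dpPass {f c : ℕ} (hc : c ∈ dpPass G new L f) (hG : G f c) :
    new f c ∈ dpPass G new L (f + 1) :=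
  mem_union_right _ (mem_image_of_mem _ (mem_filter.2 ⟨hc, hG⟩))

theorem dpPass_induction {P : ℕ → Prop} {m : ℕ} (h0 : ∀ c ∈ L, P c)
    (hs : ∀ f < m, ∀ c, P c → G f c → P (new f c)) : ∀ c ∈ dpPass G new L m, P c := by
  induction m with
  | zero => exact h0
  | succ m ih =>
    intro c hc
    have ih := ih fun f hf => hs f (by omega)
    rcases mem_union.1 hc with hc | hc
    · exact ih c hc
    · obtain ⟨d, hd, rfl⟩ := mem_image.1 hc
      exact hs m (by omega) d (ih d (mem_filter.1 hd).1) (mem_filter.1 hd).2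

/-- The code of the union of the set coded by `c` with `Y`, with the number increased by one. -/
def joinCode (n q : ℕ) (Y : Finset ℕ) (c : ℕ) : ℕ :=
  (∑ u ∈ range n, 2 ^ u * if c / q / 2 ^ u % 2 + (if u ∈ Y then 1 else 0) = 0 then 0 else 1) * q
    + (c % q + 1)

/-- Union is disjunction of digits; the machine has no bitwise operations, so `joinCode` rebuilds
the mask digit by digit. -/
theorem joinCode_code {n q j : ℕ} (X Y : Finset ℕ) (hj : j < q) :
    joinCode n q Y (code n q X j) = code n q (X ∪ Y) (j + 1) := by
  rw [joinCode, code_div X hj, code_mod X hj]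
  conv_rhs => rw [code, mask]
  congr 2
  refine sum_congr rfl fun u hu => ?_
  rw [mask_bit X (mem_range.1 hu)]
  congr 1
  by_cases h1 : u ∈ X <;> by_cases h2 : u ∈ Y <;> simp [h1, h2]

/-- No guard is assumed, because the machine computes the new code before testing the guard. The
number c % q + 1 may then reach q, hence ≤ instead of <. -/
theorem joinCode_lt {n q : ℕ} (hq : 0 < q) (Y : Finset ℕ) (c : ℕ) :
    joinCode n q Y c ≤ 2 ^ n * q := by
  have h := Nat.mul_le_mul_right q (Nat.succ_le_of_lt
    (sum_two_pow_lt (n := n) (d := fun u => if c / q / 2 ^ u % 2 + (if u ∈ Y then 1 else 0) = 0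
      then 0 else 1) fun u => by split_ifs <;> omega))
  have h2 := Nat.mod_lt c hq
  rw [Nat.succ_mul] at h
  simp only [joinCode]
  omega

/-! ### Covers with a large member -/

section Cover

variable (n q k : ℕ) (E : ℕ → Finset ℕ)

/-- The guard of the dynamic program for covers with a member of more than `k` elements. -/
def CoverGuard (f c : ℕ) : Prop := (k < (E f).card ∨ c ≠ 0) ∧ c % q + 1 < q

instance (f : ℕ) : DecidablePred (CoverGuard q k E f) := fun _ => by
  unfold CoverGuard; infer_instance

/-- One pass of the dynamic program for covers. -/
def coverPass (L : Finset ℕ) (m : ℕ) : Finset ℕ :=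
  dpPass (CoverGuard q k E) (fun f => joinCode n q (E f)) L m

variable {n q k E} {m : ℕ}

/-- The codes of unions of families with a large member. -/
def IsCoverCode (n q k : ℕ) (E : ℕ → Finset ℕ) (m c : ℕ) : Prop :=
  ∃ S ⊆ range m, ∃ j < q, S.card ≤ j ∧ c = code n q (S.biUnion E) j ∧
    (c = 0 ∨ ∃ f ∈ S, k < (E f).card)

/-- A member may be joined to a union that already uses it, so the number in a code is only an upper
bound for the size of the family. For covers with at most s members this is enough. -/
theorem coverPass_sound {L : Finset ℕ} {i : ℕ} (hi : i ≤ m)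
    (hL : ∀ c ∈ L, IsCoverCode n q k E m c) :
    ∀ c ∈ coverPass n q k E L i, IsCoverCode n q k E m c := by
  refine dpPass_induction hL fun f hf c hc hG => ?_
  obtain ⟨S, hS, j, hj, hSj, hcj, hc⟩ := hc
  have hm : c % q = j := by rw [hcj, code_mod _ hj]
  obtain ⟨hG1, hG2⟩ := hG
  rw [hm] at hG2
  refine ⟨insert f S, insert_subset (mem_range.2 (by omega)) hS, j + 1, hG2,
    (card_insert_le _ _).trans (by omega), ?_, Or.inr ?_⟩
  · rw [hcj, joinCode_code _ _ hj, biUnion_insert, union_comm]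
  · rcases hG1 with h | h
    · exact ⟨f, mem_insert_self _ _, h⟩
    · obtain ⟨g, hg, hgk⟩ := hc.resolve_left h
      exact ⟨g, mem_insert_of_mem hg, hgk⟩

theorem isCoverCode_zero (hq : 0 < q) : IsCoverCode n q k E m 0 :=
  ⟨∅, empty_subset _, 0, hq, le_rfl, by simp, Or.inl rfl⟩

/-- Starting from the code 0, only a large member may be joined, and it may come late in the order.
The first pass therefore only has to supply the large member f₀ by itself; the second joins the rest
of S to it in increasing order. -/
theorem coverPass_complete {S : Finset ℕ} (hS : S ⊆ range m) {f₀ : ℕ} (hf₀ : f₀ ∈ S)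
    (hk : k < (E f₀).card) :
    code n (m + 1) (S.biUnion E) S.card ∈
      coverPass n (m + 1) k E (coverPass n (m + 1) k E {0} m) m := by
  have hm := mem_range.1 (hS hf₀)
  have h1 : code n (m + 1) (E f₀) 1 ∈ coverPass n (m + 1) k E {0} m := by
    have h0 : (0 : ℕ) ∈ coverPass n (m + 1) k E {0} f₀ :=
      dpPass_mono (Nat.zero_le _) (mem_singleton_self 0)
    have h := new_mem_dpPass h0 (show CoverGuard (m + 1) k E f₀ 0 from
      ⟨Or.inl hk, by rw [Nat.zero_mod]; omega⟩)
    have e := joinCode_code (n := n) (q := m + 1) (j := 0) ∅ (E f₀) (by omega)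
    rw [code_empty_zero, empty_union, zero_add] at e
    simp only [e] at h
    exact dpPass_mono (by omega) h
  have key : ∀ f ≤ m, ∀ S' ⊆ range f, f₀ ∉ S' →
      code n (m + 1) (E f₀ ∪ S'.biUnion E) (S'.card + 1) ∈
        coverPass n (m + 1) k E (coverPass n (m + 1) k E {0} m) f := by
    intro f
    induction f with
    | zero =>
      intro _ S' hS' _
      rw [range_zero, subset_empty] at hS'
      subst hS'
      rw [biUnion_empty, union_empty, card_empty, zero_add]
      exact h1
    | succ f ih =>
      intro hf S' hS' h0
      by_cases hfS : f ∈ S'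
      · have hsub : S'.erase f ⊆ range f := fun g hg => by
          have h1 := mem_range.1 (hS' (mem_of_mem_erase hg))
          have h2 := ne_of_mem_erase hg
          exact mem_range.2 (by omega)
        have hc := ih (by omega) (S'.erase f) hsub fun h => h0 (mem_of_mem_erase h)
        have hcard : (S'.erase f).card + 1 = S'.card := card_erase_add_one hfS
        -- Together with f₀ there is still room among m members, so the number in the code stays
        -- below m + 1, as the guard demands.
        have hlt : S'.card < m := by
          have : (insert f₀ S').card ≤ (range m).card := card_le_card
            (insert_subset (mem_range.2 hm) (hS'.trans (range_mono hf)))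
          rw [card_insert_of_notMem h0, card_range] at this
          omega
        have h := new_mem_dpPass hc (show CoverGuard (m + 1) k E f _ from
          ⟨Or.inr (by simp only [code]; omega), by rw [code_mod _ (by omega)]; omega⟩)
        rw [joinCode_code _ _ (by omega), hcard] at h
        have e : E f₀ ∪ (S'.erase f).biUnion E ∪ E f = E f₀ ∪ S'.biUnion E := by
          conv_rhs => rw [← insert_erase hfS]
          rw [biUnion_insert, union_assoc, union_comm (E f)]
        rw [e] at h
        exact h
      · refine dpPass_mono (Nat.le_succ f) (ih (by omega) S' (fun g hg => ?_) h0)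
        have h1 := mem_range.1 (hS' hg)
        have h2 : g ≠ f := fun h => hfS (h ▸ hg)
        exact mem_range.2 (by omega)
  have h := key m le_rfl (S.erase f₀) ((erase_subset _ _).trans hS) (notMem_erase _ _)
  rwa [card_erase_add_one hf₀, ← biUnion_insert, insert_erase hf₀] at h

/-- A nonzero code is determined by a large member f of its family, by the part of the union outside
E f, for which there are at most 2^(n-k) choices, and by its number below q. The summand 1 is for
the code 0. -/
theorem card_coverCodes_le (hE : ∀ f, E f ⊆ range n) {L : Finset ℕ}
    (hL : ∀ c ∈ L, IsCoverCode n q k E m c) : L.card ≤ 1 + m * (2 ^ (n - k) * q) := by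
  classical
  let F := (range m).filter fun f => k < (E f).card
  have hsub : L ⊆ insert 0 (F.biUnion fun f =>
      ((range n \ E f).powerset ×ˢ range q).image fun p => code n q (E f ∪ p.1) p.2) := by
    intro c hc
    obtain ⟨S, hS, j, hj, hSj, hcj, rfl | ⟨f, hf, hfk⟩⟩ := hL c hc
    · exact mem_insert_self _ _
    · refine mem_insert_of_mem (mem_biUnion.2 ⟨f, mem_filter.2 ⟨hS hf, hfk⟩, mem_image.2
        ⟨(S.biUnion E \ E f, j), mem_product.2 ⟨mem_powerset.2 ?_, mem_range.2 hj⟩, ?_⟩⟩)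
      · exact sdiff_subset_sdiff (biUnion_subset.2 fun g _ => hE g) Subset.rfl
      · simp only
        rw [union_sdiff_of_subset (subset_biUnion_of_mem E hf), hcj]
  refine (card_le_card hsub).trans ((card_insert_le _ _).trans ?_)
  rw [add_comm]
  refine Nat.add_le_add_left ?_ _
  refine (card_biUnion_le_card_mul F _ (2 ^ (n - k) * q) fun f hf => ?_).trans
    (Nat.mul_le_mul_right _ ((card_filter_le _ _).trans_eq (card_range m)))
  refine card_image_le.trans ?_
  rw [card_product, card_powerset, card_range, card_sdiff_of_subset (hE f), card_range]
  have := (mem_filter.1 hf).2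
  exact Nat.mul_le_mul_right _ (Nat.pow_le_pow_right two_pos (by omega))

/-- Some cover with at most `s` members, one of them large, has been found. -/
def CoverFound (n m s k : ℕ) (E : ℕ → Finset ℕ) : Prop :=
  ∃ j < m + 1, j ≤ s ∧ code n (m + 1) (range n) j ∈
    coverPass n (m + 1) k E (coverPass n (m + 1) k E {0} m) m

theorem coverPass_twice_sound {i : ℕ} (hi : i ≤ m) :
    ∀ c ∈ coverPass n (m + 1) k E (coverPass n (m + 1) k E {0} m) i,
      IsCoverCode n (m + 1) k E m c :=
  coverPass_sound hi <| coverPass_sound le_rfl fun c hc => by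
    rw [mem_singleton.1 hc]; exact isCoverCode_zero (by omega)

theorem covers_iff_biUnion {S : Finset ℕ} (hE : ∀ f, E f ⊆ range n) :
    Covers n S E ↔ S.biUnion E = range n := by
  constructor
  · intro h
    refine (biUnion_subset.2 fun f _ => hE f).antisymm fun u hu => ?_
    obtain ⟨f, hf, huf⟩ := h u (mem_range.1 hu)
    exact mem_biUnion.2 ⟨f, hf, huf⟩
  · intro h u hu
    have : u ∈ S.biUnion E := h ▸ mem_range.2 hu
    simpa using this

theorem CoverFound.hasCover {s : ℕ} (hE : ∀ f, E f ⊆ range n) (h : CoverFound n m s k E) :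
    HasCover n m s E := by
  obtain ⟨j, hj, hjs, h⟩ := h
  obtain ⟨S, hS, i, hi, hSi, hc, -⟩ := coverPass_twice_sound le_rfl _ h
  have e1 : j = i := by rw [← code_mod (n := n) (range n) hj, hc, code_mod _ hi]
  have e2 : mask n (range n) = mask n (S.biUnion E) := by
    rw [← code_div (q := m + 1) (range n) hj, hc, code_div _ hi]
  exact ⟨S, hS, by omega, (covers_iff_biUnion hE).2
    (mask_inj Subset.rfl (biUnion_subset.2 fun f _ => hE f) e2).symm⟩

theorem coverFound_of_large {s : ℕ} (hE : ∀ f, E f ⊆ range n) {S : Finset ℕ} (hS : S ⊆ range m)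
    (hs : S.card ≤ s) (hc : Covers n S E) {f : ℕ} (hf : f ∈ S) (hk : k < (E f).card) :
    CoverFound n m s k E := by
  have h := card_le_card hS
  rw [card_range] at h
  refine ⟨S.card, by omega, hs, ?_⟩
  rw [← (covers_iff_biUnion hE).1 hc]
  exact coverPass_complete hS hf hk

/-! ### Covers without large members -/

/-- The number of elements of `X` below `u`. -/
def rank (X : Finset ℕ) (u : ℕ) : ℕ := ∑ v ∈ range u, if v ∈ X then 1 else 0

theorem rank_mono (X : Finset ℕ) {u v : ℕ} (h : u ≤ v) : rank X u ≤ rank X v :=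
  sum_le_sum_of_subset (range_mono h)

theorem rank_lt {X : Finset ℕ} {u v : ℕ} (h : u < v) (hu : u ∈ X) : rank X u < rank X v := by
  refine lt_of_lt_of_le ?_ (rank_mono X (Nat.succ_le_of_lt h))
  rw [rank, rank, sum_range_succ, if_pos hu]
  omega

theorem rank_inj {X : Finset ℕ} {u v : ℕ} (hu : u ∈ X) (hv : v ∈ X) (h : rank X u = rank X v) :
    u = v := by
  rcases lt_trichotomy u v with h' | h' | h'
  · exact absurd (rank_lt h' hu) (by omega)
  · exact h'
  · exact absurd (rank_lt h' hv) (by omega)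

theorem rank_eq_card {X : Finset ℕ} (hX : X ⊆ range n) : rank X n = X.card := by
  rw [rank, ← sum_filter, sum_const, smul_eq_mul, mul_one, filter_mem_eq_inter,
    inter_eq_right.2 hX]

variable (m k E) in
/-- The subsets of the members with at most `k` elements, followed by empty sets. -/
def subsetRows (ρ : ℕ) : Finset ℕ :=
  if ρ < m * 2 ^ k ∧ (E (ρ / 2 ^ k)).card ≤ k then
    (E (ρ / 2 ^ k)).filter fun u => ρ % 2 ^ k / 2 ^ rank (E (ρ / 2 ^ k)) u % 2 = 1
  else ∅

theorem subsetRows_subset (ρ : ℕ) : subsetRows k E m ρ ⊆ E (ρ / 2 ^ k) := by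
  unfold subsetRows
  split_ifs
  exacts [filter_subset _ _, empty_subset _]

/-- Digits refer to the ranks of the elements within E f and not to the elements themselves, so k
digits describe every subset of a set with at most k elements. -/
theorem exists_subsetRow (hE : ∀ f, E f ⊆ range n) {f : ℕ} (hf : f < m) (hk : (E f).card ≤ k)
    {Y : Finset ℕ} (hY : Y ⊆ E f) :
    ∃ ρ < m * 2 ^ k, ρ / 2 ^ k = f ∧ subsetRows k E m ρ = Y := by
  classical
  have hd : ∀ i, (if ∃ u ∈ Y, rank (E f) u = i then 1 else 0) ≤ 1 := fun i => by
    split_ifs <;> omega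
  -- Digit i of r records whether the element of rank i in E f lies in Y.
  set r := ∑ i ∈ range k, 2 ^ i * if ∃ u ∈ Y, rank (E f) u = i then 1 else 0 with hr
  have hrlt : r < 2 ^ k := sum_two_pow_lt hd
  have e1 : (f * 2 ^ k + r) / 2 ^ k = f := by
    rw [mul_comm, Nat.mul_add_div (by positivity), Nat.div_eq_of_lt hrlt, add_zero]
  have e2 : (f * 2 ^ k + r) % 2 ^ k = r := by rw [Nat.mul_add_mod', Nat.mod_eq_of_lt hrlt]
  have hlt : f * 2 ^ k + r < m * 2 ^ k := by
    have := Nat.mul_le_mul_right (2 ^ k) (Nat.succ_le_of_lt hf)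
    rw [Nat.succ_mul] at this
    omega
  refine ⟨f * 2 ^ k + r, hlt, e1, ?_⟩
  rw [subsetRows, e1, e2, if_pos ⟨hlt, hk⟩]
  ext u
  rw [mem_filter]
  have key : ∀ u ∈ E f, r / 2 ^ rank (E f) u % 2 = if ∃ v ∈ Y, rank (E f) v = rank (E f) u
      then 1 else 0 := fun u hu => sum_two_pow_bit hd (by
    have h1 := rank_lt (mem_range.1 (hE f hu)) hu
    rw [rank_eq_card (hE f)] at h1
    omega)
  constructor
  · rintro ⟨hu, h⟩
    rw [key u hu] at h
    split_ifs at h with h'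
    · obtain ⟨v, hv, hvu⟩ := h'
      rwa [← rank_inj (hY hv) hu hvu]
  · intro hu
    exact ⟨hY hu, by rw [key u (hY hu), if_pos ⟨u, hu, rfl⟩]⟩

/-- Each element u picks a member g u of the cover that contains it. The fibres of g are disjoint
subsets of small members, and at most min s n of them are nonempty. The n empty rows at the end of
the family bring the number of parts to exactly min s n. -/
theorem hasPartition_subsetRows {s : ℕ} (hE : ∀ f, E f ⊆ range n) {S : Finset ℕ}
    (hS : S ⊆ range m) (hs : S.card ≤ s) (hc : Covers n S E) (hk : ∀ f ∈ S, (E f).card ≤ k) :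
    HasPartition n (m * 2 ^ k + n) (min s n) (subsetRows k E m) := by
  classical
  choose! g hgS hgE using hc
  let Y : ℕ → Finset ℕ := fun f => (range n).filter fun u => g u = f
  have hYE : ∀ f, Y f ⊆ E f := fun f u hu => by
    obtain ⟨h1, h2⟩ := mem_filter.1 hu
    exact h2 ▸ hgE u (mem_range.1 h1)
  have hρ : ∀ f ∈ S, ∃ ρ < m * 2 ^ k, ρ / 2 ^ k = f ∧ subsetRows k E m ρ = Y f := fun f hf =>
    exists_subsetRow hE (mem_range.1 (hS hf)) (hk f hf) (hYE f)
  choose! ρ hρlt hρdiv hρ using hρ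
  set T := (range n).image g with hT
  have hTS : T ⊆ S := fun f hf => by
    obtain ⟨u, hu, rfl⟩ := mem_image.1 hf
    exact hgS u (mem_range.1 hu)
  have hTcard : T.card ≤ min s n :=
    le_min ((card_le_card hTS).trans hs) (card_image_le.trans_eq (card_range n))
  -- Rows of different members lie in different blocks of length 2^k.
  have hinj : Set.InjOn ρ T := fun a ha b hb h => by
    rw [← hρdiv a (hTS ha), h, hρdiv b (hTS hb)]
  let Z := (range (min s n - T.card)).image fun i => m * 2 ^ k + i
  have hZ : ∀ z ∈ Z, m * 2 ^ k ≤ z ∧ z < m * 2 ^ k + n := fun z hz => by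
    obtain ⟨i, hi, rfl⟩ := mem_image.1 hz
    have := mem_range.1 hi
    have := Nat.min_le_right s n
    omega
  have hZe : ∀ z ∈ Z, subsetRows k E m z = ∅ := fun z hz => by
    rw [subsetRows, if_neg (by have := hZ z hz; omega)]
  have hdis : Disjoint (T.image ρ) Z := disjoint_left.2 fun a ha hz => by
    obtain ⟨f, hf, rfl⟩ := mem_image.1 ha
    have := hρlt f (hTS hf)
    have := hZ _ hz
    omega
  refine ⟨T.image ρ ∪ Z, ?_, ?_, ?_, ?_⟩
  · refine union_subset (fun a ha => ?_) fun z hz => mem_range.2 (hZ z hz).2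
    obtain ⟨f, hf, rfl⟩ := mem_image.1 ha
    have := hρlt f (hTS hf)
    exact mem_range.2 (by omega)
  · have hZcard : Z.card = min s n - T.card := by
      rw [card_image_of_injective _ (fun a b h => by simpa using h), card_range]
    rw [card_union_of_disjoint hdis, card_image_of_injOn hinj]
    omega
  · intro u hu
    have hgT : g u ∈ T := mem_image_of_mem _ (mem_range.2 hu)
    refine ⟨ρ (g u), mem_union_left _ (mem_image_of_mem _ hgT), ?_⟩
    rw [hρ _ (hTS hgT)]
    exact mem_filter.2 ⟨mem_range.2 hu, rfl⟩
  · intro a ha b hb hab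
    rw [Function.onFun, disjoint_left]
    intro u hua hub
    have hcase : ∀ c ∈ T.image ρ ∪ Z, u ∈ subsetRows k E m c → c = ρ (g u) := by
      intro c hc hu
      rcases mem_union.1 hc with hc | hc
      · obtain ⟨f, hf, rfl⟩ := mem_image.1 hc
        rw [hρ f (hTS hf)] at hu
        rw [(mem_filter.1 hu).2]
      · rw [hZe c hc] at hu
        exact absurd hu (notMem_empty _)
    exact hab ((hcase a ha hua).trans (hcase b hb hub).symm)

/-- Replacing each row by the member it is a subset of only enlarges the sets. Empty rows are
dropped first, because the padding rows have block numbers that need not belong to a member. -/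
theorem HasPartition.hasCover_of_subsetRows {s : ℕ}
    (h : HasPartition n (m * 2 ^ k + n) (min s n) (subsetRows k E m)) : HasCover n m s E := by
  obtain ⟨S, -, hcard, hcov, -⟩ := h
  refine ⟨(S.filter fun ρ => subsetRows k E m ρ ≠ ∅).image (· / 2 ^ k), ?_, ?_, ?_⟩
  · intro f hf
    obtain ⟨ρ, hρ, rfl⟩ := mem_image.1 hf
    have hne := (mem_filter.1 hρ).2
    unfold subsetRows at hne
    split_ifs at hne with h
    · exact mem_range.2 ((Nat.div_lt_iff_lt_mul (by positivity)).2 h.1)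
    · exact absurd rfl hne
  · exact card_image_le.trans ((card_filter_le _ _).trans (by omega))
  · intro u hu
    obtain ⟨ρ, hρ, hu⟩ := hcov u hu
    exact ⟨ρ / 2 ^ k, mem_image_of_mem _ (mem_filter.2 ⟨hρ, ne_empty_of_mem hu⟩),
      subsetRows_subset ρ hu⟩

/-- Every cover either has a member above the threshold or has none. The equivalence holds for every
k; only the running time dictates its choice. -/
theorem hasCover_iff {s : ℕ} (hE : ∀ f, E f ⊆ range n) : HasCover n m s E ↔
    CoverFound n m s k E ∨ HasPartition n (m * 2 ^ k + n) (min s n) (subsetRows k E m) := by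
  constructor
  · rintro ⟨S, hS, hs, hc⟩
    by_cases hk : ∃ f ∈ S, k < (E f).card
    · obtain ⟨f, hf, hfk⟩ := hk
      exact Or.inl (coverFound_of_large hE hS hs hc hf hfk)
    · push Not at hk
      exact Or.inr (hasPartition_subsetRows hE hS hs hc hk)
  · rintro (h | h)
    · exact h.hasCover hE
    · exact HasPartition.hasCover_of_subsetRows h

end Cover

end SetCode

namespace RAM

open RAMProg Function SetCode

/-! ### The dynamic program on the machine -/

/-- The registers and the stored input during the computation; `k` is a threshold and the hosted
memory is still empty. -/
structure Ctx (I : SetInstance) (k : ℕ) (σ : St) : Prop where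
  r0 : σ.r 0 = I.n
  r1 : σ.r 1 = I.m
  r2 : σ.r 2 = I.s
  r3 : σ.r 3 = k
  r11 : σ.r 11 = I.m + 1
  inp : ∀ a, σ.c (4 * a) = I.toMem a
  orc : ∀ a, σ.c (4 * a + 3) = 0

theorem Ctx.set {I : SetInstance} {k : ℕ} {σ : St} (h : Ctx I k σ) {x v : ℕ}
    (hx : 4 ≤ x ∧ x ≠ 11) : Ctx I k (σ.set x v) := by
  refine ⟨?_, ?_, ?_, ?_, ?_, h.inp, h.orc⟩ <;> rw [St.set_r, if_neg (by omega)]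
  exacts [h.r0, h.r1, h.r2, h.r3, h.r11]

theorem Ctx.put {I : SetInstance} {k : ℕ} {σ : St} (h : Ctx I k σ) {x v : ℕ}
    (hx : x % 4 = 1 ∨ x % 4 = 2) : Ctx I k (σ.put x v) :=
  ⟨h.r0, h.r1, h.r2, h.r3, h.r11, fun a => by rw [St.put_c, if_neg (by omega), h.inp],
    fun a => by rw [St.put_c, if_neg (by omega), h.orc]⟩

/-- The finite set `L` is stored as a list without repetitions and as a table. -/
structure Stored (L : Finset ℕ) (σ : St) : Prop where
  len : σ.r 4 = L.card
  list : (Finset.range L.card).image (fun i => σ.c (4 * i + 1)) = L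
  table : ∀ c, σ.c (4 * c + 2) = if c ∈ L then 1 else 0

theorem Stored.congr {L : Finset ℕ} {σ σ' : St} (h : Stored L σ) (h4 : σ'.r 4 = σ.r 4)
    (hc : σ'.c = σ.c) : Stored L σ' :=
  ⟨h4.trans h.len, by rw [hc]; exact h.list, by rw [hc]; exact h.table⟩

/-- Insertion without branching: v is always written just behind the end of the list, while the
length and the table entry grow by the 0/1 value of the condition. If that value is 0, the extra
list entry lies beyond the length and does not count. -/
theorem Stored.insert {L : Finset ℕ} {σ σ' : St} (h : Stored L σ) (P : Prop) [Decidable P] {v : ℕ}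
    (hr : σ'.r 4 = σ.r 4 + if P ∧ v ∉ L then 1 else 0)
    (hc : ∀ a, σ'.c a = if a = 4 * v + 2 then σ.c a + (if P ∧ v ∉ L then 1 else 0) else
      if a = 4 * σ.r 4 + 1 then v else σ.c a) :
    Stored (if P then Insert.insert v L else L) σ' := by
  have hlist : ∀ i, σ'.c (4 * i + 1) = if i = L.card then v else σ.c (4 * i + 1) := fun i => by
    rw [hc, if_neg (by omega), h.len]
    exact if_congr (by omega) rfl rfl
  have htab : ∀ c, σ'.c (4 * c + 2) = (if c ∈ L then 1 else 0)
      + if c = v ∧ P ∧ v ∉ L then 1 else 0 := fun c => by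
    rw [hc, if_neg (show ¬ 4 * c + 2 = 4 * σ.r 4 + 1 by omega), h.table]
    by_cases hcv : c = v
    · subst hcv; simp
    · simp [hcv]
  have hsame : (Finset.range L.card).image (fun i => σ'.c (4 * i + 1)) = L := by
    conv_rhs => rw [← h.list]
    refine Finset.image_congr fun i hi => ?_
    simp only [hlist]
    rw [if_neg (by have := Finset.mem_range.1 (Finset.mem_coe.1 hi); omega)]
  by_cases hP : P
  · by_cases hv : v ∈ L
    · rw [if_pos hP, Finset.insert_eq_of_mem hv]
      exact ⟨by rw [hr, if_neg (by tauto), h.len, add_zero], hsame, fun c => by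
        rw [htab, if_neg (show ¬(c = v ∧ P ∧ v ∉ L) by tauto), add_zero]⟩
    · rw [if_pos hP]
      have hcard := Finset.card_insert_of_notMem hv
      refine ⟨by rw [hr, if_pos ⟨hP, hv⟩, h.len, hcard], ?_, fun c => ?_⟩
      · rw [hcard, Finset.range_add_one, Finset.image_insert, hsame, hlist, if_pos rfl]
      · rw [htab]
        by_cases hcv : c = v
        · subst hcv; simp [hv, hP]
        · simp [hcv]
  · rw [if_neg hP]
    exact ⟨by rw [hr, if_neg (by tauto), h.len, add_zero], hsame, fun c => by
      rw [htab, if_neg (show ¬(c = v ∧ P ∧ v ∉ L) by tauto), add_zero]⟩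

/-- One pass of the dynamic program, with guard `G` and transition `new`. -/
def passCmd (G new : Ex) : Cmd :=
  .rep 5 1 <| .seq (.asg 10 (.reg 4)) <| .rep 6 10 <|
    .seq (.asg 7 (.cell (.con 4 * .reg 6 + .con 1))) <|
    .seq (.asg 8 new) <|
    .seq (.asg 9 (G * (.con 1 - .cell (.con 4 * .reg 8 + .con 2)))) <|
    .seq (.wr (.con 4 * .reg 4 + .con 1) (.reg 8)) <|
    .seq (.wr (.con 4 * .reg 8 + .con 2) (.cell (.con 4 * .reg 8 + .con 2) + .reg 9)) <|
      .asg 4 (.reg 4 + .reg 9)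

/-- In round f the list is scanned only up to its length at the start of the round, kept in register
10, so codes produced in this round are not extended by f again. Processing one entry takes six
commands and one step of loop overhead, whence the factor 7. -/
theorem tr_passCmd {I : SetInstance} {k w Λ : ℕ} {G new : Ex} {Gp : ℕ → ℕ → Prop}
    [∀ f, DecidablePred (Gp f)] {nw : ℕ → ℕ → ℕ} {L : Finset ℕ} {σ : St}
    (hGh : G.ht ≤ 60) (hnh : new.ht ≤ 64)
    (hex : ∀ σ f c, Ctx I k σ → σ.r 5 = f → f < I.m → σ.r 7 = c →
      G.Ok w σ ∧ new.Ok w σ ∧ G.eval σ = (if Gp f c then 1 else 0) ∧ new.eval σ = nw f c)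
    (hΛ : (dpPass Gp nw L I.m).card ≤ Λ) (hΛw : Λ < 2 ^ w)
    (hmem : ∀ c ∈ dpPass Gp nw L I.m, c < 2 ^ w)
    (hnw : ∀ f < I.m, ∀ c ∈ dpPass Gp nw L I.m, nw f c < 2 ^ w)
    (hσ : Ctx I k σ) (hL : Stored L σ) :
    Tr w (passCmd G new) σ (fun σ' => Ctx I k σ' ∧ Stored (dpPass Gp nw L I.m) σ')
      (I.m * (Λ * 7 + 3) + 1) := by
  have hw0 : 1 < 2 ^ w ∨ Λ = 0 := by omega
  refine (Tr.rep (T := Λ * 7 + 2) (N := I.m)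
    (fun f σ => Ctx I k σ ∧ Stored (dpPass Gp nw L f) σ) (by omega) (by omega) (by omega) hσ.r1
    ⟨hσ.set (by omega), hL.congr (by simp) rfl⟩ ?_ fun σ h => h).conseq (fun _ h => h) le_rfl
  intro f hf σ hf5 _ ⟨hctx, hst⟩
  set L' := dpPass Gp nw L f with hL'
  have hsub : L' ⊆ dpPass Gp nw L I.m := dpPass_mono hf.le
  have hsub1 : dpStep (Gp f) (nw f) L' ⊆ dpPass Gp nw L I.m :=
    dpPass_mono (G := Gp) (new := nw) (L := L) (Nat.succ_le_of_lt hf)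
  have hN := (Finset.card_le_card hsub).trans hΛ
  set N := L'.card with hNdef
  set a := fun i => σ.c (4 * i + 1) with ha
  have haL : ∀ i < N, a i ∈ L' := fun i hi => by
    have h := Finset.mem_image_of_mem a (Finset.mem_range.2 hi)
    rwa [hst.list] at h
  refine (Tr.asg_seq (T := N * (6 + 1) + 1) (by omega) (by simp) (by decide) ?_ ?_).conseq
    (fun _ h => h) (show N * (6 + 1) + 1 + 1 ≤ Λ * 7 + 2 by omega)
  · rw [Ex.eval_reg, hst.len]; omega
  -- The stored set after the first i entries of the old list have been processed.
  set B : ℕ → Finset ℕ := fun i =>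
    L' ∪ ((Finset.range i).filter fun i => Gp f (a i)).image fun i => nw f (a i) with hB
  have hBsub : ∀ i ≤ N, B i ⊆ dpStep (Gp f) (nw f) L' := by
    intro i hi c hc
    rcases Finset.mem_union.1 hc with hc | hc
    · exact Finset.mem_union_left _ hc
    · obtain ⟨j, hj, rfl⟩ := Finset.mem_image.1 hc
      obtain ⟨h1, h2⟩ := Finset.mem_filter.1 hj
      exact new_mem_dpPass (haL j (by have := Finset.mem_range.1 h1; omega)) h2
  refine (Tr.rep (T := 6) (N := N) (fun i σ => Ctx I k σ ∧ σ.r 5 = f ∧ (∀ j < N, σ.c (4 * j + 1)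
    = a j) ∧ Stored (B i) σ) (by omega) (by omega) (by omega) (by simp [hst.len, ← hNdef])
    ⟨(hctx.set (by omega)).set (by omega), by simp [hf5], fun j _ => rfl, ?_⟩ ?_ ?_)
  · have : B 0 = L' := by simp [hB]
    rw [this]
    exact hst.congr (by simp) rfl
  · rintro i hi σ hi6 h10 ⟨hctx, hf5, hlist, hst⟩
    have hmemi := haL i hi
    obtain ⟨hc7, hc7'⟩ : σ.c (4 * i + 1) = a i ∧ a i < 2 ^ w :=
      ⟨hlist i hi, hmem _ (hsub hmemi)⟩
    have hBle : (B i).card ≤ Λ :=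
      (Finset.card_le_card ((hBsub i hi.le).trans hsub1)).trans hΛ
    have hnew := hnw f hf _ (hsub hmemi)
    have hge : N ≤ (B i).card := Finset.card_le_card Finset.subset_union_left
    refine Tr.asg_seq (T := 5) (by omega) (by simp) (by decide) (by simpa [hi6, hc7]) ?_
    simp only [Ex.eval_cell, Ex.eval_add, Ex.eval_mul, Ex.eval_con, Ex.eval_reg, hi6, hc7]
    obtain ⟨-, o2, -, e2⟩ := hex (σ.set 7 (a i)) f (a i) (hctx.set (by omega)) (by simp [hf5]) hf
      (by simp)
    refine Tr.asg_seq (T := 4) (by omega) o2 hnh (by rwa [e2]) ?_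
    rw [e2]
    obtain ⟨o1, -, e1, -⟩ := hex ((σ.set 7 (a i)).set 8 (nw f (a i))) f (a i)
      ((hctx.set (by omega)).set (by omega)) (by simp [hf5]) hf (by simp)
    have e9 : (G * (.con 1 - .cell (.con 4 * .reg 8 + .con 2))).eval
        ((σ.set 7 (a i)).set 8 (nw f (a i))) =
        if Gp f (a i) ∧ nw f (a i) ∉ B i then 1 else 0 := by
      simp only [Ex.eval_mul, e1, Ex.eval_sub, Ex.eval_con, Ex.eval_cell, Ex.eval_add, Ex.eval_reg,
        St.set_c, St.set_r, if_true, hst.table]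
      by_cases h1 : Gp f (a i) <;> by_cases h2 : nw f (a i) ∈ B i <;> simp [h1, h2]
    have hle1 : (if Gp f (a i) ∧ nw f (a i) ∉ B i then 1 else 0) ≤ 1 := by split_ifs <;> omega
    -- A newly inserted code still belongs to the final set of the pass, so the length never exceeds
    -- Λ.
    have hne : (if Gp f (a i) ∧ nw f (a i) ∉ B i then 1 else 0) + (B i).card ≤ Λ := by
      split_ifs with h
      · have h2 : insert (nw f (a i)) (B i) ⊆ dpPass Gp nw L I.m :=
          (Finset.insert_subset (new_mem_dpPass hmemi h.1) (hBsub i hi.le)).trans hsub1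
        have h3 := (Finset.card_le_card h2).trans hΛ
        rw [Finset.card_insert_of_notMem h.2] at h3
        omega
      · omega
    refine Tr.asg_seq (T := 3) (by omega) (by simp [o1]) ?_ (by rw [e9]; omega) ?_
    · show max G.ht _ ≤ 64
      refine max_le (by omega) (by decide)
    rw [e9]
    generalize hg : (if Gp f (a i) ∧ nw f (a i) ∉ B i then 1 else 0) = g at *
    refine Tr.wr_seq (T := 2) (by simp) (by simp) (by decide) (by decide) (by simpa) ?_
    refine Tr.wr_seq (T := 1) (by simp) (by simp) (by decide) (by decide) ?_ ?_
    · simp only [Ex.eval_add, Ex.eval_mul, Ex.eval_cell, Ex.eval_con, Ex.eval_reg, St.put_c,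
        St.put_r, St.set_r, St.set_c, if_true]
      simp only [hst.table]
      rw [if_neg (by omega)]
      simp only [show (8 : ℕ) ≠ 9 by omega, if_false]
      split_ifs with h
      · rw [if_neg (by tauto)] at hg
        omega
      · omega
    refine Tr.asg (by omega) (by simp) (by decide) (by simp [hst.len]; omega) ?_
    have hins := hst.insert (Gp f (a i)) (v := nw f (a i))
      (σ' := ⟨fun x => if x = 4 then (B i).card + g else if x = 6 then i + 1 else
        if x = 9 then g else if x = 8 then nw f (a i) else if x = 7 then a i else σ.r x,
        fun c => if c = 4 * nw f (a i) + 2 then σ.c c + g else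
          if c = 4 * (B i).card + 1 then nw f (a i) else σ.c c⟩)
      (by simp [hst.len, hg]) (fun b => by rw [hg, hst.len])
    have hBi : (if Gp f (a i) then insert (nw f (a i)) (B i) else B i) = B (i + 1) := by
      simp only [hB, Finset.range_add_one, Finset.filter_insert]
      split_ifs
      · rw [Finset.image_insert, Finset.union_insert]
      · rfl
    rw [hBi] at hins
    refine ⟨by simp [hi6], by simp [h10], ?_, by simp [hf5], fun j hj => ?_, hins.congr ?_ ?_⟩
    · refine Ctx.set (Ctx.set (Ctx.put (Ctx.put (Ctx.set (Ctx.set (Ctx.set hctx ?_) ?_) ?_) ?_) ?_)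
        ?_) ?_ <;> simp
    · simp only [Ex.eval_add, Ex.eval_mul, Ex.eval_con, Ex.eval_reg, St.set_c, St.put_c, St.put_r,
        St.set_r, hst.len]
      simp
      rw [if_neg (by omega), if_neg (by omega), hlist j hj]
    · simp [hst.len]
    · ext c
      simp only [Ex.eval_add, Ex.eval_mul, Ex.eval_con, Ex.eval_reg, Ex.eval_cell, St.set_c,
        St.put_c, St.put_r, St.set_r, hst.len]
      simp
      split_ifs <;> first | rfl | omega | (subst_vars; rfl) 
  · rintro σ ⟨hctx, h5, -, hst'⟩
    have hBN : B N = dpStep (Gp f) (nw f) L' := by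
      simp only [hB, dpStep]
      congr 1
      conv_rhs => rw [← hst.list, Finset.filter_image, Finset.image_image]
      rfl
    rw [hBN] at hst'
    exact ⟨h5, hctx.r1, hctx.set (by omega), hst'.congr (by simp) rfl⟩

end RAM

namespace RAM

open RAMProg Function SetCode

/-! ### Writing an instance into the hosted memory -/

/-- Write the instance with `N` elements, `M` members, size bound `S` and incidence matrix `χ`
(whose entry number `a` is the value of `χ` when register `6` is `a`). -/
def writeCmd (N M S χ : Ex) : Cmd :=
  .seq (.asg 5 (M * N)) <|
  .seq (.rep 6 5 <| .wr (.con 4 * (.con 3 + .reg 6) + .con 3) χ) <|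
  .seq (.wr (.con 3) N) <| .seq (.wr (.con 7) M) <| .wr (.con 11) S

theorem ite_le_one (P : Prop) [Decidable P] : (if P then 1 else 0) ≤ 1 := by
  split <;> simp

/-- P is the invariant of the caller. It has to survive changes of the registers 5 and 6 and of
hosted cells, and it has to determine the parameters and the matrix entries. The hosted memory must
start empty, because an initial memory is 0 outside of the input. -/
theorem tr_writeCmd {w n m s : ℕ} {N M S χ : Ex} {E : ℕ → Finset ℕ} {P : St → Prop} {σ : St}
    (hN : N.ht ≤ 60) (hM : M.ht ≤ 60) (hS : S.ht ≤ 60) (hχ : χ.ht ≤ 60)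
    (hset : ∀ σ x v, P σ → x = 5 ∨ x = 6 → P (σ.set x v))
    (hput : ∀ σ a v, P σ → P (σ.put (4 * a + 3) v))
    (hval : ∀ σ, P σ → (N.Ok w σ ∧ M.Ok w σ ∧ S.Ok w σ) ∧
      N.eval σ = n ∧ M.eval σ = m ∧ S.eval σ = s)
    (hent : ∀ σ a, P σ → a < m * n → σ.r 6 = a →
      χ.Ok w σ ∧ χ.eval σ = if a % n ∈ E (a / n) then 1 else 0)
    (hw : 1 ≤ w) (hnw : n < 2 ^ w) (hmw : m < 2 ^ w) (hsw : s < 2 ^ w) (hmnw : m * n < 2 ^ w)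
    (hσ : P σ) (h0 : ∀ a, σ.c (4 * a + 3) = 0) :
    Tr w (writeCmd N M S χ) σ (fun σ' => P σ' ∧ ∀ a, σ'.c (4 * a + 3)
      = (SetInstance.ofSets n m s E).toMem a) (2 * (m * n) + 5) := by
  have h1w : 1 < 2 ^ w := Nat.one_lt_two_pow (by omega)
  obtain ⟨⟨oN, oM, -⟩, eN, eM, -⟩ := hval σ hσ
  refine (Tr.asg_seq (T := 3 + (m * n * (1 + 1) + 1)) (by omega) (by simp [oN, oM]) ?_
    (by simpa [eN, eM] using hmnw) ?_).conseq (fun _ h => h) (by omega)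
  · exact max_le (by omega) (by omega)
  refine Tr.rep_seq (T := 1) (T' := 3) (N := m * n) (fun i σ => P σ ∧ ∀ b, σ.c (4 * b + 3) =
    if 3 ≤ b ∧ b < 3 + i then (if (b - 3) % n ∈ E ((b - 3) / n) then 1 else 0) else 0)
    (by omega) (by omega) (by omega) (by simp [eN, eM])
    ⟨hset _ _ _ (hset _ _ _ hσ (Or.inl rfl)) (Or.inr rfl), fun b => ?_⟩ ?_ ?_
  · rw [if_neg (by omega)]
    exact h0 b
  · rintro i hi σ h6 h5 ⟨hP, hc⟩
    obtain ⟨o, e⟩ := hent σ i hP hi h6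
    refine Tr.wr (by simp) o (by decide) (by omega) (by rw [e]; exact (ite_le_one _).trans_lt h1w) ?_
    have ea : (Ex.con 4 * (.con 3 + .reg 6) + .con 3).eval σ = 4 * (3 + i) + 3 := by simp [h6]
    rw [ea, e]
    refine ⟨h6, h5, hset _ _ _ (hput _ _ _ hP) (Or.inr rfl), fun b => ?_⟩
    rw [St.set_c, St.put_c, hc]
    by_cases hb : b = 3 + i
    · subst hb
      rw [if_pos rfl, if_pos (show 3 ≤ 3 + i ∧ 3 + i < 3 + (i + 1) by omega),
        show 3 + i - 3 = i by omega]
    · rw [if_neg (by omega)]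
      exact if_congr (by omega) rfl rfl
  · rintro σ ⟨hP, hc⟩
    obtain ⟨⟨oN, -, -⟩, eN, -, -⟩ := hval σ hP
    refine Tr.wr_seq (T := 2) (by simp) oN (by decide) (by omega) (by rwa [eN]) ?_
    rw [eN, Ex.eval_con]
    have hP1 := hput _ 0 n hP
    obtain ⟨⟨-, oM, -⟩, -, eM, -⟩ := hval _ hP1
    refine Tr.wr_seq (T := 1) (by simp) oM (by decide) (by omega) (by rwa [eM]) ?_
    rw [eM, Ex.eval_con]
    have hP2 := hput _ 1 m hP1
    obtain ⟨⟨-, -, oS⟩, -, -, eS⟩ := hval _ hP2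
    refine Tr.wr (by simp) oS (by decide) (by omega) (by rwa [eS]) ?_
    rw [eS, Ex.eval_con]
    refine ⟨hput _ 2 s hP2, fun a => ?_⟩
    simp only [St.put_c, hc]
    rcases Nat.lt_or_ge a 3 with ha | ha
    · interval_cases a
      · rw [SetInstance.toMem_zero]; simp [SetInstance.ofSets]
      · rw [SetInstance.toMem_one]; simp [SetInstance.ofSets]
      · rw [SetInstance.toMem_two]; simp [SetInstance.ofSets]
    · obtain ⟨b, rfl⟩ := Nat.exists_eq_add_of_le ha
      rw [SetInstance.toMem_ofSets (χ := fun b => if b < m * n then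
        (if b % n ∈ E (b / n) then 1 else 0) else 0) (fun a ha => if_pos ha)
        (fun a ha => if_neg (by omega)), if_neg (by omega), if_neg (by omega), if_neg (by omega),
        show 3 + b - 3 = b by omega]
      exact if_congr (by omega) rfl rfl

/-! ### The start of the dynamic program -/

/-- Set the threshold to `n / D` and start the dynamic program with the code `0`. -/
def startCmd (D : ℕ) : Cmd :=
  .seq (.asg 3 (.reg 0 / .con D)) <| .seq (.asg 11 (.reg 1 + .con 1)) <|
  .seq (.asg 4 (.con 1)) <| .wr (.con 2) (.con 1)

theorem tr_startCmd {I : SetInstance} {w D : ℕ} {σ : St} (hw : I.size + 200 ≤ w)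
    (hσ : Loaded I σ) :
    Tr w (startCmd D) σ (fun σ' => Ctx I (I.n / D) σ' ∧ Stored {0} σ') 4 := by
  have hlt : w < 2 ^ w := Nat.lt_two_pow_self
  have hn := I.n_lt_size
  have hm := I.m_lt_size
  have hk := Nat.div_le_self I.n D
  refine Tr.asg_seq (by omega) (by simp) (by simp [Ex.ht, HDiv.hDiv, Div.div]) (by simp [hσ.r0]; omega) ?_
  refine Tr.asg_seq (by omega) (by simp) (by decide) (by simp [hσ.r1]; omega) ?_
  refine Tr.asg_seq (by omega) (by simp) (by decide) (by simp; omega) ?_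
  refine Tr.wr (by simp) (by simp) (by decide) (by decide) (by simp; omega) ⟨?_, ?_⟩
  · refine ⟨by simp [hσ.r0], by simp [hσ.r1], by simp [hσ.r2], by simp [hσ.r0], by simp [hσ.r1],
      fun a => ?_, fun a => ?_⟩
    · simp only [St.put_c, St.set_c, Ex.eval_con, hσ.c]
      rw [if_neg (by omega), if_pos (by omega)]
      congr 1
      omega
    · simp only [St.put_c, St.set_c, Ex.eval_con, hσ.c]
      rw [if_neg (by omega), if_neg (by omega)]
  · refine ⟨by simp, ?_, fun c => ?_⟩
    · simp [hσ.c]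
    · simp only [St.put_c, St.set_c, Ex.eval_con, hσ.c, Finset.mem_singleton]
      rw [if_neg (show ¬ 4 ∣ 4 * c + 2 by omega)]
      exact if_congr (by omega) rfl rfl

/-! ### Expressions for sets -/

/-- Whether the element in register `u` belongs to the member in register `f` of the family. -/
def inE (f u : ℕ) : Ex := .cell (.con 4 * (.con 3 + .reg f * .reg 0 + .reg u))

/-- The size of the member in register `f` of the family. -/
def cardE (f : ℕ) : Ex := .sum 12 0 (inE f 12)

/-- The binary digit of `X` whose position is in register `u`. -/
def bitE (X : Ex) (u : ℕ) : Ex := .md (X / .pow2 u) (.con 2)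

/-- The code of the union of the set coded in register `7` and the member in register `5`. -/
def joinE : Ex :=
  .sum 12 0 (.pow2 12 * .nz (bitE (.reg 7 / .reg 11) 12 + inE 5 12)) * .reg 11
    + (.md (.reg 7) (.reg 11) + .con 1)

variable {I : SetInstance} {k w : ℕ} {σ : St}

@[simp] theorem ok_inE (f u l : ℕ) : (inE f u).Ok l σ ↔ f < 32 ∧ u < 32 := by simp [inE]

theorem eval_inE (h0 : σ.r 0 = I.n) (hi : ∀ a, σ.c (4 * a) = I.toMem a) {f u : ℕ}
    (hu : σ.r u < I.n) : (inE f u).eval σ = if σ.r u ∈ I.nbr (σ.r f) then 1 else 0 := by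
  simp only [inE, Ex.eval_cell, Ex.eval_mul, Ex.eval_add, Ex.eval_con, Ex.eval_reg, hi, h0]
  exact I.indicator_nbr hu

theorem ok_cardE (h0 : σ.r 0 = I.n) (hw : I.n ≤ w) {f : ℕ} (hf : f < 32) :
    (cardE f).Ok w σ := by
  simp [cardE, h0, hw, hf]

theorem eval_cardE (h0 : σ.r 0 = I.n) (hi : ∀ a, σ.c (4 * a) = I.toMem a) {f : ℕ} (hf : f ≠ 12) :
    (cardE f).eval σ = (I.nbr (σ.r f)).card := by
  simp only [cardE, Ex.eval_sum, h0]
  rw [← rank_eq_card (I.nbr_subset _), rank]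
  refine Finset.sum_congr rfl fun u hu => ?_
  rw [eval_inE (I := I) (σ := σ.set 12 u) (by simp [h0]) hi (by simpa using Finset.mem_range.1 hu)]
  simp [hf]

theorem ok_joinE (h : Ctx I k σ) (hw : I.n ≤ w) : joinE.Ok w σ := by
  simp [joinE, h.r0, hw, bitE]
  intro i hi
  omega

theorem eval_joinE (h : Ctx I k σ) :
    joinE.eval σ = joinCode I.n (I.m + 1) (I.nbr (σ.r 5)) (σ.r 7) := by
  simp only [joinE, Ex.eval_add, Ex.eval_mul, Ex.eval_sum, Ex.eval_md, Ex.eval_reg, Ex.eval_con,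
    h.r11, h.r0, joinCode]
  congr 2
  refine Finset.sum_congr rfl fun u hu => ?_
  simp only [Ex.eval_pow2, Ex.eval_nz, Ex.eval_add, bitE, Ex.eval_md, Ex.eval_div, Ex.eval_reg,
    Ex.eval_con, St.set_r, if_true, h.r11]
  rw [eval_inE (I := I) (σ := σ.set 12 u) (by simp [h.r0]) h.inp (by simpa using Finset.mem_range.1 hu)]
  simp [h.r11]

end RAM

namespace RAM

open RAMProg Function SetCode

/-! ### Set Cover by an algorithm for Set Partition -/

/-- The guard for covers with a large member. -/
def coverGuardE : Ex :=
  .nz (.lt (.reg 3) (cardE 5) + .reg 7) * .lt (.md (.reg 7) (.reg 11) + .con 1) (.reg 11)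

/-- The number of `j ≤ s` such that the whole universe with the number `j` has been found. -/
def coverFoundE : Ex :=
  .sum 12 11 (.cell (.con 4 * (.sum 13 0 (.pow2 13) * .reg 11 + .reg 12) + .con 2)
    * .le (.reg 12) (.reg 2))

/-- The incidence matrix of the subsets of the small members. -/
def subsetE : Ex :=
  .lett 13 (.reg 6 / .reg 0) <| .lett 14 (.md (.reg 6) (.reg 0)) <|
  .lett 15 (.reg 13 / .pow2 3) <| .lett 16 (.md (.reg 13) (.pow2 3)) <|
  .lett 17 (.sum 12 14 (inE 15 12)) <|
    .lt (.reg 13) (.reg 1 * .pow2 3) * .le (cardE 15) (.reg 3) * (inE 15 14 * bitE (.reg 16) 17)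

/-- The reduction from Set Cover to Set Partition, with the threshold `n / D`. -/
def coverCmd (D : ℕ) : Cmd :=
  .seq (startCmd D) <| .seq (passCmd coverGuardE joinE) <| .seq (passCmd coverGuardE joinE) <|
  .seq (.asg 4 coverFoundE) <|
    writeCmd (.reg 0) (.reg 1 * .pow2 3 + .reg 0) (.reg 2 - (.reg 2 - .reg 0)) subsetE

variable {I : SetInstance} {k w : ℕ} {σ : St}

theorem coverGuardE_spec (h : Ctx I k σ) (hw : I.n ≤ w) : coverGuardE.Ok w σ ∧
    coverGuardE.eval σ = if CoverGuard (I.m + 1) k I.nbr (σ.r 5) (σ.r 7) then 1 else 0 := by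
  refine ⟨by simp [coverGuardE, ok_cardE h.r0 hw], ?_⟩
  simp only [coverGuardE, Ex.eval_mul, Ex.eval_nz, Ex.eval_add, Ex.eval_lt, Ex.eval_reg,
    eval_cardE h.r0 h.inp (show 5 ≠ 12 by omega), h.r3, h.r11, Ex.eval_md, Ex.eval_con, CoverGuard]
  by_cases h1 : k < (I.nbr (σ.r 5)).card <;> by_cases h2 : σ.r 7 = 0 <;> simp [h1, h2]

theorem sum_two_pow_eq_mask (n : ℕ) : ∑ u ∈ Finset.range n, 2 ^ u = mask n (Finset.range n) :=
  Finset.sum_congr rfl fun u hu => by rw [if_pos hu, mul_one]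

/-- The expression counts the successful j, which makes it nonzero exactly on success and keeps it
small enough for a register. -/
theorem coverFoundE_spec {L : Finset ℕ} (h : Ctx I k σ) (hL : Stored L σ) (hw : I.size ≤ w) :
    coverFoundE.Ok w σ ∧ coverFoundE.eval σ ≤ I.m + 1 ∧ (coverFoundE.eval σ ≠ 0 ↔
      ∃ j < I.m + 1, j ≤ I.s ∧ code I.n (I.m + 1) (Finset.range I.n) j ∈ L) := by
  have hn := I.n_lt_size
  have hm := I.m_lt_size
  have e : coverFoundE.eval σ = ∑ j ∈ Finset.range (I.m + 1),
      (if code I.n (I.m + 1) (Finset.range I.n) j ∈ L then 1 else 0)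
        * if j ≤ I.s then 1 else 0 := by
    simp only [coverFoundE, Ex.eval_sum, Ex.eval_mul, Ex.eval_add, Ex.eval_cell, Ex.eval_con,
      Ex.eval_reg, Ex.eval_pow2, Ex.eval_le, h.r11, St.set_c, hL.table]
    refine Finset.sum_congr rfl fun j _ => ?_
    simp only [h.r0, h.r11, h.r2, sum_two_pow_eq_mask, code, St.set_r, reduceIte,
      show (11 : ℕ) ≠ 12 by omega, show (2 : ℕ) ≠ 12 by omega, show (0 : ℕ) ≠ 12 by omega]
    congr
  refine ⟨?_, ?_, ?_⟩
  · simp [coverFoundE, h.r0, h.r11]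
    exact ⟨by omega, fun _ _ => ⟨by omega, fun _ _ => by omega⟩⟩
  · rw [e]
    refine (Finset.sum_le_card_nsmul _ _ 1 fun j _ => ?_).trans (by simp)
    exact Nat.mul_le_mul (ite_le_one _) (ite_le_one _)
  · rw [e, Ne, Finset.sum_eq_zero_iff]
    push Not
    constructor
    · rintro ⟨j, hj, h⟩
      refine ⟨j, Finset.mem_range.1 hj, ?_⟩
      split_ifs at h <;> simp_all
    · rintro ⟨j, hj, hjs, h⟩
      exact ⟨j, Finset.mem_range.2 hj, by simp [h, hjs]⟩

/-- The registers and cells that the matrix of subsets depends on. -/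
structure InCtx (I : SetInstance) (k : ℕ) (σ : St) : Prop where
  r0 : σ.r 0 = I.n
  r1 : σ.r 1 = I.m
  r2 : σ.r 2 = I.s
  r3 : σ.r 3 = k
  r11 : σ.r 11 = I.m + 1
  inp : ∀ a, σ.c (4 * a) = I.toMem a

/-- While the new instance is being written the hosted memory is no longer empty, so that clause has
to leave the invariant. -/
theorem Ctx.inCtx (h : Ctx I k σ) : InCtx I k σ := ⟨h.r0, h.r1, h.r2, h.r3, h.r11, h.inp⟩

theorem InCtx.set (h : InCtx I k σ) {x v : ℕ} (hx : 4 ≤ x ∧ x ≠ 11) : InCtx I k (σ.set x v) := by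
  refine ⟨?_, ?_, ?_, ?_, ?_, h.inp⟩ <;> rw [St.set_r, if_neg (by omega)]
  exacts [h.r0, h.r1, h.r2, h.r3, h.r11]

theorem InCtx.put (h : InCtx I k σ) (a v : ℕ) : InCtx I k (σ.put (4 * a + 3) v) :=
  ⟨h.r0, h.r1, h.r2, h.r3, h.r11, fun b => by rw [St.put_c, if_neg (by omega), h.inp]⟩

theorem rank_le (X : Finset ℕ) (u : ℕ) : rank X u ≤ u :=
  (Finset.sum_le_card_nsmul _ _ 1 fun v _ => ite_le_one _).trans (by simp)

theorem eval_rank (h0 : σ.r 0 = I.n) (hi : ∀ a, σ.c (4 * a) = I.toMem a) {f u : ℕ} (hf : f ≠ 12)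
    (hu : σ.r u ≤ I.n) : (Ex.sum 12 u (inE f 12)).eval σ = rank (I.nbr (σ.r f)) (σ.r u) := by
  simp only [Ex.eval_sum, rank]
  refine Finset.sum_congr rfl fun v hv => ?_
  have hv := Finset.mem_range.1 hv
  rw [eval_inE (I := I) (σ := σ.set 12 v) (by simp [h0]) hi (by simp; omega)]
  simp [hf]

theorem subsetE_spec (h : InCtx I k σ) (hw : I.n ≤ w) (hk : k ≤ I.n)
    (ha : σ.r 6 < (I.m * 2 ^ k + I.n) * I.n) : subsetE.Ok w σ ∧ subsetE.eval σ =
      if σ.r 6 % I.n ∈ subsetRows k I.nbr I.m (σ.r 6 / I.n) then 1 else 0 := by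
  have hn : 0 < I.n := Nat.pos_of_ne_zero fun h => by simp [h] at ha
  have hu := Nat.mod_lt (σ.r 6) hn
  set a := σ.r 6 with ha'
  set σ1 := (((σ.set 13 (a / I.n)).set 14 (a % I.n)).set 15 (a / I.n / 2 ^ k)).set 16
    (a / I.n % 2 ^ k) with hσ1
  have h1 : InCtx I k σ1 := (((h.set (by omega)).set (by omega)).set (by omega)).set (by omega)
  have r13 : σ1.r 13 = a / I.n := by simp [hσ1]
  have r14 : σ1.r 14 = a % I.n := by simp [hσ1]
  have r15 : σ1.r 15 = a / I.n / 2 ^ k := by simp [hσ1]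
  have r16 : σ1.r 16 = a / I.n % 2 ^ k := by simp [hσ1]
  have e17 := eval_rank (f := 15) (u := 14) h1.r0 h1.inp (by omega) (by omega)
  rw [r14, r15] at e17
  set ρ := a / I.n with hρ
  have h2 : InCtx I k (σ1.set 17 (rank (I.nbr (ρ / 2 ^ k)) (a % I.n))) := h1.set (by omega)
  have hr := rank_le (I.nbr (ρ / 2 ^ k)) (a % I.n)
  have e14 := eval_inE (f := 15) (u := 14) h2.r0 h2.inp (by simp [r14, hu])
  have ec := eval_cardE (f := 15) h2.r0 h2.inp (by omega)
  have oc := ok_cardE (f := 15) h2.r0 hw (by omega)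
  have hstep : ∀ e : Ex, (Ex.lett 13 (.reg 6 / .reg 0) <| .lett 14 (.md (.reg 6) (.reg 0)) <|
      .lett 15 (.reg 13 / .pow2 3) <| .lett 16 (.md (.reg 13) (.pow2 3)) <| e).eval σ
        = e.eval σ1 := fun e => by
    simp [hσ1, h.r0, h.r3, ← ha', ← hρ]
  have hstep' : ∀ e : Ex, e.Ok w σ1 → (Ex.lett 13 (.reg 6 / .reg 0) <|
      .lett 14 (.md (.reg 6) (.reg 0)) <| .lett 15 (.reg 13 / .pow2 3) <|
      .lett 16 (.md (.reg 13) (.pow2 3)) <| e).Ok w σ := fun e he => by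
    simp only [hσ1] at he
    simp [h.r0, h.r3, ← ha', ← hρ, he]
    omega
  constructor
  · refine hstep' _ ?_
    simp only [Ex.ok_lett, e17]
    simp [r14, oc, bitE, h1.r3]
    omega
  · rw [subsetE, hstep, Ex.eval_lett, e17]
    simp only [Ex.eval_mul, Ex.eval_lt, Ex.eval_le, ec, e14, bitE, Ex.eval_md, Ex.eval_div,
      Ex.eval_reg, Ex.eval_pow2, Ex.eval_con, h2.r3, h2.r1]
    simp only [St.set_r, r13, r14, r15, r16]
    simp only [show (15 : ℕ) ≠ 17 by omega, show (13 : ℕ) ≠ 17 by omega,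
      show (14 : ℕ) ≠ 17 by omega, show (16 : ℕ) ≠ 17 by omega, if_false, if_true, subsetRows]
    by_cases g1 : ρ < I.m * 2 ^ k <;> by_cases g2 : (I.nbr (ρ / 2 ^ k)).card ≤ k <;>
      by_cases g3 : a % I.n ∈ I.nbr (ρ / 2 ^ k) <;> simp [g1, g2, g3]
    split_ifs <;> omega

/-- The number of steps of one pass over a list of length at most `Λ`. -/
def passTime (m Λ : ℕ) : ℕ := m * (Λ * 7 + 3) + 1

/-- A bound for the number of codes in the search for a cover with a large member. -/
def coverCodes (n m k : ℕ) : ℕ := 1 + m * (2 ^ (n - k) * (m + 1))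

/-- Codes and list lengths are bounded by products of few factors of at most 2^size, so a word
length linear in the input size is enough. -/
theorem tr_coverPass (hk : k ≤ I.n) (hw : 300 * I.size ≤ w) {L : Finset ℕ}
    (hL : ∀ c ∈ L, IsCoverCode I.n (I.m + 1) k I.nbr I.m c) (hσ : Ctx I k σ) (hst : Stored L σ) :
    Tr w (passCmd coverGuardE joinE) σ (fun σ' => Ctx I k σ' ∧
      Stored (coverPass I.n (I.m + 1) k I.nbr L I.m) σ') (passTime I.m (coverCodes I.n I.m k)) := by
  have hn := I.n_lt_size
  have hm := I.m_lt_size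
  have hZ : I.size < 2 ^ I.size := Nat.lt_two_pow_self
  have hw2 : 2 ^ (4 * I.size) ≤ 2 ^ w := Nat.pow_le_pow_right two_pos (by omega)
  have hp : 2 ^ (4 * I.size) = 2 ^ I.size * (2 ^ I.size * (2 ^ I.size * 2 ^ I.size)) := by
    rw [← pow_add, ← pow_add, ← pow_add]; congr 1; omega
  set Z := 2 ^ I.size with hZdef
  have hnZ : 2 ^ I.n ≤ Z := Nat.pow_le_pow_right two_pos hn.le
  have hnkZ : 2 ^ (I.n - k) ≤ Z := Nat.pow_le_pow_right two_pos (by omega)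
  have hc : 2 ^ I.n * (I.m + 1) ≤ Z * Z := Nat.mul_le_mul hnZ (by omega)
  have hZ2 : 2 ≤ Z := by omega
  have hZZ : Z * Z < 2 ^ (4 * I.size) := by
    rw [hp]
    have : 0 < Z * Z := by positivity
    nlinarith
  have hs := coverPass_sound (i := I.m) le_rfl hL
  have hmem : ∀ c ∈ coverPass I.n (I.m + 1) k I.nbr L I.m, c < 2 ^ w := fun c hc' => by
    obtain ⟨S, -, j, hj, -, rfl, -⟩ := hs c hc'
    exact (code_lt _ hj).trans_le (hc.trans (hZZ.le.trans hw2))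
  refine tr_passCmd (by decide) (by decide) (fun σ f c h h5 _ h7 => ?_)
    (card_coverCodes_le I.nbr_subset hs) ?_ hmem (fun f hf c _ => ?_) hσ hst
  · obtain ⟨h1, h2⟩ := coverGuardE_spec h (w := w) (by omega)
    refine ⟨h1, ok_joinE h (by omega), ?_, ?_⟩
    · rw [h2, h5, h7]
    · rw [eval_joinE h, h5, h7]
  · refine lt_of_lt_of_le ?_ hw2
    rw [hp]
    have h1 : I.m * (2 ^ (I.n - k) * (I.m + 1)) ≤ Z * (Z * Z) :=
      Nat.mul_le_mul (by omega) (Nat.mul_le_mul hnkZ (by omega))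
    have h2 : 2 ≤ Z * (Z * Z) := hZ2.trans (Nat.le_mul_of_pos_right _ (by positivity))
    have h3 := Nat.mul_le_mul_right (Z * (Z * Z)) hZ2
    rw [coverCodes]
    omega
  · exact (joinCode_lt (by omega) _ _).trans_lt (hc.trans_lt (hZZ.trans_le hw2))

/-- The number of steps of the reduction from Set Cover. -/
def coverTime (n m k : ℕ) : ℕ :=
  4 + (passTime m (coverCodes n m k) + (passTime m (coverCodes n m k) +
    (2 * ((m * 2 ^ k + n) * n) + 5 + 1)))

theorem tr_coverCmd {D : ℕ} (hw : 300 * I.size ≤ w) (hσ : Loaded I σ) :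
    Tr w (coverCmd D) σ (fun σ' => (∀ b, σ'.c (4 * b + 3) = (SetInstance.ofSets I.n
      (I.m * 2 ^ (I.n / D) + I.n) (min I.s I.n) (subsetRows (I.n / D) I.nbr I.m)).toMem b) ∧
      (σ'.r 4 ≠ 0 ↔ CoverFound I.n I.m I.s (I.n / D) I.nbr)) (coverTime I.n I.m (I.n / D)) := by
  have hn := I.n_lt_size
  have hm := I.m_lt_size
  have hk := Nat.div_le_self I.n D
  set k := I.n / D with hkD
  have hZ : I.size < 2 ^ I.size := Nat.lt_two_pow_self
  have hlt : w < 2 ^ w := Nat.lt_two_pow_self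
  have hw2 : 2 ^ (4 * I.size) ≤ 2 ^ w := Nat.pow_le_pow_right two_pos (by omega)
  have hp : 2 ^ (4 * I.size) = 2 ^ I.size * (2 ^ I.size * (2 ^ I.size * 2 ^ I.size)) := by
    rw [← pow_add, ← pow_add, ← pow_add]; congr 1; omega
  set Z := 2 ^ I.size with hZdef
  have hZ2 : 2 ≤ Z := by omega
  have hkZ : 2 ^ k ≤ Z := Nat.pow_le_pow_right two_pos (by omega)
  have hmJ : I.m * 2 ^ k + I.n ≤ Z * Z := by
    have h1 : (I.m + 1) * 2 ^ k ≤ Z * Z := Nat.mul_le_mul (by omega) hkZ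
    by_cases h : I.m + 2 ≤ Z
    · have h1 : (I.m + 1) * Z ≤ Z * Z := Nat.mul_le_mul_right _ (by omega)
      have h2 : I.m * 2 ^ k ≤ I.m * Z := Nat.mul_le_mul_left _ hkZ
      rw [Nat.succ_mul] at h1
      omega
    · have h1 : (I.m + 1) * Z ≤ Z * Z := Nat.mul_le_mul_right _ (by omega)
      have h2 : I.m * 2 ^ k ≤ I.m * Z := Nat.mul_le_mul_left _ hkZ
      rw [Nat.succ_mul] at h1
      omega
  have htot : (I.m * 2 ^ k + I.n) * I.n ≤ Z * Z * Z := Nat.mul_le_mul hmJ (by omega)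
  have hZZZ : Z * Z * Z < 2 ^ w := by
    refine lt_of_lt_of_le ?_ hw2
    rw [hp]
    have : 0 < Z * (Z * Z) := by positivity
    nlinarith
  have hZZ : Z * Z ≤ Z * Z * Z := Nat.le_mul_of_pos_right _ (by omega)
  refine Tr.seq ((tr_startCmd (D := D) (by omega) hσ).conseq (fun σ ⟨hσ, hst⟩ => ?_) le_rfl)
  refine Tr.seq ((tr_coverPass hk hw (fun c hc => ?_) hσ hst).conseq (fun σ ⟨hσ, hst⟩ => ?_) le_rfl)
  · rw [Finset.mem_singleton.1 hc]
    exact isCoverCode_zero (by omega)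
  refine Tr.seq ((tr_coverPass hk hw (fun c hc => ?_) hσ hst).conseq (fun σ ⟨hσ, hst⟩ => ?_) le_rfl)
  · exact coverPass_sound le_rfl (fun c hc => by
      rw [Finset.mem_singleton.1 hc]; exact isCoverCode_zero (by omega)) c hc
  obtain ⟨o, hle, hfound⟩ := coverFoundE_spec (w := w) hσ hst (by omega)
  refine Tr.asg_seq (by omega) o (by decide) (by omega) ?_
  generalize coverFoundE.eval σ = v at *
  -- Register 4 carries the outcome of the search for covers with a large member through the writing
  -- of the instance.
  refine (tr_writeCmd (w := w) (P := fun σ => InCtx I k σ ∧ σ.r 4 = v) (by decide) (by decide)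
    (by decide) (by decide) ?_ ?_ ?_ ?_ (by omega) (by omega) ?_ ?_ ?_ ?_ ?_).conseq
    (fun σ ⟨⟨_, h4⟩, h⟩ => ⟨h, ?_⟩) le_rfl
  · exact fun σ x v ⟨h, h4⟩ hx => ⟨h.set (by omega), by simp [h4]; omega⟩
  · exact fun σ a v ⟨h, h4⟩ => ⟨h.put a v, h4⟩
  · rintro σ ⟨h, h4⟩
    refine ⟨by simp [h.r3]; omega, h.r0, by simp [h.r0, h.r1, h.r3], ?_⟩
    simp only [Ex.eval_sub, Ex.eval_reg, h.r0, h.r2]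
    omega
  · rintro σ a ⟨h, h4⟩ ha h6
    have := subsetE_spec h (w := w) (by omega) hk (by rwa [h6])
    rwa [h6] at this
  · omega
  · have := Nat.min_le_right I.s I.n; omega
  · omega
  · exact ⟨hσ.inCtx.set (by omega), by simp⟩
  · exact fun a => by rw [St.set_c, hσ.orc]
  · rw [h4]
    exact hfound

end RAM

/-! ### Running time of the reduction from Set Cover -/

namespace RAM

open RAMProg Function SetCode

/-- The exponents come from rounded quotients, so an excess of 1 is tolerated; the factor 2 that it
causes is absorbed by one more power of size + 2. -/
theorem OStar.of_nat {δ : ℝ} {f e : SetInstance → ℕ} (k : ℕ)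
    (hf : ∀ I, f I ≤ (I.size + 2) ^ k * 2 ^ e I) (he : ∀ I, (e I : ℝ) ≤ δ * I.n + 1) :
    OStar δ fun I => (f I : ℝ) := by
  refine ⟨k + 1, fun I => ?_⟩
  have h1 : (f I : ℝ) ≤ ((I.size : ℝ) + 2) ^ k * 2 ^ (e I : ℝ) := by
    rw [Real.rpow_natCast]; exact_mod_cast hf I
  have h2 : (2 : ℝ) ^ (e I : ℝ) ≤ 2 ^ (δ * I.n + 1) :=
    Real.rpow_le_rpow_of_exponent_le (by norm_num) (he I)
  rw [Real.rpow_add two_pos, Real.rpow_one] at h2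
  have h3 : (0 : ℝ) ≤ I.size := by positivity
  calc (f I : ℝ) ≤ ((I.size : ℝ) + 2) ^ k * (2 ^ (δ * I.n) * 2) := h1.trans (by gcongr)
    _ ≤ ((I.size : ℝ) + 2) ^ k * (2 ^ (δ * I.n) * (I.size + 2)) := by gcongr; linarith
    _ = _ := by ring

/-- The dynamic program costs about 2^(n-k) and writing the subsets about 2^k; the hypothesis 2k ≤ n
makes the former dominate. -/
theorem coverTime_le {n m k Z : ℕ} (hn : n < Z) (hm : m < Z) (hk : 2 * k ≤ n) :
    coverTime n m k ≤ (Z + 2) ^ 9 * 2 ^ (n - k) := by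
  have hX : 2 ^ k ≤ 2 ^ (n - k) := Nat.pow_le_pow_right two_pos (by omega)
  set X := 2 ^ (n - k) with hXd
  have hX1 : 1 ≤ X := Nat.one_le_two_pow
  have hc : coverCodes n m k ≤ (Z + 2) ^ 3 * X := by
    have h1 : m * (X * (m + 1)) ≤ Z * (X * Z) := by
      gcongr
      omega
    have h2 : 1 ≤ Z * X := Nat.mul_pos (by omega) hX1
    have h3 : 0 < Z * Z * X := Nat.mul_pos (Nat.mul_pos (by omega) (by omega)) hX1
    have h4 : (Z + 2) ^ 3 * X = Z * Z * Z * X + 6 * (Z * Z * X) + 12 * (Z * X) + 8 * X := by ring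
    have h5 : Z * (X * Z) = Z * Z * X := by ring
    rw [coverCodes, ← hXd]
    omega
  have hp : passTime m (coverCodes n m k) ≤ 10 * ((Z + 2) ^ 4 * X) := by
    have h1 : m * (coverCodes n m k * 7 + 3) ≤ Z * ((Z + 2) ^ 3 * X * 7 + 3) := by gcongr
    have h2 : Z * ((Z + 2) ^ 3 * X) ≤ (Z + 2) * ((Z + 2) ^ 3 * X) := by gcongr; omega
    have h3 : (Z + 2) * ((Z + 2) ^ 3 * X) = (Z + 2) ^ 4 * X := by ring
    have h4 : Z + 2 ≤ (Z + 2) ^ 4 * X :=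
      (Nat.le_self_pow (by omega) _).trans (Nat.le_mul_of_pos_right _ hX1)
    have h5 : Z * ((Z + 2) ^ 3 * X * 7 + 3) = 7 * (Z * ((Z + 2) ^ 3 * X)) + 3 * Z := by ring
    rw [passTime]
    omega
  have hq : (m * 2 ^ k + n) * n ≤ 2 * ((Z + 2) ^ 4 * X) := by
    have h1 : (m * 2 ^ k + n) * n ≤ (Z * X + Z) * Z := by gcongr
    have h2 : Z * Z * X ≤ (Z + 2) * (Z + 2) * X := by gcongr <;> omega
    have h3 : (Z + 2) * (Z + 2) * X ≤ (Z + 2) ^ 4 * X :=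
      Nat.mul_le_mul_right _ (by rw [← sq]; exact Nat.pow_le_pow_right (by omega) (by omega))
    have h4 : Z * Z ≤ Z * Z * X := Nat.le_mul_of_pos_right _ hX1
    have h5 : (Z * X + Z) * Z = Z * Z * X + Z * Z := by ring
    omega
  have h1 : 1 ≤ (Z + 2) ^ 4 * X := Nat.mul_pos (by positivity) hX1
  have h2 : 34 * ((Z + 2) ^ 4 * X) ≤ (Z + 2) ^ 9 * X := by
    have : 3 ^ 5 ≤ (Z + 2) ^ 5 := Nat.pow_le_pow_left (by omega) 5
    calc 34 * ((Z + 2) ^ 4 * X) ≤ (Z + 2) ^ 5 * ((Z + 2) ^ 4 * X) :=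
          Nat.mul_le_mul_right _ (by omega)
      _ = _ := by ring
  rw [coverTime]
  omega

theorem natSize_le_self (n : ℕ) : Nat.size n ≤ n := Nat.size_le.2 Nat.lt_two_pow_self

theorem size_ofSets_subsetRows_le (I : SetInstance) (k : ℕ) :
    (SetInstance.ofSets I.n (I.m * 2 ^ k + I.n) (min I.s I.n) (subsetRows k I.nbr I.m)).size
      ≤ (I.size + 2) ^ 2 * 2 ^ k := by
  have hn := I.n_lt_size
  have hm := I.m_lt_size
  have h1 := (natSize_le_self (min I.s I.n)).trans (Nat.min_le_right _ _)
  have hZ : (I.n + 1) * (I.m + 1) ≤ I.size := Nat.le_add_right _ _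
  show (I.n + 1) * (I.m * 2 ^ k + I.n + 1) + Nat.size (min I.s I.n) ≤ _
  set Z := I.size
  set X := 2 ^ k with hXd
  have hX1 : 1 ≤ X := Nat.one_le_two_pow
  have h5 : (I.n + 1) * (I.m * X + I.n + 1) ≤ Z * X + Z * Z := by
    have h : (I.n + 1) * I.m ≤ Z := by nlinarith
    have h' : (I.n + 1) * I.m * X ≤ Z * X := by gcongr
    have h'' : (I.n + 1) * (I.n + 1) ≤ Z * Z := Nat.mul_le_mul hn hn
    have e : (I.n + 1) * (I.m * X + I.n + 1) = (I.n + 1) * I.m * X + (I.n + 1) * (I.n + 1) := by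
      ring
    omega
  have h4 : Z * Z ≤ Z * Z * X := Nat.le_mul_of_pos_right _ hX1
  have h6 : Z ≤ Z * X := Nat.le_mul_of_pos_right _ hX1
  have h7 : (Z + 2) ^ 2 * X = Z * Z * X + 4 * (Z * X) + 4 * X := by ring
  omega

theorem natCast_div_le (n D : ℕ) : ((n / D : ℕ) : ℝ) ≤ (D : ℝ)⁻¹ * n := by
  rw [mul_comm, ← div_eq_mul_inv]
  exact Nat.cast_div_le

theorem natCast_sub_div_le (n : ℕ) {D : ℕ} (hD : 0 < D) :
    ((n - n / D : ℕ) : ℝ) ≤ (1 - (D : ℝ)⁻¹) * n + 1 := by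
  have h : (n : ℝ) ≤ D * ((n / D : ℕ) : ℝ) + D := by
    have h1 := Nat.div_add_mod n D
    have h2 := Nat.mod_lt n hD
    exact_mod_cast (by omega : n ≤ D * (n / D) + D)
  have hD' : (0 : ℝ) < D := by exact_mod_cast hD
  have h3 : (D : ℝ)⁻¹ * n ≤ ((n / D : ℕ) : ℝ) + 1 := by
    rw [inv_mul_le_iff₀ hD']
    linarith
  rw [Nat.cast_sub (Nat.div_le_self n D)]
  linarith

/-- The dynamic program gains 1/D in the exponent. The call costs 2^(Kn/D) for the enlarged family
and 2^((1-ε)n) for the universe, which is still a gain of ε/2. The smaller of the two gains is what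
remains. -/
theorem solvableInTime_hasSetCover {ε : ℝ} (hε : 0 < ε)
    (h : SolvableInTime SetInstance.HasSetPartition (1 - ε)) :
    ∃ ε : ℝ, 0 < ε ∧ SolvableInTime SetInstance.HasSetCover (1 - ε) := by
  obtain ⟨p, C, K, hp⟩ := h
  -- D > 2K/ε gives K/D ≤ ε/2, and D > 2 gives 2⌊n/D⌋ ≤ n.
  obtain ⟨D, hD⟩ := exists_nat_gt (max 2 (2 * K / ε))
  have hD2 : (2 : ℝ) < D := (le_max_left _ _).trans_lt hD
  have hDK : K * (D : ℝ)⁻¹ ≤ ε / 2 := by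
    have h := ((le_max_right _ _).trans_lt hD).le
    rw [div_le_iff₀ hε] at h
    rw [← div_eq_mul_inv, div_le_iff₀ (by linarith)]
    linarith
  have hD2' : 2 < D := by exact_mod_cast hD2
  have hD1 : (D : ℝ)⁻¹ ≤ 1 := inv_le_one_of_one_le₀ (by linarith)
  refine ⟨min (D : ℝ)⁻¹ (ε / 2), lt_min (by positivity) (by positivity), ?_⟩
  have hm1 : min (D : ℝ)⁻¹ (ε / 2) ≤ (D : ℝ)⁻¹ := min_le_left _ _
  have hm2 : min (D : ℝ)⁻¹ (ε / 2) ≤ ε / 2 := min_le_right _ _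
  set J : SetInstance → SetInstance := fun I => SetInstance.ofSets I.n
    (I.m * 2 ^ (I.n / D) + I.n) (min I.s I.n) (subsetRows (I.n / D) I.nbr I.m) with hJ
  refine solvableInTime_of_cmd (by linarith) hp (coverCmd D) 300
    (fun I => coverTime I.n I.m (I.n / D))
    (fun I => C * ((J I).size : ℝ) ^ K * 2 ^ ((1 - ε) * ((J I).n : ℝ))) (by omega) ?_ ?_
    fun I σ hσ _ => (tr_coverCmd le_rfl hσ).conseq
      (fun σ' h => ⟨J I, h.1, le_rfl, ?_⟩) le_rfl
  · refine (OStar.of_nat 9 (fun I => coverTime_le I.n_lt_size I.m_lt_size ?_)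
      fun I => natCast_sub_div_le I.n (by omega)).mono (by linarith) fun I => le_rfl
    calc 2 * (I.n / D) ≤ D * (I.n / D) := Nat.mul_le_mul_right _ (by omega)
      _ ≤ I.n := Nat.mul_div_le _ _
  · have h1 := OStar.of_nat (δ := (D : ℝ)⁻¹) 2 (fun I => size_ofSets_subsetRows_le I (I.n / D))
      fun I => (natCast_div_le I.n D).trans (by linarith)
    refine (((OStar.const |C|).mul (h1.pow (fun I => by positivity) K)
      fun I => by positivity).mul (OStar.two_pow (1 - ε)) fun I => by positivity).mono
      (by linarith) fun I => ?_
    exact mul_le_mul_of_nonneg_right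
      (mul_le_mul_of_nonneg_right (le_abs_self C) (by positivity)) (by positivity)
  · rw [SetInstance.hasSetCover_iff_nbr, hasCover_iff (k := I.n / D) I.nbr_subset,
      SetInstance.hasSetPartition_iff (E := subsetRows (I.n / D) I.nbr I.m)
        (SetInstance.ofSets_mem _ _ _ _)
        fun ρ => (subsetRows_subset ρ).trans (I.nbr_subset _), h.2]
    rfl

end RAM

/-! ### Sets from binary digits, and disjointness by counting -/

namespace SetCode

open Finset

/-- The set of the positions below `n` of the binary digits `1` of `x`. -/
def bits (n x : ℕ) : Finset ℕ := (range n).filter fun u => x / 2 ^ u % 2 = 1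

theorem bits_mask {n : ℕ} {X : Finset ℕ} (hX : X ⊆ range n) : bits n (mask n X) = X := by
  ext u
  rw [bits, mem_filter]
  constructor
  · rintro ⟨hu, h⟩
    rw [mask_bit X (mem_range.1 hu)] at h
    by_contra hn
    simp [hn] at h
  · exact fun hu => ⟨hX hu, by rw [mask_bit X (mem_range.1 (hX hu)), if_pos hu]⟩

theorem card_bits (n x : ℕ) : (bits n x).card = ∑ u ∈ range n, x / 2 ^ u % 2 := by
  rw [bits, card_filter]
  refine sum_congr rfl fun u _ => ?_
  split_ifs <;> omega

theorem eq_of_bits_eq {B x y : ℕ} (hx : x < 2 ^ B) (hy : y < 2 ^ B)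
    (h : ∀ b < B, x / 2 ^ b % 2 = y / 2 ^ b % 2) : x = y := by
  induction B generalizing x y with
  | zero => omega
  | succ B ih =>
    have h0 := h 0 (by omega)
    rw [pow_zero, Nat.div_one, Nat.div_one] at h0
    rw [pow_succ] at hx hy
    have := ih (x := x / 2) (y := y / 2) (by omega) (by omega) fun b hb => by
      have := h (b + 1) (by omega)
      rwa [pow_succ', ← Nat.div_div_eq_div_mul, ← Nat.div_div_eq_div_mul] at this
    omega

/-- An element common to E f and E g can be deleted from E f without changing the union, so the sum
of the sizes exceeds the size of the union. -/
theorem card_biUnion_add_one_le {ι : Type*} [DecidableEq ι] {S : Finset ι} {E : ι → Finset ℕ}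
    {f g : ι} (hf : f ∈ S) (hg : g ∈ S) (hfg : f ≠ g) {u : ℕ} (huf : u ∈ E f) (hug : u ∈ E g) :
    (S.biUnion E).card + 1 ≤ ∑ f ∈ S, (E f).card := by
  have hsub : S.biUnion E ⊆ (E f).erase u ∪ (S.erase f).biUnion E := by
    intro v hv
    obtain ⟨h, hh, hv⟩ := mem_biUnion.1 hv
    by_cases hhf : h = f
    · subst hhf
      by_cases hvu : v = u
      · subst hvu
        exact mem_union_right _ (mem_biUnion.2 ⟨g, mem_erase.2 ⟨hfg.symm, hg⟩, hug⟩)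
      · exact mem_union_left _ (mem_erase.2 ⟨hvu, hv⟩)
    · exact mem_union_right _ (mem_biUnion.2 ⟨h, mem_erase.2 ⟨hhf, hh⟩, hv⟩)
  have h1 := (card_le_card hsub).trans (card_union_le _ _)
  have h2 : ((S.erase f).biUnion E).card ≤ ∑ f ∈ S.erase f, (E f).card := card_biUnion_le
  have h3 := card_erase_add_one huf
  have h4 := add_sum_erase S (fun f => (E f).card) hf
  omega

/-- This is how a covering problem can express disjointness: it suffices to control the total size.
-/
theorem pairwiseDisjoint_of_sum_card_le {ι : Type*} [DecidableEq ι] {S : Finset ι}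
    {E : ι → Finset ℕ} (h : ∑ f ∈ S, (E f).card ≤ (S.biUnion E).card) :
    (S : Set ι).PairwiseDisjoint E := by
  intro f hf g hg hfg
  rw [Function.onFun, disjoint_left]
  intro u huf hug
  have := card_biUnion_add_one_le hf hg hfg huf hug
  omega

/-! ### Partitions into few groups -/

section Partition

/-- Finite families of pairwise disjoint nonempty sets. -/
structure IsPacking (m : ℕ) (E : ℕ → Finset ℕ) (S : Finset ℕ) : Prop where
  subset : S ⊆ range m
  nonempty : ∀ f ∈ S, (E f).Nonempty
  disjoint : (S : Set ℕ).PairwiseDisjoint E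

variable {n q k m : ℕ} {E : ℕ → Finset ℕ}

theorem IsPacking.mono {S S' : Finset ℕ} (h : IsPacking m E S) (hS : S' ⊆ S) : IsPacking m E S' :=
  ⟨hS.trans h.subset, fun f hf => h.nonempty f (hS hf), h.disjoint.subset (coe_subset.2 hS)⟩

/-- Disjoint nonempty sets are at most as many as their elements. This keeps all numbers of members
at most n, although m may be larger. -/
theorem IsPacking.card_le {S : Finset ℕ} (h : IsPacking m E S) : S.card ≤ (S.biUnion E).card := by
  rw [card_biUnion h.disjoint, card_eq_sum_ones]
  exact sum_le_sum fun f hf => (h.nonempty f hf).card_pos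

variable (n q k E) in
/-- The guard of the dynamic program for disjoint families. -/
def PackGuard (f c : ℕ) : Prop := (E f).Nonempty ∧ Disjoint (bits n (c / q)) (E f) ∧
  ((bits n (c / q)).card + (E f).card ≤ k ∨ c = 0) ∧ c % q + 1 < q

instance (f : ℕ) : DecidablePred (PackGuard n q k E f) := fun _ => by
  unfold PackGuard; infer_instance

variable (n q k E) in
/-- The codes of the families of pairwise disjoint nonempty sets below `m` that have at most one
member or a union with at most `k` elements. -/
def packings (m : ℕ) : Finset ℕ :=
  dpPass (PackGuard n q k E) (fun f => joinCode n q (E f)) {0} m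

/-- Here the number in a code is exact: a member already used is nonempty and meets the current
union, so the guard rejects it. -/
theorem packings_sound (hE : ∀ f, E f ⊆ range n) : ∀ c ∈ packings n q k E m,
    0 < q → ∃ S, IsPacking m E S ∧ S.card < q ∧ ((S.biUnion E).card ≤ k ∨ S.card ≤ 1) ∧
      c = code n q (S.biUnion E) S.card := by
  refine dpPass_induction (fun c hc hq => ⟨∅, ⟨empty_subset _, by simp, by simp⟩, by simpa,
    Or.inr (by simp), by simpa using hc⟩) fun f hf c hc hG hq => ?_
  obtain ⟨S, hS, hSq, hSk, rfl⟩ := hc hq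
  obtain ⟨hne, hdis, hk, hj⟩ := hG
  have hU : S.biUnion E ⊆ range n := biUnion_subset.2 fun f _ => hE f
  rw [code_div _ hSq, bits_mask hU] at hdis hk
  rw [code_mod _ hSq] at hj
  have hfS : f ∉ S := fun hfS => by
    obtain ⟨u, hu⟩ := hne
    exact disjoint_left.1 hdis (mem_biUnion.2 ⟨f, hfS, hu⟩) hu
  have hcard := card_insert_of_notMem hfS
  refine ⟨insert f S, ⟨insert_subset (mem_range.2 hf) hS.subset, ?_, ?_⟩, by omega, ?_, ?_⟩
  · intro g hg
    rcases mem_insert.1 hg with rfl | hg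
    exacts [hne, hS.nonempty g hg]
  · rw [coe_insert, Set.pairwiseDisjoint_insert]
    refine ⟨hS.disjoint, fun g hg _ => ?_⟩
    exact (hdis.mono_left (subset_biUnion_of_mem E hg)).symm
  · rcases hk with hk | hk
    · left
      rw [biUnion_insert, union_comm]
      exact (card_union_le _ _).trans hk
    · right
      -- The code 0 carries the number 0, so the family before the step was empty and f becomes its
      -- only member.
      have : S.card = 0 := by rw [← code_mod (n := n) (S.biUnion E) hSq, hk, Nat.zero_mod]
      omega
  · rw [joinCode_code _ _ hSq, hcard, biUnion_insert, union_comm]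

/-- The members are joined in increasing order, so one pass is enough. Removing the last member
leaves a union with at most k elements or the empty family, whose code 0 the guard admits for the
sake of single large members. -/
theorem packings_complete (hE : ∀ f, E f ⊆ range n) {S : Finset ℕ} (hS : IsPacking m E S)
    (hk : (S.biUnion E).card ≤ k ∨ S.card ≤ 1) :
    code n (m + 1) (S.biUnion E) S.card ∈ packings n (m + 1) k E m := by
  have key : ∀ f ≤ m, ∀ S, IsPacking f E S → ((S.biUnion E).card ≤ k ∨ S.card ≤ 1) →
      code n (m + 1) (S.biUnion E) S.card ∈ packings n (m + 1) k E f := by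
    intro f
    induction f with
    | zero =>
      intro _ S hS _
      have h := hS.subset
      rw [range_zero, subset_empty] at h
      subst h
      simp [packings, dpPass]
    | succ f ih =>
      intro hf S hS hk
      have hsub : S.erase f ⊆ range f := fun g hg => by
        have h1 := mem_range.1 (hS.subset (mem_of_mem_erase hg))
        have h2 := ne_of_mem_erase hg
        exact mem_range.2 (by omega)
      by_cases hfS : f ∈ S
      · have hS' := hS.mono (erase_subset f S)
        have hcard := card_erase_add_one hfS
        have hunion : (S.erase f).biUnion E ∪ E f = S.biUnion E := by
          conv_rhs => rw [← insert_erase hfS]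
          rw [biUnion_insert, union_comm]
        have hdis : Disjoint ((S.erase f).biUnion E) (E f) := by
          rw [disjoint_biUnion_left]
          exact fun g hg => hS.disjoint (mem_of_mem_erase hg) hfS (ne_of_mem_erase hg)
        have hkc : ((S.erase f).biUnion E).card + (E f).card = (S.biUnion E).card := by
          rw [← hunion, card_union_of_disjoint hdis]
        have hSm := (card_le_card hS.subset).trans_eq (card_range _)
        have hc := ih (by omega) (S.erase f) ⟨hsub, hS'.nonempty, hS'.disjoint⟩ (by omega)
        have h := new_mem_dpPass hc (show PackGuard n (m + 1) k E f _ from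
          ⟨hS.nonempty f hfS, ?_, ?_, ?_⟩)
        · rw [joinCode_code _ _ (by omega), hcard, hunion] at h
          exact h
        · rwa [code_div _ (by omega), bits_mask (biUnion_subset.2 fun f _ => hE f)]
        · rcases hk with hk | hk
          · left
            rwa [code_div _ (by omega), bits_mask (biUnion_subset.2 fun f _ => hE f), hkc]
          · right
            have : S.erase f = ∅ := card_eq_zero.1 (by omega)
            rw [this]
            simp
        · rw [code_mod _ (by omega)]
          omega
      · refine dpPass_mono (Nat.le_succ f) (ih (by omega) S ⟨?_, hS.nonempty, hS.disjoint⟩ hk)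
        rwa [erase_eq_of_notMem hfS] at hsub
  exact key m le_rfl S hS hk

/-- The number of subsets of `{0, …, n - 1}` with at most `k` elements. -/
def smallSets (n k : ℕ) : ℕ := ((range n).powerset.filter fun X => X.card ≤ k).card

/-- A union is either a set with at most k elements or one of the m members; the factor m + 1 counts
the possible numbers. -/
theorem card_packings_le (hE : ∀ f, E f ⊆ range n) :
    (packings n (m + 1) k E m).card ≤ (smallSets n k + m) * (m + 1) := by
  have hsub : packings n (m + 1) k E m ⊆
      ((((range n).powerset.filter fun X => X.card ≤ k) ∪ (range m).image E) ×ˢ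
        range (m + 1)).image fun p => code n (m + 1) p.1 p.2 := by
    intro c hc
    obtain ⟨S, hS, hj, hk, rfl⟩ := packings_sound hE c hc (by omega)
    refine mem_image.2 ⟨(S.biUnion E, S.card), mem_product.2 ⟨?_, mem_range.2 hj⟩, rfl⟩
    simp only
    have hX : S.biUnion E ∈ (range n).powerset :=
      mem_powerset.2 (biUnion_subset.2 fun f _ => hE f)
    rcases hk with hk | hk
    · exact mem_union_left _ (mem_filter.2 ⟨hX, hk⟩)
    · rcases Nat.le_one_iff_eq_zero_or_eq_one.1 hk with h | h
      · rw [card_eq_zero] at h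
        subst h
        exact mem_union_left _ (mem_filter.2 ⟨hX, by simp⟩)
      · obtain ⟨f, rfl⟩ := card_eq_one.1 h
        refine mem_union_right _ (mem_image.2 ⟨f, ?_, by simp⟩)
        have := mem_range.1 (hS.subset (mem_singleton_self f))
        exact mem_range.2 (by omega)
  refine (card_le_card hsub).trans (card_image_le.trans ?_)
  rw [card_product, card_range]
  refine Nat.mul_le_mul_right _ ((card_union_le _ _).trans (Nat.add_le_add_left ?_ _))
  exact card_image_le.trans_eq (card_range m)

/-- A family of small total weight splits into a small number of groups of bounded weight and
single members. -/
theorem exists_coloring (w : ℕ → ℕ) (k : ℕ) (S : Finset ℕ) : ∃ (t : ℕ) (col : ℕ → ℕ),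
    (∀ f ∈ S, col f ≤ t) ∧ t * (k + 1) ≤ 2 * ∑ f ∈ S, w f ∧
    ∀ c, ∑ f ∈ S with col f = c, w f ≤ k ∨ (S.filter fun f => col f = c).card ≤ 1 := by
  -- Strengthened for the induction: colour t is an open group of weight at most k/2, and the t
  -- closed colours together weigh at least t(k + 1)/2.
  suffices h : ∃ (t : ℕ) (col : ℕ → ℕ), (∀ f ∈ S, col f ≤ t) ∧
      2 * ∑ f ∈ S with col f = t, w f ≤ k ∧
      t * (k + 1) ≤ 2 * ∑ f ∈ S with col f ≠ t, w f ∧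
      ∀ c, ∑ f ∈ S with col f = c, w f ≤ k ∨ (S.filter fun f => col f = c).card ≤ 1 by
    obtain ⟨t, col, h1, -, h2, h3⟩ := h
    refine ⟨t, col, h1, h2.trans ?_, h3⟩
    exact Nat.mul_le_mul_left _ (sum_le_sum_of_subset (filter_subset _ _))
  induction S using Finset.induction_on with
  | empty => exact ⟨0, fun _ => 0, by simp, by simp, by simp, by simp⟩
  | insert f S hf ih =>
    obtain ⟨t, col, h1, h2, h3, h4⟩ := ih
    have hne : ∀ g ∈ S, g ≠ f := fun g hg h => hf (h ▸ hg)
    -- A member of weight at most k/2 joins the open group, which then weighs at most k. If its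
    -- weight now exceeds k/2, the group is closed and the empty colour t + 1 becomes the open one.
    by_cases hlight : 2 * w f ≤ k
    · set col' : ℕ → ℕ := fun g => if g = f then t else col g with hcol'
      have e : ∀ c, S.filter (fun g => col' g = c) = S.filter fun g => col g = c := fun c =>
        filter_congr fun g hg => by simp [hcol', hne g hg]
      have en : ∀ c, S.filter (fun g => col' g ≠ c) = S.filter fun g => col g ≠ c := fun c =>
        filter_congr fun g hg => by simp [hcol', hne g hg]
      have et : (insert f S).filter (fun g => col' g = t)
          = insert f (S.filter fun g => col g = t) := by
        rw [filter_insert, if_pos (by simp [hcol']), e]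
      have ht : ∑ g ∈ insert f S with col' g = t, w g = w f + ∑ g ∈ S with col g = t, w g := by
        rw [et, sum_insert fun h => hf (mem_filter.1 h).1]
      have hc : ∀ c, c ≠ t → (insert f S).filter (fun g => col' g = c)
          = S.filter fun g => col g = c := fun c hc => by
        rw [filter_insert, if_neg (by simp [hcol', hc.symm]), e]
      have h4' : ∀ c, ∑ f ∈ insert f S with col' f = c, w f ≤ k ∨
          ((insert f S).filter fun f => col' f = c).card ≤ 1 := fun c => by
        by_cases hct : c = t
        · subst hct
          left
          omega
        · rw [hc c hct]
          exact h4 c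
      have h1' : ∀ g ∈ insert f S, col' g ≤ t := fun g hg => by
        simp only [hcol']
        split_ifs with h
        · exact le_rfl
        · exact h1 g (mem_of_mem_insert_of_ne hg h)
      by_cases hsum : 2 * ∑ g ∈ insert f S with col' g = t, w g ≤ k
      · refine ⟨t, col', h1', hsum, ?_, h4'⟩
        rw [filter_insert, if_neg (by simp [hcol']), en]
        exact h3
      · have hlt : ∀ g ∈ insert f S, col' g ≠ t + 1 := fun g hg => by have := h1' g hg; omega
        refine ⟨t + 1, col', fun g hg => (h1' g hg).trans (by omega), ?_, ?_, h4'⟩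
        · rw [filter_false_of_mem hlt]
          simp
        · rw [filter_true_of_mem hlt, ← sum_filter_add_sum_filter_not _ (fun g => col' g = t),
            filter_insert (fun g => ¬ col' g = t), if_neg (by simp [hcol'])]
          have := en t
          simp only [ne_eq] at this h3
          rw [this, Nat.succ_mul]
          omega
    -- A heavier member forms a closed group by itself. It takes over colour t, and the open group
    -- is recoloured t + 1.
    · set col' : ℕ → ℕ := fun g => if g = f then t else if col g = t then t + 1 else col g
        with hcol'
      have hval : ∀ g ∈ S, col' g = if col g = t then t + 1 else col g := fun g hg => by
        simp only [hcol']
        rw [if_neg (hne g hg)]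
      have hf' : col' f = t := if_pos rfl
      have e1 : (insert f S).filter (fun g => col' g = t + 1) = S.filter fun g => col g = t := by
        rw [filter_insert, if_neg (by omega)]
        refine filter_congr fun g hg => ?_
        have := h1 g hg
        rw [hval g hg]
        split_ifs <;> omega
      have e2 : (insert f S).filter (fun g => col' g = t) = {f} := by
        rw [filter_insert, if_pos hf', filter_false_of_mem fun g hg => ?_]
        · rfl
        · rw [hval g hg]
          split_ifs <;> omega
      refine ⟨t + 1, col', fun g hg => ?_, by rwa [e1], ?_, fun c => ?_⟩
      · rcases mem_insert.1 hg with rfl | hg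
        · omega
        · have := h1 g hg
          rw [hval g hg]
          split_ifs <;> omega
      · have e3 : (insert f S).filter (fun g => col' g ≠ t + 1)
            = insert f (S.filter fun g => col g ≠ t) := by
          rw [filter_insert, if_pos (by omega)]
          congr 1
          refine filter_congr fun g hg => ?_
          have := h1 g hg
          rw [hval g hg]
          split_ifs <;> omega
        rw [e3, sum_insert fun h => hf (mem_filter.1 h).1, Nat.succ_mul]
        omega
      · by_cases hc1 : c = t + 1
        · subst hc1
          rw [e1]
          exact h4 t
        · by_cases hc : c = t
          · subst hc
            rw [e2]
            exact Or.inr (by simp)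
          · have e3 : (insert f S).filter (fun g => col' g = c) = S.filter fun g => col g = c := by
              rw [filter_insert, if_neg (by omega)]
              refine filter_congr fun g hg => ?_
              rw [hval g hg]
              split_ifs <;> omega
            rw [e3]
            exact h4 c

end Partition

end SetCode

/-! ### Partitions as tuples of packings with prescribed total weight -/

namespace SetCode

open Finset

/-- The size of the coded set and the coded number, combined in one number. -/
def weight (n q c : ℕ) : ℕ := (bits n (c / q)).card * (n + 1) + c % q

theorem weight_code {n q j : ℕ} {X : Finset ℕ} (hX : X ⊆ range n) (hj : j < q) :
    weight n q (code n q X j) = X.card * (n + 1) + j := by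
  rw [weight, code_div X hj, code_mod X hj, bits_mask hX]

/-- The total weight of a partition of the universe into `j` nonempty sets, where `j ≤ s` and `j`
differs from `s` by at most `e`. -/
def IsFinal (n s e W : ℕ) : Prop := W / (n + 1) = n ∧ s ≤ W % (n + 1) + e ∧ W % (n + 1) ≤ s

instance (n s e W : ℕ) : Decidable (IsFinal n s e W) := by unfold IsFinal; infer_instance

theorem IsFinal.lt {n s e W : ℕ} (h : IsFinal n s e W) : W < (n + 1) * (n + 1) := by
  have h1 := Nat.div_add_mod W (n + 1)
  have h2 := Nat.mod_lt W (show 0 < n + 1 by omega)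
  rw [h.1] at h1
  rw [Nat.mul_succ]
  omega

variable {n m s D : ℕ} {E : ℕ → Finset ℕ}

/-- The number of empty members of the family. -/
def emptyCount (m : ℕ) (E : ℕ → Finset ℕ) : ℕ := ((range m).filter fun f => E f = ∅).card

/-- The nonempty members of the partition are grouped by `exists_coloring`, and every colour class
is a packing in the table. The empty members account for the difference between s and the total
number in the codes. -/
theorem exists_codes_of_hasPartition (hE : ∀ f, E f ⊆ range n) (hD : 0 < D)
    (h : HasPartition n m s E) : ∃ g : ℕ → ℕ,
      (∀ c < 2 * D, g c ∈ packings n (m + 1) (n / D) E m) ∧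
      (∀ u < n, ∃ c < 2 * D, u ∈ bits n (g c / (m + 1))) ∧
      IsFinal n s (emptyCount m E) (∑ c ∈ range (2 * D), weight n (m + 1) (g c)) := by
  obtain ⟨S, hS, hs, hcov, hdis⟩ := h
  set S' := S.filter fun f => (E f).Nonempty with hS'
  have hp : IsPacking m E S' := ⟨(filter_subset _ _).trans hS, fun f hf => (mem_filter.1 hf).2,
    hdis.subset (coe_subset.2 (filter_subset _ _))⟩
  have hU : S'.biUnion E = range n := by
    refine (biUnion_subset.2 fun f _ => hE f).antisymm fun u hu => ?_
    obtain ⟨f, hf, huf⟩ := hcov u (mem_range.1 hu)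
    exact mem_biUnion.2 ⟨f, mem_filter.2 ⟨hf, ⟨u, huf⟩⟩, huf⟩
  have hsum : ∑ f ∈ S', (E f).card = n := by rw [← card_biUnion hp.disjoint, hU, card_range]
  obtain ⟨t, col, h1, h2, h3⟩ := exists_coloring (fun f => (E f).card) (n / D) S'
  -- The total size is n < D(⌊n/D⌋ + 1), so t(⌊n/D⌋ + 1) ≤ 2n leaves fewer than 2D closed colours.
  have ht : t < 2 * D := by
    rw [hsum] at h2
    have h4 : n < D * (n / D + 1) := Nat.lt_mul_div_succ n hD
    have h5 : t * (n / D + 1) < 2 * D * (n / D + 1) := by rw [mul_assoc]; omega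
    exact lt_of_mul_lt_mul_right h5 (Nat.zero_le _)
  have hcol : ∀ f ∈ S', col f ∈ range (2 * D) := fun f hf =>
    mem_range.2 ((h1 f hf).trans_lt ht)
  set G : ℕ → Finset ℕ := fun c => S'.filter fun f => col f = c with hG
  have hGp : ∀ c, IsPacking m E (G c) := fun c => hp.mono (filter_subset _ _)
  have hGU : ∀ c, (G c).biUnion E ⊆ range n := fun c => biUnion_subset.2 fun f _ => hE f
  have hGm : ∀ c, (G c).card < m + 1 := fun c => by
    have := (card_le_card (hGp c).subset).trans_eq (card_range m)
    omega
  refine ⟨fun c => code n (m + 1) ((G c).biUnion E) (G c).card, fun c _ => ?_, fun u hu => ?_, ?_⟩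
  · refine packings_complete hE (hGp c) ?_
    rw [card_biUnion (hGp c).disjoint]
    exact h3 c
  · obtain ⟨f, hf, huf⟩ := mem_biUnion.1 (hU ▸ mem_range.2 hu)
    refine ⟨col f, mem_range.1 (hcol f hf), ?_⟩
    rw [code_div _ (hGm _), bits_mask (hGU _)]
    exact mem_biUnion.2 ⟨f, mem_filter.2 ⟨hf, rfl⟩, huf⟩
  · have hW : ∑ c ∈ range (2 * D), weight n (m + 1) (code n (m + 1) ((G c).biUnion E) (G c).card)
        = (n + 1) * n + S'.card := by
      rw [sum_congr rfl fun c _ => weight_code (hGU c) (hGm c), sum_add_distrib, ← sum_mul,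
        card_eq_sum_card_fiberwise hcol, mul_comm]
      congr 2
      rw [← hsum, ← sum_fiberwise_of_maps_to hcol]
      exact sum_congr rfl fun c _ => card_biUnion (hGp c).disjoint
    have hn : S'.card ≤ n := hp.card_le.trans_eq (by rw [hU, card_range])
    have hsplit : S'.card + (S.filter fun f => ¬ (E f).Nonempty).card = S.card :=
      card_filter_add_card_filter_not _
    have hempty : (S.filter fun f => ¬ (E f).Nonempty).card ≤ emptyCount m E := by
      refine card_le_card fun f hf => ?_
      obtain ⟨h1, h2⟩ := mem_filter.1 hf
      exact mem_filter.2 ⟨hS h1, not_nonempty_iff_eq_empty.1 h2⟩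
    rw [hW, IsFinal, Nat.mul_add_div (by omega), Nat.mul_add_mod, Nat.div_eq_of_lt (by omega),
      Nat.mod_eq_of_lt (by omega)]
    omega

/-- The final weight bounds the sum of the sizes by n, and covering makes it at least n. Equality
forces the unions to be disjoint, so the packings combine to one. Empty members then supply what is
missing to s. -/
theorem hasPartition_of_codes (hE : ∀ f, E f ⊆ range n) {k T : ℕ} {g : ℕ → ℕ}
    (hg : ∀ c < T, g c ∈ packings n (m + 1) k E m)
    (hcov : ∀ u < n, ∃ c < T, u ∈ bits n (g c / (m + 1)))
    (hW : IsFinal n s (emptyCount m E) (∑ c ∈ range T, weight n (m + 1) (g c))) :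
    HasPartition n m s E := by
  choose! G hGp hGq _ hGc using fun c hc => packings_sound hE (g c) (hg c hc) (Nat.succ_pos m)
  have hGU : ∀ c, (G c).biUnion E ⊆ range n := fun c => biUnion_subset.2 fun f _ => hE f
  have hUU : (range T).biUnion (fun c => (G c).biUnion E) = range n := by
    refine (biUnion_subset.2 fun c _ => hGU c).antisymm fun u hu => ?_
    obtain ⟨c, hc, huc⟩ := hcov u (mem_range.1 hu)
    rw [hGc c hc, code_div _ (hGq c hc), bits_mask (hGU c)] at huc
    exact mem_biUnion.2 ⟨c, mem_range.2 hc, huc⟩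
  have hwt : ∑ c ∈ range T, weight n (m + 1) (g c)
      = (n + 1) * ∑ c ∈ range T, ((G c).biUnion E).card + ∑ c ∈ range T, (G c).card := by
    rw [mul_comm, sum_mul, ← sum_add_distrib]
    refine sum_congr rfl fun c hc => ?_
    have hc := mem_range.1 hc
    conv_lhs => rw [hGc c hc]
    rw [weight_code (hGU c) (hGq c hc)]
  have hlt := hW.lt
  rw [hwt] at hW hlt
  have hn : n ≤ ∑ c ∈ range T, ((G c).biUnion E).card := by
    have h : (range n).card ≤ _ := hUU ▸ card_biUnion_le
    rwa [card_range] at h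
  have hn' : ∑ c ∈ range T, ((G c).biUnion E).card ≤ n := by
    refine Nat.lt_succ_iff.1 (lt_of_mul_lt_mul_left (?_ : (n + 1) * _ < (n + 1) * (n + 1))
      (Nat.zero_le _))
    omega
  have hA : ∑ c ∈ range T, ((G c).biUnion E).card = n := le_antisymm hn' hn
  have hb : ∑ c ∈ range T, (G c).card ≤ n := by
    rw [← hA]
    exact sum_le_sum fun c hc => (hGp c (mem_range.1 hc)).card_le
  rw [hA, IsFinal, Nat.mul_add_div (by omega), Nat.mul_add_mod, Nat.div_eq_of_lt (by omega),
    Nat.mod_eq_of_lt (by omega)] at hW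
  have hXdis := pairwiseDisjoint_of_sum_card_le (S := range T) (E := fun c => (G c).biUnion E)
    (by rw [hUU, card_range, hA])
  -- Members of packings are nonempty, so a member shared by two packings would give their unions a
  -- common element.
  have hGdis : (range T : Set ℕ).PairwiseDisjoint G := by
    intro c hc d hd hcd
    rw [Function.onFun, disjoint_left]
    intro f hfc hfd
    obtain ⟨u, hu⟩ := (hGp c (mem_range.1 hc)).nonempty f hfc
    exact disjoint_left.1 (hXdis hc hd hcd) (mem_biUnion.2 ⟨f, hfc, hu⟩)
      (mem_biUnion.2 ⟨f, hfd, hu⟩)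
  set S := (range T).biUnion G with hS
  have hSU : S.biUnion E = range n := by rw [hS, biUnion_biUnion, hUU]
  have hScard : S.card = ∑ c ∈ range T, (G c).card := card_biUnion hGdis
  have hSsub : S ⊆ range m := biUnion_subset.2 fun c hc => (hGp c (mem_range.1 hc)).subset
  have hSdis : (S : Set ℕ).PairwiseDisjoint E := pairwiseDisjoint_of_sum_card_le (by
    rw [hSU, card_range, hS, sum_biUnion hGdis, ← hA]
    exact sum_le_sum fun c hc => (card_biUnion (hGp c (mem_range.1 hc)).disjoint).ge)
  have hSne : ∀ f ∈ S, (E f).Nonempty := fun f hf => by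
    obtain ⟨c, hc, hf⟩ := mem_biUnion.1 hf
    exact (hGp c (mem_range.1 hc)).nonempty f hf
  -- `IsFinal` bounds the deficit s - |S| by the number of empty members.
  obtain ⟨Z, hZ, hZc⟩ := exists_subset_card_eq
    (show s - S.card ≤ ((range m).filter fun f => E f = ∅).card by
      rw [emptyCount] at hW; omega)
  have hZe : ∀ f ∈ Z, E f = ∅ := fun f hf => (mem_filter.1 (hZ hf)).2
  have hSZ : Disjoint S Z := disjoint_left.2 fun f hf hfZ =>
    (hSne f hf).ne_empty (hZe f hfZ)
  refine ⟨S ∪ Z, union_subset hSsub (hZ.trans (filter_subset _ _)), ?_, ?_, ?_⟩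
  · rw [card_union_of_disjoint hSZ]
    omega
  · intro u hu
    obtain ⟨f, hf, huf⟩ := mem_biUnion.1 (hSU ▸ mem_range.2 hu)
    exact ⟨f, mem_union_left _ hf, huf⟩
  · intro a ha b hb hab
    rcases mem_union.1 (mem_coe.1 ha) with ha | ha
    · rcases mem_union.1 (mem_coe.1 hb) with hb | hb
      · exact hSdis ha hb hab
      · rw [Function.onFun, hZe b hb]
        exact disjoint_empty_right _
    · rw [Function.onFun, hZe a ha]
      exact disjoint_empty_left _

/-! ### Chains of sets with prefix sums -/

section Chain

/-- The conditions on a set in position `i` of `T` positions, with the total weight `p` of the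
earlier sets and the total weight `out` including this one. -/
def ChainValid (n T B s e i p out : ℕ) : Prop :=
  out < 2 ^ B ∧ (i = 0 → p = 0) ∧ (i + 1 = T → IsFinal n s e out)

/-- The elements covered by the set with the mask `X` in position `i`: besides those of the set, an
element for the position, and elements that compare the weights at consecutive positions. -/
def ChainMark (n T B X i p out a : ℕ) : Prop :=
  (a < n ∧ X / 2 ^ a % 2 = 1) ∨ (n ≤ a ∧
    (((a - n) % (2 * B + 1) = 2 * B ∧ (a - n) / (2 * B + 1) = i) ∨
    ((a - n) % (2 * B + 1) ≠ 2 * B ∧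
      (((a - n) / (2 * B + 1) = i ∧
        (i + 1 = T ∨ (a - n) % (2 * B + 1) % 2 ≠ out / 2 ^ ((a - n) % (2 * B + 1) / 2) % 2)) ∨
      ((a - n) / (2 * B + 1) + 1 = i ∧
        (a - n) % (2 * B + 1) % 2 = p / 2 ^ ((a - n) % (2 * B + 1) / 2) % 2)))))

instance (n T B s e i p out : ℕ) : Decidable (ChainValid n T B s e i p out) := by
  unfold ChainValid; infer_instance

instance (n T B X i p out a : ℕ) : Decidable (ChainMark n T B X i p out a) := by
  unfold ChainMark; infer_instance

/-- The family of the possible sets, positions and prefix sums. -/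
def chainRow (n q T B s e : ℕ) (cd : ℕ → ℕ) (ρ : ℕ) : Finset ℕ :=
  (range (n + T * (2 * B + 1))).filter fun a =>
    ChainValid n T B s e (ρ / 2 ^ B % T) (ρ % 2 ^ B)
      (ρ % 2 ^ B + weight n q (cd (ρ / 2 ^ B / T))) ∧
    ChainMark n T B (cd (ρ / 2 ^ B / T) / q) (ρ / 2 ^ B % T) (ρ % 2 ^ B)
      (ρ % 2 ^ B + weight n q (cd (ρ / 2 ^ B / T))) a

variable {q T B e len : ℕ} {cd : ℕ → ℕ}

/-- Position d uses the row with its true prefix sum p d. A comparison element of block d for digit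
b and value v is covered at position d if v differs from digit b of p (d + 1), and at position d + 1
if v agrees with it. The last position covers its whole block, having no successor. -/
theorem hasCover_chainRow (hT : 0 < T) (hB : (n + 1) * (n + 1) ≤ 2 ^ B) {g : ℕ → ℕ}
    (hg : ∀ c < T, ∃ i < len, cd i = g c) (hcov : ∀ u < n, ∃ c < T, u ∈ bits n (g c / q))
    (hW : IsFinal n s e (∑ c ∈ range T, weight n q (g c))) :
    HasCover (n + T * (2 * B + 1)) (len * T * 2 ^ B) T (chainRow n q T B s e cd) := by
  choose! i hi hgi using hg
  set p : ℕ → ℕ := fun d => ∑ c ∈ range d, weight n q (g c) with hp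
  have hpT : ∀ d ≤ T, p d < 2 ^ B := fun d hd =>
    ((sum_le_sum_of_subset (range_mono hd)).trans_lt hW.lt).trans_le hB
  have hps : ∀ d, p d + weight n q (g d) = p (d + 1) := fun d => (sum_range_succ _ _).symm
  set ρ : ℕ → ℕ := fun d => (i d * T + d) * 2 ^ B + p d with hρ
  have e1 : ∀ d < T, ρ d % 2 ^ B = p d := fun d hd => by
    rw [hρ, Nat.mul_add_mod', Nat.mod_eq_of_lt (hpT d hd.le)]
  have e2 : ∀ d < T, ρ d / 2 ^ B = i d * T + d := fun d hd => by
    show ((i d * T + d) * 2 ^ B + p d) / 2 ^ B = _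
    rw [mul_comm _ (2 ^ B), Nat.mul_add_div (by positivity), Nat.div_eq_of_lt (hpT d hd.le), add_zero]
  have e3 : ∀ d < T, ρ d / 2 ^ B % T = d := fun d hd => by
    rw [e2 d hd, Nat.mul_add_mod', Nat.mod_eq_of_lt hd]
  have e4 : ∀ d < T, ρ d / 2 ^ B / T = i d := fun d hd => by
    rw [e2 d hd, mul_comm _ T, Nat.mul_add_div hT, Nat.div_eq_of_lt hd, add_zero]
  have hrow : ∀ d < T, ∀ a < n + T * (2 * B + 1),
      ChainMark n T B (g d / q) d (p d) (p (d + 1)) a → a ∈ chainRow n q T B s e cd (ρ d) := by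
    intro d hd a ha h
    rw [chainRow, mem_filter, e1 d hd, e3 d hd, e4 d hd, hgi d hd, hps]
    exact ⟨mem_range.2 ha, ⟨hpT (d + 1) hd, fun h => by simp [hp, h], fun h => h ▸ hW⟩, h⟩
  refine ⟨(range T).image ρ, ?_, card_image_le.trans_eq (card_range T), fun a ha => ?_⟩
  · intro r hr
    obtain ⟨d, hd, rfl⟩ := mem_image.1 hr
    have hd := mem_range.1 hd
    have h1 : (i d + 1) * T ≤ len * T := Nat.mul_le_mul_right _ (hi d hd)
    have h2 : (i d * T + d + 1) * 2 ^ B ≤ len * T * 2 ^ B :=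
      Nat.mul_le_mul_right _ (by rw [Nat.succ_mul] at h1; omega)
    rw [Nat.succ_mul] at h2
    have := hpT d hd.le
    exact mem_range.2 (by simp only [hρ]; omega)
  · suffices h : ∃ d < T, ChainMark n T B (g d / q) d (p d) (p (d + 1)) a by
      obtain ⟨d, hd, h⟩ := h
      exact ⟨ρ d, mem_image_of_mem _ (mem_range.2 hd), hrow d hd a ha h⟩
    by_cases han : a < n
    · obtain ⟨d, hd, h⟩ := hcov a han
      exact ⟨d, hd, Or.inl ⟨han, (mem_filter.1 h).2⟩⟩
    · have hd : (a - n) / (2 * B + 1) < T := (Nat.div_lt_iff_lt_mul (by omega)).2 (by omega)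
      by_cases hy : (a - n) % (2 * B + 1) = 2 * B
      · exact ⟨_, hd, Or.inr ⟨by omega, Or.inl ⟨hy, rfl⟩⟩⟩
      · by_cases h : (a - n) / (2 * B + 1) + 1 = T ∨ (a - n) % (2 * B + 1) % 2 ≠
          p ((a - n) / (2 * B + 1) + 1) / 2 ^ ((a - n) % (2 * B + 1) / 2) % 2
        · exact ⟨_, hd, Or.inr ⟨by omega, Or.inr ⟨hy, Or.inl ⟨rfl, h⟩⟩⟩⟩
        · push Not at h
          exact ⟨_, show (a - n) / (2 * B + 1) + 1 < T by omega,
            Or.inr ⟨by omega, Or.inr ⟨hy, Or.inr ⟨rfl, h.2⟩⟩⟩⟩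

/-- With only T sets allowed, the T position elements leave exactly one row per position. The
comparison elements then force the incoming sum of each position to be the outgoing sum of the
previous one. By induction the incoming sums are the true prefix sums, and the last row was admitted
only with a final total. -/
theorem exists_codes_of_hasCover_chainRow (hT : 0 < T)
    (h : HasCover (n + T * (2 * B + 1)) (len * T * 2 ^ B) T (chainRow n q T B s e cd)) :
    ∃ g : ℕ → ℕ, (∀ c < T, ∃ i < len, cd i = g c) ∧
      (∀ u < n, ∃ c < T, u ∈ bits n (g c / q)) ∧
      IsFinal n s e (∑ c ∈ range T, weight n q (g c)) := by
  obtain ⟨S, hS, hcard, hcov⟩ := h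
  have hdec : ∀ d < T, ∀ y < 2 * B + 1, n + (d * (2 * B + 1) + y) < n + T * (2 * B + 1) ∧
      (n + (d * (2 * B + 1) + y) - n) / (2 * B + 1) = d ∧
      (n + (d * (2 * B + 1) + y) - n) % (2 * B + 1) = y := fun d hd y hy => by
    have h := Nat.mul_le_mul_right (2 * B + 1) (Nat.succ_le_of_lt hd)
    rw [Nat.succ_mul] at h
    rw [Nat.add_sub_cancel_left]
    refine ⟨by omega, ?_, ?_⟩
    · rw [mul_comm, Nat.mul_add_div (by omega), Nat.div_eq_of_lt hy, add_zero]
    · rw [Nat.mul_add_mod', Nat.mod_eq_of_lt hy]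
  have hpos : ∀ d < T, ∃ ρ ∈ S, ρ / 2 ^ B % T = d ∧ ChainValid n T B s e d (ρ % 2 ^ B)
      (ρ % 2 ^ B + weight n q (cd (ρ / 2 ^ B / T))) := fun d hd => by
    -- Residue 2B of block d is the position element, which only rows for position d contain.
    obtain ⟨h1, h2, h3⟩ := hdec d hd (2 * B) (by omega)
    obtain ⟨ρ, hρ, h⟩ := hcov _ h1
    obtain ⟨-, hv, hm⟩ := mem_filter.1 h
    rw [ChainMark, h2, h3] at hm
    have hi : ρ / 2 ^ B % T = d := by
      rcases hm with hm | ⟨-, hm | hm⟩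
      · omega
      · exact hm.2.symm
      · exact absurd rfl hm.1
    exact ⟨ρ, hρ, hi, hi ▸ hv⟩
  choose! ρ hρS hρi hρv using hpos
  -- The rows chosen for distinct positions are distinct, so these T rows exhaust S.
  have himg : (range T).image ρ = S := by
    refine eq_of_subset_of_card_le (fun r hr => ?_) ?_
    · obtain ⟨d, hd, rfl⟩ := mem_image.1 hr
      exact hρS d (mem_range.1 hd)
    · rw [card_image_of_injOn fun a ha b hb hab => ?_, card_range]
      · exact hcard
      · rw [← hρi a (mem_range.1 (mem_coe.1 ha)), hab, hρi b (mem_range.1 (mem_coe.1 hb))]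
  set g : ℕ → ℕ := fun d => cd (ρ d / 2 ^ B / T) with hg
  have hcov' : ∀ a < n + T * (2 * B + 1), ∃ d < T, ChainMark n T B (g d / q) d (ρ d % 2 ^ B)
      (ρ d % 2 ^ B + weight n q (g d)) a := fun a ha => by
    obtain ⟨r, hr, h⟩ := hcov a ha
    rw [← himg] at hr
    obtain ⟨d, hd, rfl⟩ := mem_image.1 hr
    have hd := mem_range.1 hd
    have h := (mem_filter.1 h).2.2
    rw [hρi d hd] at h
    exact ⟨d, hd, h⟩
  have hp : ∀ d < T, ρ d % 2 ^ B = ∑ c ∈ range d, weight n q (g c) := by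
    intro d
    induction d with
    | zero => exact fun h0 => by simpa using (hρv 0 h0).2.1 rfl
    | succ d ih =>
      intro hd
      have hdT : d < T := by omega
      rw [sum_range_succ, ← ih hdT]
      refine eq_of_bits_eq (Nat.mod_lt _ (by positivity)) (hρv d hdT).1 fun b hb => ?_
      set v := (ρ d % 2 ^ B + weight n q (g d)) / 2 ^ b % 2 with hv
      have hv2 : v < 2 := Nat.mod_lt _ two_pos
      -- The comparison element for digit b with the very value v of the outgoing sum: position d
      -- does not cover it, so position d + 1 must, and its incoming sum has the digit v as well.
      obtain ⟨h1, h2, h3⟩ := hdec d hdT (2 * b + v) (by omega)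
      obtain ⟨d', hd', h⟩ := hcov' _ h1
      rw [ChainMark, h2, h3, show (2 * b + v) % 2 = v by omega,
        show (2 * b + v) / 2 = b by omega] at h
      rcases h with h | ⟨-, h | ⟨-, ⟨h, h'⟩ | ⟨h, h'⟩⟩⟩
      · omega
      · omega
      · subst h
        rcases h' with h' | h'
        · omega
        · exact absurd hv h'
      · subst h
        exact h'.symm
  refine ⟨g, fun d hd => ⟨_, ?_, rfl⟩, fun u hu => ?_, ?_⟩
  · rw [Nat.div_lt_iff_lt_mul hT, Nat.div_lt_iff_lt_mul (by positivity)]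
    exact mem_range.1 (hS (hρS d hd))
  · obtain ⟨d, hd, h⟩ := hcov' u (by omega)
    rcases h with h | h
    · exact ⟨d, hd, mem_filter.2 ⟨mem_range.2 hu, h.2⟩⟩
    · omega
  · obtain ⟨d, rfl⟩ : ∃ d, T = d + 1 := ⟨T - 1, by omega⟩
    have h := (hρv d (by omega)).2.2 rfl
    rwa [hp d (by omega), ← sum_range_succ] at h

end Chain

/-- The enumeration cd of the packings is arbitrary, since the order of the list is whatever the
dynamic program produces. -/
theorem hasPartition_iff (hE : ∀ f, E f ⊆ range n) (hD : 0 < D) {B len : ℕ}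
    (hB : (n + 1) * (n + 1) ≤ 2 ^ B) {cd : ℕ → ℕ}
    (hcd : (range len).image cd = packings n (m + 1) (n / D) E m) :
    HasPartition n m s E ↔ HasCover (n + 2 * D * (2 * B + 1)) (len * (2 * D) * 2 ^ B) (2 * D)
      (chainRow n (m + 1) (2 * D) B s (emptyCount m E) cd) := by
  have hmem : ∀ c, c ∈ packings n (m + 1) (n / D) E m ↔ ∃ i < len, cd i = c := fun c => by
    rw [← hcd, mem_image]
    simp only [mem_range]
  constructor
  · intro h
    obtain ⟨g, hg, hcov, hW⟩ := exists_codes_of_hasPartition hE hD h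
    exact hasCover_chainRow (by omega) hB (fun c hc => (hmem _).1 (hg c hc)) hcov hW
  · intro h
    obtain ⟨g, hg, hcov, hW⟩ := exists_codes_of_hasCover_chainRow (by omega) h
    exact hasPartition_of_codes hE (fun c hc => (hmem _).2 (hg c hc)) hcov hW

end SetCode

/-! ### Expressions with known values, and the matrix of chains -/

namespace RAM

open RAMProg Function SetCode

namespace Ex

/-- The expression can be evaluated, and its value is `v`. -/
def Has (e : Ex) (w : ℕ) (σ : St) (v : ℕ) : Prop := e.Ok w σ ∧ e.eval σ = v

/-- The expression can be evaluated, and its value is the truth value of `P`. -/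
def Tests (e : Ex) (w : ℕ) (σ : St) (P : Prop) : Prop :=
  e.Ok w σ ∧ (P → e.eval σ = 1) ∧ (¬ P → e.eval σ = 0)

variable {a b : Ex} {w u v x : ℕ} {σ : St} {P Q : Prop}

theorem Has.lett (hx : x < 32) (ha : a.Has w σ u) (hb : b.Has w (σ.set x u) v) :
    (lett x a b).Has w σ v := by
  obtain ⟨ha, rfl⟩ := ha
  exact ⟨⟨hx, ha, hb.1⟩, hb.2⟩

theorem Has.con : (con v).Has w σ v := ⟨trivial, rfl⟩
theorem Has.reg (hx : x < 32) (h : σ.r x = v) : (reg x).Has w σ v := ⟨hx, h⟩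
theorem Has.add (ha : a.Has w σ u) (hb : b.Has w σ v) : (a + b).Has w σ (u + v) :=
  ⟨⟨ha.1, hb.1⟩, by rw [eval_add, ha.2, hb.2]⟩
theorem Has.sub (ha : a.Has w σ u) (hb : b.Has w σ v) : (a - b).Has w σ (u - v) :=
  ⟨⟨ha.1, hb.1⟩, by rw [eval_sub, ha.2, hb.2]⟩
theorem Has.mul (ha : a.Has w σ u) (hb : b.Has w σ v) : (a * b).Has w σ (u * v) :=
  ⟨⟨ha.1, hb.1⟩, by rw [eval_mul, ha.2, hb.2]⟩
theorem Has.div (ha : a.Has w σ u) (hb : b.Has w σ v) : (a / b).Has w σ (u / v) :=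
  ⟨⟨ha.1, hb.1⟩, by rw [eval_div, ha.2, hb.2]⟩
theorem Has.md (ha : a.Has w σ u) (hb : b.Has w σ v) : (md a b).Has w σ (u % v) :=
  ⟨(ok_md ..).2 ⟨ha.1, hb.1⟩, by rw [eval_md, ha.2, hb.2]⟩
theorem Has.cell (ha : a.Has w σ u) (h : σ.c u = v) : (cell a).Has w σ v :=
  ⟨ha.1, by rw [eval_cell, ha.2, h]⟩

theorem Tests.of_ite [Decidable P] (h : a.Has w σ (if P then 1 else 0)) : a.Tests w σ P :=
  ⟨h.1, fun hP => by rw [h.2, if_pos hP], fun hP => by rw [h.2, if_neg hP]⟩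

theorem Tests.has [Decidable P] (h : a.Tests w σ P) : a.Has w σ (if P then 1 else 0) :=
  ⟨h.1, by split_ifs with hP; exacts [h.2.1 hP, h.2.2 hP]⟩

theorem Tests.congr (h : a.Tests w σ P) (hPQ : P ↔ Q) : a.Tests w σ Q := by rwa [← hPQ]

theorem Tests.le (ha : a.Has w σ u) (hb : b.Has w σ v) : (le a b).Tests w σ (u ≤ v) :=
  .of_ite ⟨(ok_le ..).2 ⟨ha.1, hb.1⟩, by rw [eval_le, ha.2, hb.2]⟩
theorem Tests.lt (ha : a.Has w σ u) (hb : b.Has w σ v) : (lt a b).Tests w σ (u < v) :=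
  .of_ite ⟨(ok_lt ..).2 ⟨ha.1, hb.1⟩, by rw [eval_lt, ha.2, hb.2]⟩
theorem Tests.eq (ha : a.Has w σ u) (hb : b.Has w σ v) : (eq a b).Tests w σ (u = v) :=
  .of_ite ⟨(ok_eq ..).2 ⟨ha.1, hb.1⟩, by rw [eval_eq, ha.2, hb.2]⟩
theorem Tests.and (ha : a.Tests w σ P) (hb : b.Tests w σ Q) : (a * b).Tests w σ (P ∧ Q) := by
  refine ⟨⟨ha.1, hb.1⟩, fun h => ?_, fun h => ?_⟩
  · rw [eval_mul, ha.2.1 h.1, hb.2.1 h.2]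
  · rw [eval_mul]
    by_cases hP : P
    · rw [hb.2.2 fun hQ => h ⟨hP, hQ⟩, mul_zero]
    · rw [ha.2.2 hP, zero_mul]
theorem Tests.or (ha : a.Tests w σ P) (hb : b.Tests w σ Q) : (nz (a + b)).Tests w σ (P ∨ Q) := by
  refine ⟨(ok_nz ..).2 ⟨ha.1, hb.1⟩, fun h => ?_, fun h => ?_⟩
  · rw [eval_nz, eval_add, if_neg]
    rcases h with h | h
    · rw [ha.2.1 h]; omega
    · rw [hb.2.1 h]; omega
  · rw [eval_nz, eval_add, ha.2.2 fun h' => h (.inl h'), hb.2.2 fun h' => h (.inr h'), if_pos rfl]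
theorem Tests.not (ha : a.Tests w σ P) : (eqz a).Tests w σ (¬ P) := by
  refine ⟨(ok_eqz ..).2 ha.1, fun h => ?_, fun h => ?_⟩
  · rw [eval_eqz, ha.2.2 h, if_pos rfl]
  · rw [eval_eqz, ha.2.1 (not_not.1 h), if_neg one_ne_zero]
theorem Tests.imp (ha : a.Tests w σ P) (hb : b.Tests w σ Q) :
    (nz (eqz a + b)).Tests w σ (P → Q) :=
  (ha.not.or hb).congr (by tauto)

end Ex

/-! ### Set Partition by an algorithm for Set Cover -/

/-- The number of binary digits `1` of `X` below the size of the universe. -/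
def cardBitsE (X : Ex) : Ex := .sum 12 0 (bitE X 12)

/-- The guard for packings. -/
def packGuardE : Ex :=
  .lt (.con 0) (cardE 5) *
  (.eq (.sum 12 0 (bitE (.reg 7 / .reg 11) 12 * inE 5 12)) (.con 0) *
  (.nz (.le (cardBitsE (.reg 7 / .reg 11) + cardE 5) (.reg 3) + .eq (.reg 7) (.con 0)) *
  .lt (.md (.reg 7) (.reg 11) + .con 1) (.reg 11)))

variable {I : SetInstance} {k w D len : ℕ} {cd : ℕ → ℕ} {σ : St}

theorem has_cardBitsE {X : Ex} {x : ℕ} (h0 : σ.r 0 = I.n) (hw : I.n ≤ w)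
    (hX : ∀ u, X.Has w (σ.set 12 u) x) : (cardBitsE X).Has w σ (bits I.n x).card := by
  refine ⟨?_, ?_⟩
  · simp [cardBitsE, bitE, h0, hw, (hX _).1]
    intro i hi
    omega
  · simp [cardBitsE, bitE, h0, card_bits, (hX _).2]

/-- Disjointness is tested by counting common digits: a sum of products of digits vanishes exactly
if the two sets do not meet. -/
theorem packGuardE_tests (h : Ctx I k σ) (hw : I.n ≤ w) :
    packGuardE.Tests w σ (PackGuard I.n (I.m + 1) k I.nbr (σ.r 5) (σ.r 7)) := by
  have hX : ∀ u, (Ex.reg 7 / Ex.reg 11).Has w (σ.set 12 u) (σ.r 7 / (I.m + 1)) := fun u =>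
    .div (.reg (by omega) (by simp)) (.reg (by omega) (by simp [h.r11]))
  have hc : (cardE 5).Has w σ (I.nbr (σ.r 5)).card :=
    ⟨ok_cardE h.r0 hw (by omega), eval_cardE h.r0 h.inp (by omega)⟩
  have hsum : (Ex.sum 12 0 (bitE (.reg 7 / .reg 11) 12 * inE 5 12)).Has w σ
      (∑ u ∈ Finset.range I.n, σ.r 7 / (I.m + 1) / 2 ^ u % 2
        * if u ∈ I.nbr (σ.r 5) then 1 else 0) := by
    refine ⟨?_, ?_⟩
    · simp [bitE, h.r0, hw]
      intro i hi
      omega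
    · rw [Ex.eval_sum, h.r0]
      refine Finset.sum_congr rfl fun u hu => ?_
      rw [Ex.eval_mul, eval_inE (I := I) (σ := σ.set 12 u) (by simp [h.r0]) h.inp
        (by simpa using Finset.mem_range.1 hu)]
      simp [bitE, h.r11]
  refine ((Ex.Tests.lt .con hc).and ((Ex.Tests.eq hsum .con).and
    (((Ex.Tests.le ((has_cardBitsE h.r0 hw hX).add hc) (.reg (by omega) h.r3)).or
      (Ex.Tests.eq (.reg (by omega) rfl) .con)).and
      (Ex.Tests.lt ((Ex.Has.md (.reg (by omega) rfl) (.reg (by omega) h.r11)).add .con)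
        (.reg (by omega) h.r11))))).congr ?_
  refine and_congr Finset.card_pos (and_congr ?_ Iff.rfl)
  rw [Finset.sum_eq_zero_iff, Finset.disjoint_left]
  refine forall_congr' fun u => ?_
  rw [bits, Finset.mem_filter]
  by_cases h1 : u ∈ I.nbr (σ.r 5)
  · simp [h1]
  · simp [h1]

/-- The incidence matrix of the chains of packings. -/
def chainE (T : ℕ) : Ex :=
  .lett 13 (.reg 6 / .reg 21) <| .lett 14 (.md (.reg 6) (.reg 21)) <|
  .lett 15 (.md (.reg 13) (.reg 20)) <| .lett 16 (.md (.reg 13 / .reg 20) (.con T)) <|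
  .lett 17 (.cell (.con 4 * (.reg 13 / .reg 20 / .con T) + .con 1)) <|
  .lett 23 (.reg 17 / .reg 11) <|
  .lett 24 (.reg 15 + (cardBitsE (.reg 23) * (.reg 0 + .con 1) + .md (.reg 17) (.reg 11))) <|
  .lett 25 (.md (.reg 14 - .reg 0) (.reg 22)) <| .lett 26 ((.reg 14 - .reg 0) / .reg 22) <|
  .lett 27 (.reg 25 / .con 2) <|
    .lt (.reg 24) (.reg 20) *
    (.nz (.eqz (.eq (.reg 16) (.con 0)) + .eq (.reg 15) (.con 0)) *
    .nz (.eqz (.eq (.reg 16 + .con 1) (.con T)) +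
      .eq (.reg 24 / (.reg 0 + .con 1)) (.reg 0) *
      (.le (.reg 2) (.md (.reg 24) (.reg 0 + .con 1) + .reg 18) *
      .le (.md (.reg 24) (.reg 0 + .con 1)) (.reg 2)))) *
    .nz (.lt (.reg 14) (.reg 0) * .eq (bitE (.reg 23) 14) (.con 1) +
      .le (.reg 0) (.reg 14) * .nz (.eq (.reg 25) (.con 2 * .reg 19) * .eq (.reg 26) (.reg 16) +
        .eqz (.eq (.reg 25) (.con 2 * .reg 19)) *
        .nz (.eq (.reg 26) (.reg 16) * .nz (.eq (.reg 16 + .con 1) (.con T) +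
            .eqz (.eq (.md (.reg 25) (.con 2)) (bitE (.reg 24) 27))) +
          .eq (.reg 26 + .con 1) (.reg 16) * .eq (.md (.reg 25) (.con 2)) (bitE (.reg 15) 27))))

/-- The registers and cells that the matrix of chains depends on. -/
structure ChainCtx (I : SetInstance) (T len : ℕ) (cd : ℕ → ℕ) (σ : St) : Prop where
  r0 : σ.r 0 = I.n
  r2 : σ.r 2 = I.s
  r4 : σ.r 4 = 0
  r10 : σ.r 10 = len
  r11 : σ.r 11 = I.m + 1
  r18 : σ.r 18 = emptyCount I.m I.nbr
  r19 : σ.r 19 = 2 * Nat.size I.n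
  r20 : σ.r 20 = 2 ^ (2 * Nat.size I.n)
  r21 : σ.r 21 = I.n + T * (2 * (2 * Nat.size I.n) + 1)
  r22 : σ.r 22 = 2 * (2 * Nat.size I.n) + 1
  list : ∀ i, σ.c (4 * i + 1) = cd i

theorem ChainCtx.set {T : ℕ} (h : ChainCtx I T len cd σ) {x v : ℕ} (hx : x = 5 ∨ x = 6) :
    ChainCtx I T len cd (σ.set x v) := by
  refine ⟨?_, ?_, ?_, ?_, ?_, ?_, ?_, ?_, ?_, ?_, h.list⟩ <;> rw [St.set_r, if_neg (by omega)]
  exacts [h.r0, h.r2, h.r4, h.r10, h.r11, h.r18, h.r19, h.r20, h.r21, h.r22]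

theorem ChainCtx.put {T : ℕ} (h : ChainCtx I T len cd σ) (a v : ℕ) :
    ChainCtx I T len cd (σ.put (4 * a + 3) v) :=
  ⟨h.r0, h.r2, h.r4, h.r10, h.r11, h.r18, h.r19, h.r20, h.r21, h.r22,
    fun b => by rw [St.put_c, if_neg (by omega), h.list]⟩

/-- The arithmetic mirrors `ChainValid` and `ChainMark` clause by clause. The bound on w is needed
because element numbers and digit positions occur as exponents of two. -/
theorem has_chainE {T : ℕ} (h : ChainCtx I T len cd σ) (hw : I.n + T * (4 * I.n + 1) ≤ w)
    (hT : 0 < T) :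
    (chainE T).Has w σ (if σ.r 6 % (I.n + T * (2 * (2 * Nat.size I.n) + 1)) ∈
      chainRow I.n (I.m + 1) T (2 * Nat.size I.n) I.s (emptyCount I.m I.nbr) cd
        (σ.r 6 / (I.n + T * (2 * (2 * Nat.size I.n) + 1))) then 1 else 0) := by
  have hsz := natSize_le_self I.n
  set B := 2 * Nat.size I.n with hB
  set N := I.n + T * (2 * B + 1) with hN
  have h19 : σ.r 19 = B := h.r19
  have h20 : σ.r 20 = 2 ^ B := h.r20
  have h21 : σ.r 21 = N := h.r21
  have h22 : σ.r 22 = 2 * B + 1 := h.r22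
  have hNpos : 0 < N := by
    have : 0 < T * (2 * B + 1) := by positivity
    omega
  have hNw : N ≤ w := by
    have : T * (2 * B + 1) ≤ T * (4 * I.n + 1) := Nat.mul_le_mul_left _ (by omega)
    omega
  set ρ := σ.r 6 / N with hρ
  set a := σ.r 6 % N with ha
  have haN : a < N := Nat.mod_lt _ hNpos
  set p := ρ % 2 ^ B with hp
  set i := ρ / 2 ^ B % T with hi
  set c := cd (ρ / 2 ^ B / T) with hc
  set X := c / (I.m + 1) with hX
  set out := p + weight I.n (I.m + 1) c with hout
  refine .lett (by omega) (u := ρ) (.div (.reg (by omega) rfl) (.reg (by omega) h21)) ?_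
  refine .lett (by omega) (u := a) (.md (.reg (by omega) (by simp))
    (.reg (by omega) (by simp [h21]))) ?_
  refine .lett (by omega) (u := p) (.md (.reg (by omega) (by simp))
    (.reg (by omega) (by simp [h20]))) ?_
  refine .lett (by omega) (u := i) (.md (.div (.reg (by omega) (by simp))
    (.reg (by omega) (by simp [h20]))) .con) ?_
  refine .lett (by omega) (u := c) (.cell (.add (.mul .con (.div (.div
    (.reg (by omega) (by simp)) (.reg (by omega) (by simp [h20]))) .con)) .con)
    (h.list _)) ?_
  refine .lett (by omega) (u := X) (.div (.reg (by omega) (by simp))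
    (.reg (by omega) (by simp [h.r11]))) ?_
  refine .lett (by omega) (u := out) (.add (.reg (by omega) (by simp))
    (.add (.mul (has_cardBitsE (I := I) (x := X) (by simp [h.r0]) (by omega) fun u =>
      .reg (by omega) (by simp)) (.add (.reg (by omega) (by simp [h.r0])) .con))
      (.md (.reg (by omega) (by simp)) (.reg (by omega) (by simp [h.r11]))))) ?_
  refine .lett (by omega) (u := (a - I.n) % (2 * B + 1)) (.md (.sub
    (.reg (by omega) (by simp)) (.reg (by omega) (by simp [h.r0])))
    (.reg (by omega) (by simp [h22]))) ?_
  refine .lett (by omega) (u := (a - I.n) / (2 * B + 1)) (.div (.sub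
    (.reg (by omega) (by simp)) (.reg (by omega) (by simp [h.r0])))
    (.reg (by omega) (by simp [h22]))) ?_
  refine .lett (by omega) (u := (a - I.n) % (2 * B + 1) / 2)
    (.div (.reg (by omega) (by simp)) .con) ?_
  set y := (a - I.n) % (2 * B + 1) with hy
  set d := (a - I.n) / (2 * B + 1) with hd
  have hyB : y < 2 * B + 1 := Nat.mod_lt _ (by omega)
  generalize hσ' : (((((((((σ.set 13 ρ).set 14 a).set 15 p).set 16 i).set 17 c).set 23 X).set 24
    out).set 25 y).set 26 d).set 27 (y / 2) = σ'
  have r0 : (Ex.reg 0).Has w σ' I.n := .reg (by omega) (by simp [← hσ', h.r0])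
  have r2 : (Ex.reg 2).Has w σ' I.s := .reg (by omega) (by simp [← hσ', h.r2])
  have r14 : (Ex.reg 14).Has w σ' a := .reg (by omega) (by simp [← hσ'])
  have r15 : (Ex.reg 15).Has w σ' p := .reg (by omega) (by simp [← hσ'])
  have r16 : (Ex.reg 16).Has w σ' i := .reg (by omega) (by simp [← hσ'])
  have r18 : (Ex.reg 18).Has w σ' (emptyCount I.m I.nbr) :=
    .reg (by omega) (by simp [← hσ', h.r18])
  have r19 : (Ex.reg 19).Has w σ' B := .reg (by omega) (by simp [← hσ', h19])
  have r20 : (Ex.reg 20).Has w σ' (2 ^ B) := .reg (by omega) (by simp [← hσ', h20])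
  have r23 : (Ex.reg 23).Has w σ' X := .reg (by omega) (by simp [← hσ'])
  have r24 : (Ex.reg 24).Has w σ' out := .reg (by omega) (by simp [← hσ'])
  have r25 : (Ex.reg 25).Has w σ' y := .reg (by omega) (by simp [← hσ'])
  have r26 : (Ex.reg 26).Has w σ' d := .reg (by omega) (by simp [← hσ'])
  have bit14 : ∀ {e : Ex} {v : ℕ}, e.Has w σ' v → (bitE e 14).Has w σ' (v / 2 ^ a % 2) :=
    fun he => .md (.div he ⟨⟨by omega, by simp [← hσ']; omega⟩, by simp [← hσ']⟩) .con
  have bit27 : ∀ {e : Ex} {v : ℕ}, e.Has w σ' v → (bitE e 27).Has w σ' (v / 2 ^ (y / 2) % 2) :=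
    fun he => .md (.div he ⟨⟨by omega, by
      simp [← hσ']
      have : 2 * B + 1 ≤ T * (2 * B + 1) := Nat.le_mul_of_pos_left _ hT
      omega⟩, by simp [← hσ']⟩) .con
  have n1 := r0.add (Ex.Has.con (v := 1))
  have c0 : (Ex.con 0).Has w σ' 0 := .con
  have cT : (Ex.con T).Has w σ' T := .con
  have c1 : (Ex.con 1).Has w σ' 1 := .con
  have valid := (Ex.Tests.lt r24 r20).and (((Ex.Tests.eq r16 c0).imp (Ex.Tests.eq r15 c0)).and
    ((Ex.Tests.eq (r16.add c1) cT).imp ((Ex.Tests.eq (r24.div n1) r0).and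
      ((Ex.Tests.le r2 ((r24.md n1).add r18)).and (Ex.Tests.le (r24.md n1) r2)))))
  have cmp := fun {e : Ex} {v : ℕ} (he : e.Has w σ' v) =>
    Ex.Tests.eq (r25.md (Ex.Has.con (v := 2))) (bit27 he)
  have special := Ex.Tests.eq r25 ((Ex.Has.con (v := 2)).mul r19)
  have mark := ((Ex.Tests.lt r14 r0).and (Ex.Tests.eq (bit14 r23) c1)).or
    ((Ex.Tests.le r0 r14).and ((special.and (Ex.Tests.eq r26 r16)).or (special.not.and
      (((Ex.Tests.eq r26 r16).and ((Ex.Tests.eq (r16.add c1) cT).or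
        (cmp r24).not)).or ((Ex.Tests.eq (r26.add c1) r16).and (cmp r15))))))
  refine ((valid.and mark).congr ?_).has
  rw [chainRow, Finset.mem_filter]
  exact ⟨fun h => ⟨Finset.mem_range.2 haN, h⟩, fun h => h.2⟩

end RAM

/-! ### The program of the reduction from Set Partition -/

namespace RAM

open RAMProg Function SetCode

/-- The number of empty members of the family. -/
def emptyCountE : Ex := .sum 13 1 (.eq (cardE 13) (.con 0))

/-- The reduction from Set Partition to Set Cover, with the threshold `n / D` and `T` positions. -/
def partCmd (D T : ℕ) : Cmd :=
  .seq (startCmd D) <| .seq (passCmd packGuardE joinE) <|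
  .seq (.asg 18 emptyCountE) <|
  .seq (.asg 19 (.con 2 * .sum 12 0 (.le (.pow2 12) (.reg 0)))) <|
  .seq (.asg 20 (.pow2 19)) <| .seq (.asg 22 (.con 2 * .reg 19 + .con 1)) <|
  .seq (.asg 21 (.reg 0 + .con T * .reg 22)) <| .seq (.asg 10 (.reg 4)) <|
  .seq (.asg 4 (.con 0)) <|
    writeCmd (.reg 21) (.reg 10 * .con T * .reg 20) (.con T) (chainE T)

/-- The height does not depend on T, but T is a variable, so the height is first rewritten to closed
numerals. -/
theorem ht_chainE (T : ℕ) : (chainE T).ht ≤ 60 := by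
  have hadd : ∀ a b : Ex, (a + b).ht = max a.ht (b.ht + 1) := fun _ _ => rfl
  have hsub : ∀ a b : Ex, (a - b).ht = max a.ht (b.ht + 1) := fun _ _ => rfl
  have hmul : ∀ a b : Ex, (a * b).ht = max a.ht (b.ht + 1) := fun _ _ => rfl
  have hdiv : ∀ a b : Ex, (a / b).ht = max a.ht (b.ht + 1) := fun _ _ => rfl
  have hcon : ∀ c, (Ex.con c).ht = 1 := fun _ => rfl
  have hreg : ∀ x, (Ex.reg x).ht = 1 := fun _ => rfl
  have hcell : ∀ a, (Ex.cell a).ht = max a.ht 2 := fun _ => rfl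
  have hsum : ∀ x y e, (Ex.sum x y e).ht = max (e.ht + 3) 4 := fun _ _ _ => rfl
  have hpow : ∀ x, (Ex.pow2 x).ht = 3 := fun _ => rfl
  have hlett : ∀ x a e, (Ex.lett x a e).ht = max (a.ht + 1) (e.ht + 2) := fun _ _ _ => rfl
  simp only [chainE, cardBitsE, bitE, Ex.md, Ex.nz, Ex.eqz, Ex.le, Ex.lt, Ex.eq, hadd, hsub, hmul,
    hdiv, hcon, hreg, hcell, hsum, hpow, hlett]
  decide

/-- The number of elements of the instance of Set Cover. -/
def chainSize (n T : ℕ) : ℕ := n + T * (2 * (2 * Nat.size n) + 1)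

/-- A bound for the number of packings. -/
def packBound (n m k : ℕ) : ℕ := (smallSets n k + m) * (m + 1)

/-- The number of members of the family of chains for `Λ` packings. -/
def chainCount (n T Λ : ℕ) : ℕ := Λ * T * 2 ^ (2 * Nat.size n)

/-- The number of steps of the reduction from Set Partition. -/
def partTime (n m k T : ℕ) : ℕ := 4 + (passTime m (packBound n m k) +
  (2 * (chainCount n T (packBound n m k) * chainSize n T) + 5 + 7))

variable {I : SetInstance} {k w D T len : ℕ} {cd : ℕ → ℕ} {σ : St}

theorem has_emptyCountE (h : Ctx I k σ) (hw : I.size ≤ w) :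
    emptyCountE.Has w σ (emptyCount I.m I.nbr) := by
  have hn := I.n_lt_size
  have hm := I.m_lt_size
  have key : ∀ f, (Ex.eq (cardE 13) (.con 0)).Has w (σ.set 13 f)
      (if I.nbr f = ∅ then 1 else 0) := fun f => by
    have h' := h.set (x := 13) (v := f) (by omega)
    refine ((Ex.Tests.eq ⟨ok_cardE h'.r0 (by omega) (by omega),
      eval_cardE h'.r0 h'.inp (by omega)⟩ .con).congr ?_).has
    simp
  refine ⟨⟨by omega, by omega, by omega, by rw [h.r1]; omega, fun f _ => (key f).1⟩, ?_⟩
  rw [emptyCountE, Ex.eval_sum, h.r1, emptyCount, Finset.card_filter]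
  exact Finset.sum_congr rfl fun f _ => (key f).2

/-- The binary length of n is the number of exponents i with 2^i ≤ n, and all of these are below n.
-/
theorem has_natSize (h : Ctx I k σ) (hw : I.size ≤ w) :
    (Ex.con 2 * .sum 12 0 (.le (.pow2 12) (.reg 0))).Has w σ (2 * Nat.size I.n) := by
  have hn := I.n_lt_size
  refine .mul .con ⟨?_, ?_⟩
  · simp [h.r0]
    refine ⟨by omega, fun i hi => by omega⟩
  · simp only [Ex.eval_sum, Ex.eval_le, Ex.eval_pow2, Ex.eval_reg, h.r0, St.set_r, reduceIte,
      show (0 : ℕ) ≠ 12 by omega, ← Nat.lt_size]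
    rw [← Finset.card_filter]
    have : (Finset.range I.n).filter (fun i => i < Nat.size I.n)
        = Finset.range (Nat.size I.n) := by
      ext i
      have := natSize_le_self I.n
      simp only [Finset.mem_filter, Finset.mem_range]
      omega
    rw [this, Finset.card_range]

theorem smallSets_le (n k : ℕ) : smallSets n k ≤ 2 ^ n :=
  (Finset.card_filter_le _ _).trans_eq (by rw [Finset.card_powerset, Finset.card_range])

theorem packBound_le (I : SetInstance) (k : ℕ) :
    packBound I.n I.m k ≤ 2 * (2 ^ I.size * 2 ^ I.size) := by
  have hn := I.n_lt_size
  have hm := I.m_lt_size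
  have hZ : I.size < 2 ^ I.size := Nat.lt_two_pow_self
  have h1 : smallSets I.n k ≤ 2 ^ I.size :=
    (smallSets_le _ _).trans (Nat.pow_le_pow_right two_pos hn.le)
  calc packBound I.n I.m k ≤ (2 ^ I.size + 2 ^ I.size) * 2 ^ I.size :=
        Nat.mul_le_mul (by omega) (by omega)
    _ = _ := by ring

theorem chainSize_le (n T : ℕ) : chainSize n T ≤ n + T * (4 * n + 1) := by
  have := natSize_le_self n
  exact Nat.add_le_add_left (Nat.mul_le_mul_left _ (by omega)) _

/-- The number of matrix entries is the bound of the writing loop and must fit into a register. This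
fixes the word length (300 + 10 T) · size. -/
theorem chain_lt (I : SetInstance) (k : ℕ) (hT : 0 < T) :
    chainCount I.n T (packBound I.n I.m k) * chainSize I.n T < 2 ^ ((300 + 10 * T) * I.size) := by
  have hn := I.n_lt_size
  have hb := packBound_le I k
  have hZ : I.size < 2 ^ I.size := Nat.lt_two_pow_self
  have hY : T < 2 ^ T := Nat.lt_two_pow_self
  have hs := natSize_le_self I.n
  have hP : 2 ^ (2 * Nat.size I.n) ≤ 2 ^ I.size * 2 ^ I.size := by
    rw [← pow_add]; exact Nat.pow_le_pow_right two_pos (by omega)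
  have hN := chainSize_le I.n T
  have hexp : 10 * I.size + 3 * T ≤ (300 + 10 * T) * I.size := by
    have : T * 1 ≤ T * I.size := Nat.mul_le_mul_left _ (by omega)
    have e : (300 + 10 * T) * I.size = 300 * I.size + 10 * (T * I.size) := by ring
    omega
  refine lt_of_lt_of_le ?_ (Nat.pow_le_pow_right two_pos hexp)
  rw [pow_add, mul_comm 10, mul_comm 3, pow_mul, pow_mul]
  set Z := 2 ^ I.size
  set Y := 2 ^ T
  have hN' : chainSize I.n T ≤ 6 * (Y * Z) := by
    have h1 : T * (4 * I.n + 1) ≤ Y * (5 * Z) := Nat.mul_le_mul hY.le (by omega)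
    have h2 : Z ≤ Y * Z := Nat.le_mul_of_pos_left _ (by omega)
    have e : Y * (5 * Z) = 5 * (Y * Z) := by ring
    omega
  have hZ2 : 2 ≤ Z := by omega
  have hY2 : 2 ≤ Y := by omega
  have h16 : 2 ^ 5 ≤ Z ^ 5 := Nat.pow_le_pow_left hZ2 5
  have h0 : 0 < Z ^ 5 * Y ^ 3 := Nat.mul_pos (by positivity) (Nat.pow_pos (by omega))
  calc chainCount I.n T (packBound I.n I.m k) * chainSize I.n T
      ≤ 2 * (Z * Z) * Y * (Z * Z) * (6 * (Y * Z)) := by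
        refine Nat.mul_le_mul (Nat.mul_le_mul (Nat.mul_le_mul hb hY.le) hP) hN'
    _ = 12 * (Z ^ 5 * Y ^ 2) := by ring
    _ ≤ 12 * (Z ^ 5 * Y ^ 3) := by gcongr <;> omega
    _ < 32 * (Z ^ 5 * Y ^ 3) := by omega
    _ ≤ Z ^ 5 * (Z ^ 5 * Y ^ 3) := Nat.mul_le_mul_right _ (by omega)
    _ = Z ^ 10 * Y ^ 3 := by ring

theorem tr_packPass (hw : 300 * I.size ≤ w) (hσ : Ctx I k σ) (hst : Stored {0} σ) :
    Tr w (passCmd packGuardE joinE) σ (fun σ' => Ctx I k σ' ∧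
      Stored (packings I.n (I.m + 1) k I.nbr I.m) σ') (passTime I.m (packBound I.n I.m k)) := by
  have hn := I.n_lt_size
  have hm := I.m_lt_size
  have hZ : I.size < 2 ^ I.size := Nat.lt_two_pow_self
  have hnZ : 2 ^ I.n ≤ 2 ^ I.size := Nat.pow_le_pow_right two_pos hn.le
  have hc : 2 ^ I.n * (I.m + 1) ≤ 2 ^ I.size * 2 ^ I.size := Nat.mul_le_mul hnZ (by omega)
  have hZw : 2 * (2 ^ I.size * 2 ^ I.size) < 2 ^ w := by
    rw [← pow_add, ← pow_succ']
    exact Nat.pow_lt_pow_right (by omega) (by omega)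
  refine tr_passCmd (Λ := packBound I.n I.m k) (Gp := PackGuard I.n (I.m + 1) k I.nbr)
    (nw := fun f => joinCode I.n (I.m + 1) (I.nbr f)) (by decide) (by decide)
    (fun σ f c h h5 _ h7 => ?_)
    (card_packings_le I.nbr_subset) ((packBound_le I k).trans_lt hZw) (fun c hc' => ?_)
    (fun f hf c _ => ?_) hσ hst
  · have h1 := (packGuardE_tests h (w := w) (by omega)).has
    rw [h5, h7] at h1
    exact ⟨h1.1, ok_joinE h (by omega), h1.2, by rw [eval_joinE h, h5, h7]⟩
  · obtain ⟨S, -, hS, -, rfl⟩ := packings_sound I.nbr_subset c hc' (Nat.succ_pos _)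
    exact (code_lt _ hS).trans (by omega)
  · exact (joinCode_lt (by omega) _ _).trans_lt (by omega)

/-- Register 4 holds the list length during the dynamic program but is read as a verdict at the end.
The length therefore moves to register 10 and register 4 is cleared, so that only the answer of the
call counts. -/
theorem tr_partCmd (hT : 0 < T) (hσ : Loaded I σ) :
    Tr ((300 + 10 * T) * I.size) (partCmd D T) σ (fun σ' => ∃ (len : ℕ) (cd : ℕ → ℕ),
      len ≤ packBound I.n I.m (I.n / D) ∧
      (Finset.range len).image cd = packings I.n (I.m + 1) (I.n / D) I.nbr I.m ∧
      (∀ b, σ'.c (4 * b + 3) = (SetInstance.ofSets (chainSize I.n T) (chainCount I.n T len) T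
        (chainRow I.n (I.m + 1) T (2 * Nat.size I.n) I.s (emptyCount I.m I.nbr) cd)).toMem b) ∧
      σ'.r 4 = 0) (partTime I.n I.m (I.n / D) T) := by
  have hn := I.n_lt_size
  have hm := I.m_lt_size
  have hs := natSize_le_self I.n
  have hlt : (300 + 10 * T) * I.size < 2 ^ ((300 + 10 * T) * I.size) := Nat.lt_two_pow_self
  have hN := chainSize_le I.n T
  have hchain := chain_lt I (I.n / D) hT
  have hTs : T ≤ T * I.size := Nat.le_mul_of_pos_right _ (by omega)
  have hNw : I.n + T * (4 * I.n + 1) ≤ (300 + 10 * T) * I.size := by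
    have h1 : T * (4 * I.n + 1) ≤ T * (4 * I.size) := Nat.mul_le_mul_left _ (by omega)
    have e : (300 + 10 * T) * I.size = 300 * I.size + 10 * (T * I.size) := by ring
    have e2 : T * (4 * I.size) = 4 * (T * I.size) := by ring
    omega
  have hw : 300 * I.size + T ≤ (300 + 10 * T) * I.size := by
    have e : (300 + 10 * T) * I.size = 300 * I.size + 10 * (T * I.size) := by ring
    omega
  have hcount : ∀ len ≤ packBound I.n I.m (I.n / D),
      chainCount I.n T len ≤ chainCount I.n T (packBound I.n I.m (I.n / D)) := fun len h =>
    Nat.mul_le_mul_right _ (Nat.mul_le_mul_right _ h)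
  have hbound := packBound_le I (I.n / D)
  have hZw : 2 * (2 ^ I.size * 2 ^ I.size) < 2 ^ ((300 + 10 * T) * I.size) := by
    rw [← pow_add, ← pow_succ']
    exact Nat.pow_lt_pow_right (by omega) (by omega)
  set k := I.n / D
  set w := (300 + 10 * T) * I.size
  refine Tr.seq ((tr_startCmd (D := D) (by omega) hσ).conseq (fun σ ⟨hσ, hst⟩ => ?_) le_rfl)
  refine Tr.seq ((tr_packPass (by omega) hσ hst).conseq (fun σ ⟨hσ, hst⟩ => ?_) le_rfl)
  have hlen : σ.r 4 ≤ packBound I.n I.m k := by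
    rw [hst.len]
    exact card_packings_le I.nbr_subset
  set len := σ.r 4 with hlen'
  set W := 2 * (chainCount I.n T (packBound I.n I.m k) * chainSize I.n T) + 5 with hW
  have he := has_emptyCountE hσ (w := w) (by omega)
  have hem : emptyCount I.m I.nbr ≤ I.m :=
    (Finset.card_filter_le _ _).trans_eq (Finset.card_range _)
  refine Tr.asg_seq (T := W + 6) (by omega) he.1 (by decide) (by rw [he.2]; omega) ?_
  rw [he.2]
  have hb := has_natSize (hσ.set (x := 18) (v := emptyCount I.m I.nbr) (by omega)) (w := w)
    (by omega)
  refine Tr.asg_seq (T := W + 5) (by omega) hb.1 (by decide) (by rw [hb.2]; omega) ?_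
  rw [hb.2]
  refine Tr.asg_seq (T := W + 4) (by omega) (by simp; omega) (by decide) ?_ ?_
  · simp only [Ex.eval_pow2, St.set_r, if_true]
    exact Nat.pow_lt_pow_right (by omega) (by omega)
  have hbT : T * (2 * (2 * Nat.size I.n) + 1) ≤ T * (4 * I.n + 1) :=
    Nat.mul_le_mul_left _ (by omega)
  refine Tr.asg_seq (T := W + 3) (by omega) (by simp) (by decide) (by simp; omega) ?_
  refine Tr.asg_seq (T := W + 2) (by omega) (by simp) (Nat.le_of_ble_eq_true rfl)
    (by simp [hσ.r0]; omega) ?_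
  refine Tr.asg_seq (T := W + 1) (by omega) (by simp) (by decide) (by simp; omega) ?_
  refine Tr.asg_seq (T := W) (by omega) (by simp) (by decide) (by simp) ?_
  refine (tr_writeCmd (w := w) (n := chainSize I.n T) (m := chainCount I.n T len) (s := T)
    (E := chainRow I.n (I.m + 1) T (2 * Nat.size I.n) I.s (emptyCount I.m I.nbr)
      fun i => σ.c (4 * i + 1))
    (P := ChainCtx I T len fun i => σ.c (4 * i + 1)) (by decide)
    (Nat.le_of_ble_eq_true rfl) (Nat.le_of_ble_eq_true rfl) (ht_chainE T)
    (fun σ x v h hx => h.set hx) (fun σ a v h => h.put a v) ?_ ?_ (by omega) (by omega) ?_ ?_ ?_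
    ?_ ?_).conseq (fun σ' ⟨h1, h2⟩ => ⟨len, _, hlen, ?_, h2, h1.r4⟩) ?_
  · intro σ' h
    refine ⟨by simp, h.r21, ?_, rfl⟩
    simp [h.r10, h.r20, chainCount]
  · intro σ' a h ha h6
    have := has_chainE h hNw hT
    rw [h6] at this
    exact this
  · have h1 := Nat.le_mul_of_pos_right (chainCount I.n T (packBound I.n I.m k))
      (show 0 < chainSize I.n T from Nat.add_pos_right _ (by positivity))
    have h2 := hcount len hlen
    omega
  · omega
  · exact (Nat.mul_le_mul_right _ (hcount len hlen)).trans_lt hchain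
  · refine ⟨?_, ?_, ?_, ?_, ?_, ?_, ?_, ?_, ?_, ?_, fun i => ?_⟩ <;>
      simp [hσ.r0, hσ.r2, hσ.r11, ← hlen']
  · exact fun a => by simp [hσ.orc]
  · have := hst.list
    rwa [← hst.len] at this
  · have := Nat.mul_le_mul_right (chainSize I.n T) (hcount len hlen)
    omega

end RAM

/-! ### Running time of the reduction from Set Partition -/

namespace RAM

open RAMProg Function SetCode

/-- In the expansion of (1 + x)^n over all subsets, a set with at most k elements contributes at
least x^k because x ≤ 1. -/
theorem smallSets_mul_pow_le (n k : ℕ) {x : ℝ} (hx : 0 < x) (hx1 : x ≤ 1) :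
    (smallSets n k : ℝ) * x ^ k ≤ (1 + x) ^ n := by
  have h := Finset.sum_pow_mul_eq_add_pow x 1 (Finset.range n)
  rw [Finset.card_range, add_comm] at h
  rw [← h, smallSets, ← nsmul_eq_mul]
  refine (Finset.card_nsmul_le_sum _ (fun X : Finset ℕ => x ^ X.card * 1 ^ (n - X.card)) _
    fun X hX => ?_).trans
    (Finset.sum_le_sum_of_subset_of_nonneg (Finset.filter_subset _ _) fun X _ _ => by positivity)
  rw [one_pow, mul_one]
  exact pow_le_pow_of_le_one hx.le hx1 (Finset.mem_filter.1 hX).2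

/-- The count is at most (1 + x)^n x^(-n/D). First x is taken so small that 1 + x ≤ 2^(η/2), then D
so large that the second factor is at most 2^(ηn/2) too. -/
theorem exists_smallSets_le {η : ℝ} (hη : 0 < η) :
    ∃ D : ℕ, 0 < D ∧ ∀ n : ℕ, (smallSets n (n / D) : ℝ) ≤ 2 ^ (η * n) := by
  set x : ℝ := min 1 ((2 : ℝ) ^ (η / 2) - 1) with hx
  have h1 : (1 : ℝ) < 2 ^ (η / 2) := Real.one_lt_rpow (by norm_num) (by positivity)
  have hx0 : 0 < x := lt_min one_pos (by linarith)
  have hx1 : x ≤ 1 := min_le_left _ _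
  have hx2 : 1 + x ≤ 2 ^ (η / 2) := by linarith [min_le_right 1 ((2 : ℝ) ^ (η / 2) - 1)]
  set b : ℝ := Real.logb 2 x⁻¹ with hb
  have hxb : x⁻¹ = 2 ^ b := (Real.rpow_logb (by norm_num) (by norm_num) (by positivity)).symm
  have hb0 : 0 ≤ b := Real.logb_nonneg (by norm_num) ((one_le_inv₀ hx0).2 hx1)
  obtain ⟨D, hD⟩ := exists_nat_gt (2 * b / η)
  have hD0 : (0 : ℝ) < D := lt_of_le_of_lt (by positivity) hD
  refine ⟨D, by exact_mod_cast hD0, fun n => ?_⟩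
  have h2 := smallSets_mul_pow_le n (n / D) hx0 hx1
  have h3 : (smallSets n (n / D) : ℝ) ≤ (1 + x) ^ n * x⁻¹ ^ (n / D) := by
    rw [inv_pow, ← div_eq_mul_inv, le_div_iff₀ (by positivity)]
    exact h2
  have h4 : (1 + x) ^ n ≤ (2 : ℝ) ^ (η / 2 * n) := by
    rw [Real.rpow_mul two_pos.le, Real.rpow_natCast]
    exact pow_le_pow_left₀ (by positivity) hx2 n
  have h5 : x⁻¹ ^ (n / D) ≤ (2 : ℝ) ^ (η / 2 * n) := by
    rw [hxb, ← Real.rpow_natCast, ← Real.rpow_mul two_pos.le]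
    refine Real.rpow_le_rpow_of_exponent_le (by norm_num) ?_
    have h6 : b ≤ η / 2 * D := by
      rw [div_lt_iff₀ hη] at hD
      linarith
    have h7 : (D : ℝ) * ((n / D : ℕ) : ℝ) ≤ n := by exact_mod_cast Nat.mul_div_le n D
    calc b * ((n / D : ℕ) : ℝ) ≤ η / 2 * D * ((n / D : ℕ) : ℝ) := by gcongr
      _ = η / 2 * (D * ((n / D : ℕ) : ℝ)) := by ring
      _ ≤ η / 2 * n := by gcongr
  calc (smallSets n (n / D) : ℝ) ≤ (1 + x) ^ n * x⁻¹ ^ (n / D) := h3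
    _ ≤ 2 ^ (η / 2 * n) * 2 ^ (η / 2 * n) := by gcongr
    _ = 2 ^ (η * n) := by rw [← Real.rpow_add two_pos]; ring_nf

/-- The reason why logarithmically many additional elements are affordable: two to the power of c
binary lengths of n is polynomial in n. -/
theorem two_pow_mul_size_le (c n : ℕ) : 2 ^ (c * Nat.size n) ≤ (2 * n + 1) ^ c := by
  rw [mul_comm, pow_mul]
  refine Nat.pow_le_pow_left ?_ c
  rcases Nat.eq_zero_or_pos (Nat.size n) with h | h
  · simp [h]
  · obtain ⟨t, ht⟩ : ∃ t, Nat.size n = t + 1 := ⟨Nat.size n - 1, by omega⟩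
    have : 2 ^ t ≤ n := Nat.lt_size.1 (by omega)
    rw [ht, pow_succ]
    omega

theorem OStar.natAdd {δ : ℝ} {f g : SetInstance → ℕ} (hf : OStar δ fun I => (f I : ℝ))
    (hg : OStar δ fun I => (g I : ℝ)) : OStar δ fun I => ((f I + g I : ℕ) : ℝ) :=
  (hf.add hg).mono le_rfl fun _ => (Nat.cast_add _ _).le

theorem OStar.natMul {δ : ℝ} {f g : SetInstance → ℕ} (hf : OStar δ fun I => (f I : ℝ))
    (hg : OStar 0 fun I => (g I : ℝ)) : OStar δ fun I => ((f I * g I : ℕ) : ℝ) :=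
  (hf.mul hg fun _ => Nat.cast_nonneg _).mono (add_zero δ).le fun _ => (Nat.cast_mul _ _).le

theorem OStar.of_nat_poly {f : SetInstance → ℕ} (k : ℕ) (hf : ∀ I, f I ≤ (I.size + 2) ^ k) :
    OStar 0 fun I => (f I : ℝ) :=
  OStar.of_nat (e := fun _ => 0) k (fun I => by simpa using hf I) fun I => by simp

theorem ostar_n : OStar 0 fun I => (I.n : ℝ) :=
  .of_nat_poly 1 fun I => by have := I.n_lt_size; rw [pow_one]; omega

theorem ostar_m : OStar 0 fun I => (I.m : ℝ) :=
  .of_nat_poly 1 fun I => by have := I.m_lt_size; rw [pow_one]; omega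

theorem ostar_two_pow_size (c : ℕ) : OStar 0 fun I => ((2 ^ (c * Nat.size I.n) : ℕ) : ℝ) :=
  .of_nat_poly (2 * c) fun I => (two_pow_mul_size_le c I.n).trans (by
    have := I.n_lt_size
    rw [pow_mul]
    refine Nat.pow_le_pow_left ?_ c
    nlinarith)

theorem ostar_natConst (c : ℕ) : OStar 0 fun _ => (c : ℝ) := .const c

theorem ostar_chainSize (T : ℕ) : OStar 0 fun I => (chainSize I.n T : ℝ) :=
  (ostar_n.natAdd ((ostar_natConst T).natMul
    (((ostar_natConst 4).natMul ostar_n).natAdd (ostar_natConst 1)))).mono le_rfl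
    fun I => Nat.cast_le.2 (chainSize_le I.n T)

theorem ostar_packBound {η : ℝ} (hη : 0 ≤ η) {k : SetInstance → ℕ}
    (h : OStar η fun I => (smallSets I.n (k I) : ℝ)) :
    OStar η fun I => (packBound I.n I.m (k I) : ℝ) :=
  (h.natAdd (ostar_m.mono hη fun _ => le_rfl)).natMul (ostar_m.natAdd (ostar_natConst 1))

theorem ostar_chainCount {η : ℝ} (hη : 0 ≤ η) {k : SetInstance → ℕ}
    (h : OStar η fun I => (smallSets I.n (k I) : ℝ)) (T : ℕ) :
    OStar η fun I => (chainCount I.n T (packBound I.n I.m (k I)) : ℝ) :=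
  ((ostar_packBound hη h).natMul (ostar_natConst T)).natMul (ostar_two_pow_size 2)

theorem ostar_partTime {η : ℝ} (hη : 0 ≤ η) {k : SetInstance → ℕ}
    (h : OStar η fun I => (smallSets I.n (k I) : ℝ)) (T : ℕ) :
    OStar η fun I => (partTime I.n I.m (k I) T : ℝ) := by
  have c : ∀ c : ℕ, OStar η fun _ => (c : ℝ) := fun c =>
    (ostar_natConst c).mono hη fun _ => le_rfl
  have h1 := (((((ostar_packBound hη h).natMul (ostar_natConst 7)).natAdd (c 3)).natMul
    ostar_m).natAdd (c 1))
  have h2 := (((ostar_chainCount hη h T).natMul (ostar_chainSize T)).natMul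
    (ostar_natConst 2)).natAdd (c 12)
  refine ((c 4).natAdd (h1.natAdd h2)).mono le_rfl fun I => Nat.cast_le.2 (le_of_eq ?_)
  rw [partTime, passTime]
  ring

/-- On the additional elements the factor 1 - ε is replaced by 1, which makes their contribution an
explicit natural number. -/
theorem two_rpow_chainSize_le {ε : ℝ} (hε : 0 < ε) (n T : ℕ) :
    (2 : ℝ) ^ ((1 - ε) * (chainSize n T : ℝ)) ≤
      2 ^ ((1 - ε) * (n : ℝ)) * ((2 ^ (4 * T * Nat.size n) * 2 ^ T : ℕ) : ℝ) := by
  have e : ((2 ^ (4 * T * Nat.size n) * 2 ^ T : ℕ) : ℝ)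
      = 2 ^ ((T * (2 * (2 * Nat.size n) + 1) : ℕ) : ℝ) := by
    rw [← pow_add, Real.rpow_natCast]
    push_cast
    ring_nf
  rw [e, ← Real.rpow_add two_pos]
  refine Real.rpow_le_rpow_of_exponent_le (by norm_num) ?_
  rw [chainSize, Nat.cast_add]
  have : (0 : ℝ) ≤ ((T * (2 * (2 * Nat.size n) + 1) : ℕ) : ℝ) := Nat.cast_nonneg _
  nlinarith

/-- The preparation costs 2^(ηn) with η ≤ 1/2. The call costs 2^(Kηn) for the size of the family
and, up to a polynomial, 2^((1-ε)n) for the universe, which together leave a gain of ε/2. -/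
theorem solvableInTime_hasSetPartition {ε : ℝ} (hε : 0 < ε)
    (h : SolvableInTime SetInstance.HasSetCover (1 - ε)) :
    ∃ ε : ℝ, 0 < ε ∧ SolvableInTime SetInstance.HasSetPartition (1 - ε) := by
  obtain ⟨p, C, K, hp⟩ := h
  -- The choice gives Kη ≤ ε/2; the denominator K + 1 also serves K = 0.
  set η : ℝ := min (1 / 2) (ε / (2 * (K + 1))) with hη
  have hη0 : 0 < η := lt_min (by norm_num) (by positivity)
  have hη1 : η ≤ 1 / 2 := min_le_left _ _
  have hηK : K * η ≤ ε / 2 := by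
    have h1 : η ≤ ε / (2 * (K + 1)) := min_le_right _ _
    rw [le_div_iff₀ (by positivity)] at h1
    nlinarith
  obtain ⟨D, hD0, hD⟩ := exists_smallSets_le hη0
  set T := 2 * D with hT
  have hsmall : OStar η fun I => (smallSets I.n (I.n / D) : ℝ) :=
    (OStar.two_pow η).mono le_rfl fun I => hD I.n
  refine ⟨min (1 / 2) (ε / 2), lt_min (by norm_num) (by positivity), ?_⟩
  have hm1 : min (1 / 2) (ε / 2) ≤ 1 / 2 := min_le_left _ _
  have hm2 : min (1 / 2) (ε / 2) ≤ ε / 2 := min_le_right _ _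
  set sJ : SetInstance → ℕ := fun I => (chainSize I.n T + 1) *
    (chainCount I.n T (packBound I.n I.m (I.n / D)) + 1) + Nat.size T with hsJ
  have c : ∀ c : ℕ, OStar η fun _ => (c : ℝ) := fun c =>
    (ostar_natConst c).mono hη0.le fun _ => le_rfl
  have hsJ' : OStar η fun I => (sJ I : ℝ) :=
    ((((ostar_chainCount hη0.le hsmall T).natAdd (c 1)).natMul
      ((ostar_chainSize T).natAdd (ostar_natConst 1))).natAdd (c (Nat.size T))).mono le_rfl
      fun I => Nat.cast_le.2 (le_of_eq (by simp only [hsJ]; ring))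
  refine solvableInTime_of_cmd (by linarith) hp (partCmd D T) (300 + 10 * T)
    (fun I => partTime I.n I.m (I.n / D) T)
    (fun I => |C| * (sJ I : ℝ) ^ K * (2 ^ ((1 - ε) * (I.n : ℝ)) *
      ((2 ^ (4 * T * Nat.size I.n) * 2 ^ T : ℕ) : ℝ))) (by omega)
    ((ostar_partTime hη0.le hsmall T).mono (by linarith) fun _ => le_rfl) ?_
    fun I σ hσ _ => (tr_partCmd (D := D) (by omega) hσ).conseq
      (fun σ' ⟨len, cd, hlen, hcd, hJ, h4⟩ => ⟨_, hJ, ?_, ?_⟩) le_rfl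
  · exact (((OStar.const |C|).mul (hsJ'.pow (fun _ => Nat.cast_nonneg _) K)
      fun I => by positivity).mul ((OStar.two_pow (1 - ε)).mul
        ((ostar_two_pow_size (4 * T)).natMul (ostar_natConst (2 ^ T)))
        fun I => Nat.cast_nonneg _) fun I => by positivity).mono (by linarith) fun _ => le_rfl
  · have h1 : (SetInstance.ofSets (chainSize I.n T) (chainCount I.n T len) T
        (chainRow I.n (I.m + 1) T (2 * Nat.size I.n) I.s (emptyCount I.m I.nbr) cd)).size
        ≤ sJ I := by
      show (chainSize I.n T + 1) * (chainCount I.n T len + 1) + Nat.size T ≤ _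
      have : chainCount I.n T len ≤ chainCount I.n T (packBound I.n I.m (I.n / D)) :=
        Nat.mul_le_mul_right _ (Nat.mul_le_mul_right _ hlen)
      simp only [hsJ]
      gcongr
    have h2 := two_rpow_chainSize_le hε I.n T
    refine mul_le_mul ?_ h2 (by positivity) (by positivity)
    refine mul_le_mul (le_abs_self C) ?_ (by positivity) (abs_nonneg C)
    exact pow_le_pow_left₀ (Nat.cast_nonneg _) (Nat.cast_le.2 h1) K
  · have hB : (I.n + 1) * (I.n + 1) ≤ 2 ^ (2 * Nat.size I.n) := by
      have := Nat.lt_size_self I.n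
      rw [two_mul, pow_add]
      exact Nat.mul_le_mul this this
    rw [SetInstance.hasSetPartition_iff_nbr, hasPartition_iff I.nbr_subset hD0 hB hcd,
      SetInstance.hasSetCover_iff (SetInstance.ofSets_mem _ _ _ _)]
    simp only [h4, ne_eq, not_true_eq_false, false_or]
    rfl

end RAM

theorem mainTheorem9 :
    (∃ ε : ℝ, 0 < ε ∧ SolvableInTime SetInstance.HasSetCover (1 - ε)) ↔
      (∃ ε' : ℝ, 0 < ε' ∧ SolvableInTime SetInstance.HasSetPartition (1 - ε')) :=
  ⟨fun ⟨_, hε, h⟩ => RAM.solvableInTime_hasSetPartition hε h,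
    fun ⟨_, hε, h⟩ => RAM.solvableInTime_hasSetCover hε h⟩
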